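/- Let $\mathcal C=\mathbb T\times[0,1]$, with points $(z,t)$, $z=e^{i\phi}$, and let $\mathcal C_1=\mathbb T\times[0,1)$. Let $$\mathcal R(z,t)=\left(\frac{z^2+t^2}{z^{-2}+t^2},\ \frac{z^2+z^{-2}+2}{z^2+z^{-2}+t^2+t^{-2}}\right)$$ (extended by continuity to $t=0$) be the Migdal–Kadanoff renormalization map; on $\mathcal C$ it is defined except at $\alpha_\pm=(\pm i,1)$. Let $\mathcal A_1=\mathcal R^{-1}\{\alpha_\pm\}\subset\mathbb T\times\{1\}$ (four points). **Cones.** Put $\tau=1-t$ and let $|\epsilon|$ be the angular distance from $\phi$ to the nearer of $\pm\pi/2$ in $\mathbb R/2\pi\mathbb Z$. For $\bar\epsilon,\kappa>0$ put $\bar\tau=\bar\epsilon^2/18$. A continuous function $s$ on $\mathcal C$ is called a *$(\kappa,\bar\epsilon)$-slope* if $s\ge\sqrt{1-t^2}$ everywhere; $s=\sqrt{1-t^2}$ wherever $\tau>\bar\tau$ or $\tau>\epsilon^2/18$; $s=\sqrt{\bar\tau(2-\bar\tau)}$ where $\tau\le\bar\tau$ and $|\epsilon|\ge\bar\epsilon$;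 and $\bigl|s-|\epsilon|/3\bigr|\le\kappa|\epsilon|/3$ where $\tau\le\epsilon^2/18$ and $|\epsilon|<\bar\epsilon$. The vertical cone field of $s$ is $\mathcal K^v(x)=\{|dt|\ge s(x)|d\phi|\}$. **Line fields.** A *central line field* is a field of tangent lines $\mathcal L(x)\subset\mathcal K^v(x)$, $x\in\mathcal C\setminus\{\alpha_\pm\}$, with $D\mathcal R_x\mathcal L(x)\subset\mathcal L(\mathcal Rx)$ for $x\notin\{\alpha_\pm\}\cup\mathcal A_1$, and continuous on $\mathcal C\setminus(\{\alpha_\pm\}\cup\mathcal A_1)$. **Laminations.** A *proper curve* is a continuous $\gamma:[0,1]\to\mathbb T$, identified with the graph $\{(\gamma(t),t)\}$. It is *strictly vertical* if on $[0,1)$ it is $C^1$ with $s\,|d\phi/dt|<1$. A *strictly vertical lamination* is a family of strictly vertical proper curves (leaves), disjoint in $\mathcal C_1$, with local product structure: for every leaf $\gamma_0$ and $t_0\in[0,1)$ there is $\varepsilon>0$ such that the leaves passing near $(\gamma_0(t_0),t_0)$, restricted to $|t-t_0|<\varepsilon$, $t<1$, depend continuously in the uniform $C^1$ topology on the parameter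 $\gamma(t_0)$. For a family $\mathcal F$ of proper curves, $(\mathcal R^n)^*\mathcal F$ is the family of all proper curves whose part in $\mathcal C_1$ is mapped by $\mathcal R^n$ into a single curve of $\mathcal F$. A *central foliation* is a strictly vertical lamination whose leaves fill $\mathcal C_1$ and which satisfies $\mathcal R^*\mathcal F=\mathcal F$. Families of proper curves are compared by the Hausdorff distance $\operatorname{dist}_H$ of subsets of $C^0([0,1],\mathbb T)$ with the uniform metric. **Lee–Yang loci.** Let $\Gamma_0$ be an edge $ab$, and let $\Gamma_{n+1}$ be obtained by replacing each of the four edges $ac,cb,ad,db$ of a diamond by a copy of $\Gamma_n$. Let $Z_n(z,t)=\sum_\sigma t^{-I(\sigma)/2}z^{-M(\sigma)}$ be the Ising partition function of $\Gamma_n$, where, summing over the edges $\{v,w\}$ of $\Gamma_n$, $I(\sigma)=\sum\sigma(v)\sigma(w)$ and $M(\sigma)=\frac12\sum(\sigma(v)+\sigma(w))$. The *Lee–Yang locus* $\mathcal S_n$ is the family of proper curves along which $t^{4^n/2}Z_n$ (a polynomial in $t$) vanishes. **Theorem.** There are a line field $\mathcal L^c$, $\kappa>0$ and $\lambda\in(0,1)$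 such that the following hold for all $0<\bar\epsilon<\kappa$ and every $(\kappa,\bar\epsilon)$-slope $s$. 1. $\mathcal L^c$ is a central line field, and any central line field coincides with it on $\mathcal C\setminus(\{\alpha_\pm\}\cup\mathcal A_1)$. 2. $\mathcal L^c$ is uniquely integrable on $\mathcal C_1$: two integral curves of $\mathcal L^c$ over the same $t$-interval that meet in $\mathcal C_1$ coincide. The family $\mathcal F^c$ of all proper integral curves of $\mathcal L^c$ (tangent to $\mathcal L^c$ off $\{\alpha_\pm\}\cup\mathcal A_1$) is a central foliation, and it is the only one. 3. For every nonempty strictly vertical lamination $\mathcal F$ there is $C>0$ with $\operatorname{dist}_H((\mathcal R^n)^*\mathcal F,\mathcal F^c)\le C\lambda^n$ for all $n\ge0$ ($\lambda$ does not depend on $\mathcal F$). 4. There is $C>0$ with $\operatorname{dist}_H(\mathcal S_n,\mathcal F^c)\le C\lambda^n$ for all $n\ge0$. -/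

import Mathlib

open Set

namespace DHL

noncomputable section

/-! ### The cylinder and the renormalization map -/

/-- The cylinder `𝒞 = 𝕋 × [0,1]`; a point is `(z, t)` with `|z| = 1`, `z = exp (i φ)`. -/
abbrev Cyl : Type := Circle × unitInterval

/-- The inclusion of the cylinder in `ℂ²`. -/
def emb (x : Cyl) : ℂ × ℂ := ((x.1 : ℂ), ((x.2 : ℝ) : ℂ))

/-- The Migdal-Kadanoff renormalization map
`(z,t) ↦ ((z² + t²)/(z⁻² + t²), (z² + z⁻² + 2)/(z² + z⁻² + t² + t⁻²))`,
with the second fraction expanded by `t²`, so that it makes sense at `t = 0`. -/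
def RG (p : ℂ × ℂ) : ℂ × ℂ :=
  ((p.1 ^ 2 + p.2 ^ 2) / ((p.1 ^ 2)⁻¹ + p.2 ^ 2),
    p.2 ^ 2 * (p.1 ^ 2 + (p.1 ^ 2)⁻¹ + 2) /
      (p.2 ^ 2 * (p.1 ^ 2 + (p.1 ^ 2)⁻¹) + p.2 ^ 4 + 1))

/-- The two indeterminacy points `α₊ = (i, 1)` and `α₋ = (-i, 1)`. -/
def Indet : Set Cyl := {x | (x.1 : ℂ) ^ 2 = -1 ∧ x.2 = 1}

/-- The first preimages of the indeterminacy points (four points of the top circle). -/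
def PreIndet : Set Cyl := {x | x ∉ Indet ∧ ∃ y ∈ Indet, RG (emb x) = emb y}

/-! ### Curves in the cylinder, as graphs over the `t`-interval -/

/-- Curves `φ = γ(t)`, `0 ≤ t ≤ 1`, joining the bottom of the cylinder to the top, with the
uniform (`C⁰`) metric. -/
abbrev Curve : Type := C(unitInterval, Circle)

/-- The point of the cylinder at height `t` on the curve. -/
def pt (γ : Curve) (t : unitInterval) : Cyl := (γ t, t)

/-- The curve as a function of a real parameter with complex values (extended by constants). -/
def toFun (γ : Curve) (r : ℝ) : ℂ := (γ (projIcc 0 1 zero_le_one r) : ℂ)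

/-- `dφ/dt = v` along `γ` at height `t`, the derivative being taken within `S`. -/
def HasAngDerivWithin (γ : Curve) (v : ℝ) (S : Set ℝ) (t : unitInterval) : Prop :=
  HasDerivWithinAt (toFun γ) ((v : ℂ) * (Complex.I * (γ t : ℂ))) S (t : ℝ)

/-- The angular velocity `dφ/dt` of `γ` at height `t`. -/
def angVel (γ : Curve) (t : unitInterval) : ℝ :=
  (derivWithin (toFun γ) (Icc 0 1) (t : ℝ) / (Complex.I * (γ t : ℂ))).re

/-! ### The cone fields

A horizontal cone field is given by its slope function `s`:
`𝒦ʰ(x) = {(dφ, dt) : |dt| < s(x) |dφ|}`.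
The vertical cone `𝒦ᵛ(x)` is the complement, `|dt| ≥ s(x) |dφ|`. -/

/-- The slope of the algebraic cone field, bounded by the tangent lines to the two rotated copies
of the curve `t = - cos φ` through the point. -/
def algSlope (x : Cyl) : ℝ := Real.sqrt (1 - (x.2 : ℝ) ^ 2)

/-- `|ε|`, the angular distance to the nearer of the two angles `φ = ± π/2`. -/
def epsAbs (x : Cyl) : ℝ := |Real.pi / 2 - abs (Complex.arg (x.1 : ℂ))|

/-- `τ = 1 - t`. -/
def tau (x : Cyl) : ℝ := 1 - (x.2 : ℝ)

/-- Slope functions of the modified horizontal cone fields with thresholds `εb` and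
`τb = εb² / 18`.  It is the algebraic cone field except at the points near the top which lie above
the parabolas `τ = ε² / 18`.  There the slope is `√(τb (2 - τb))` when `|ε| ≥ εb`, and
`|ε| / 3` up to a relative error of at most `κ` when `|ε| < εb`. -/
structure IsModifiedSlope (κ εb : ℝ) (s : Cyl → ℝ) : Prop where
  continuous : Continuous s
  alg_le : ∀ x, algSlope x ≤ s x
  white : ∀ x, ¬ (tau x ≤ εb ^ 2 / 18 ∧ tau x ≤ epsAbs x ^ 2 / 18) → s x = algSlope x
  grey : ∀ x, tau x ≤ epsAbs x ^ 2 / 18 → epsAbs x < εb →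
    |s x - epsAbs x / 3| ≤ κ * (epsAbs x / 3)
  black : ∀ x, tau x ≤ εb ^ 2 / 18 → εb ≤ epsAbs x →
    s x = Real.sqrt (εb ^ 2 / 18 * (2 - εb ^ 2 / 18))

/-! ### Central line fields -/

/-- The tangent vector `(dφ, dt) = (v, 1)` at `x`, as a vector of `ℂ²`. -/
def tangentVec (x : Cyl) (v : ℝ) : ℂ × ℂ := ((v : ℂ) * (Complex.I * (x.1 : ℂ)), 1)

/-- A line in a vertical cone is spanned by a unique vector `(dφ, dt) = (ℓ, 1)`, so a vertical line
field is given by a function `ℓ`.  It is central if it lies in the vertical cones and is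
invariant under the differential of the renormalization map (where the latter is defined), and
continuous away from the indeterminacy points and their four preimages. -/
structure IsCentralLineField (s : Cyl → ℝ) (l : Cyl → ℝ) : Prop where
  vertical : ∀ x, x ∉ Indet → s x * |l x| ≤ 1
  invariant : ∀ x y, x ∉ Indet → y ∉ Indet → RG (emb x) = emb y →
    ∃ c : ℝ, fderiv ℂ RG (emb x) (tangentVec x (l x)) = c • tangentVec y (l y)
  continuousOn : ContinuousOn l (Indet ∪ PreIndet)ᶜ

/-- `γ` is tangent to the line field `l` over the interval `[a, b]`
(away from the indeterminacy points and their preimages on the top). -/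
def IsIntegralOn (l : Cyl → ℝ) (γ : Curve) (a b : ℝ) : Prop :=
  ∀ t : unitInterval, (t : ℝ) ∈ Icc a b → pt γ t ∉ Indet ∪ PreIndet →
    HasAngDerivWithin γ (l (pt γ t)) (Icc a b) t

/-- The family of all proper integral curves of the line field. -/
def integralCurves (l : Cyl → ℝ) : Set Curve := {γ | IsIntegralOn l γ 0 1}

/-- Unique integrability on the topless cylinder: two integral curves over the same interval
which meet below the top coincide over that interval. -/
def UniquelyIntegrable (l : Cyl → ℝ) : Prop :=
  ∀ (γ₁ γ₂ : Curve) (a b : unitInterval), IsIntegralOn l γ₁ a b → IsIntegralOn l γ₂ a b →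
    ∀ t ∈ Icc a b, t < 1 → γ₁ t = γ₂ t → ∀ u ∈ Icc a b, γ₁ u = γ₂ u

/-! ### Vertical laminations -/

/-- A proper strictly vertical curve: it is `C¹` on the topless cylinder and goes there through
the interiors of the vertical cones; it extends continuously to the top. -/
structure IsStrictlyVertical (s : Cyl → ℝ) (γ : Curve) : Prop where
  hasDeriv : ∀ t : unitInterval, t < 1 → HasAngDerivWithin γ (angVel γ t) (Icc 0 1) t
  continuousOn : ContinuousOn (angVel γ) {t | t < 1}
  vertical : ∀ t : unitInterval, t < 1 → s (pt γ t) * |angVel γ t| < 1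

/-- A (proper) strictly vertical lamination: a family of proper strictly vertical curves, disjoint
on the topless cylinder, with a local product structure: the leaves passing near a point of height
`t₀ < 1` of a leaf depend `C¹`-continuously, near the height `t₀`, on their position at
height `t₀`. -/
structure IsVerticalLamination (s : Cyl → ℝ) (F : Set Curve) : Prop where
  vertical : ∀ γ ∈ F, IsStrictlyVertical s γ
  disjoint : ∀ γ₁ ∈ F, ∀ γ₂ ∈ F, ∀ t : unitInterval, t < 1 → γ₁ t = γ₂ t → γ₁ = γ₂
  product : ∀ γ₀ ∈ F, ∀ t₀ : unitInterval, t₀ < 1 → ∃ ε > (0 : ℝ), ∃ ρ > (0 : ℝ),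
    ∀ γ₁ ∈ F, dist (γ₁ t₀) (γ₀ t₀) < ρ → ∀ η > (0 : ℝ), ∃ δ > (0 : ℝ),
      ∀ γ₂ ∈ F, dist (γ₂ t₀) (γ₁ t₀) < δ → ∀ t : unitInterval, t < 1 → dist t t₀ < ε →
        dist (γ₂ t) (γ₁ t) < η ∧ |angVel γ₂ t - angVel γ₁ t| < η

/-- The pullback `(Rⁿ)^* F`: all proper curves which `Rⁿ` maps, below the top, into a
leaf of `F`. -/
def pullback (n : ℕ) (F : Set Curve) : Set Curve :=
  {δ | ∃ γ ∈ F, ∀ t : unitInterval, t < 1 → ∃ u : unitInterval, RG^[n] (emb (pt δ t)) = emb (pt γ u)}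

/-- A central foliation: a strictly vertical lamination filling in the topless cylinder,
which is invariant under pullback by the renormalization map. -/
structure IsCentralFoliation (s : Cyl → ℝ) (F : Set Curve) : Prop where
  lamination : IsVerticalLamination s F
  fills : ∀ (z : Circle) (t : unitInterval), t < 1 → ∃ γ ∈ F, γ t = z
  invariant : pullback 1 F = F

/-! ### The Ising model on the diamond hierarchical lattice and the Lee-Yang loci -/

/-- The unmarked vertices of the graph `Γₙ`.  The graph `Γₙ₊₁` is the diamond with vertices
`a, b, c, d` in which each of the four edges is replaced by a copy of `Γₙ`. -/
def Inner : ℕ → Type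
  | 0 => Empty
  | n + 1 => Bool ⊕ (Fin 4 × Inner n)

/-- The vertices of `Γₙ`: the marked vertices `a = inl false`, `b = inl true`, and the others. -/
abbrev Vertex (n : ℕ) : Type := Bool ⊕ Inner n

/-- The edges of `Γₙ`. -/
def Edge : ℕ → Type
  | 0 => Unit
  | n + 1 => Fin 4 × Edge n

instance instFintypeInner : (n : ℕ) → Fintype (Inner n)
  | 0 => inferInstanceAs (Fintype Empty)
  | n + 1 =>
    letI := instFintypeInner n
    inferInstanceAs (Fintype (Bool ⊕ (Fin 4 × Inner n)))

instance instDecidableEqInner : (n : ℕ) → DecidableEq (Inner n)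
  | 0 => inferInstanceAs (DecidableEq Empty)
  | n + 1 =>
    letI := instDecidableEqInner n
    inferInstanceAs (DecidableEq (Bool ⊕ (Fin 4 × Inner n)))

instance instFintypeEdge : (n : ℕ) → Fintype (Edge n)
  | 0 => inferInstanceAs (Fintype Unit)
  | n + 1 =>
    letI := instFintypeEdge n
    inferInstanceAs (Fintype (Fin 4 × Edge n))

/-- The position in `Γₙ₊₁` of the marked vertex `a` (`end_ = false`) or `b` (`end_ = true`) of the
`k`-th copy of `Γₙ`; the four edges of the diamond are `ac`, `cb`, `ad`, `db`. -/
def corner (n : ℕ) (k : Fin 4) (end_ : Bool) : Vertex (n + 1) :=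
  match k, end_ with
  | 0, false => Sum.inl false
  | 0, true => Sum.inr (Sum.inl false)
  | 1, false => Sum.inr (Sum.inl false)
  | 1, true => Sum.inl true
  | 2, false => Sum.inl false
  | 2, true => Sum.inr (Sum.inl true)
  | 3, false => Sum.inr (Sum.inl true)
  | 3, true => Sum.inl true

/-- The `k`-th copy of `Γₙ` in `Γₙ₊₁`. -/
def copy (n : ℕ) (k : Fin 4) : Vertex n → Vertex (n + 1)
  | Sum.inl e => corner n k e
  | Sum.inr v => Sum.inr (Sum.inr (k, v))

/-- The two endpoints of an edge of `Γₙ`. -/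
def ends : (n : ℕ) → Edge n → Vertex n × Vertex n
  | 0, _ => (Sum.inl false, Sum.inl true)
  | n + 1, (k, e) => (copy n k (ends n e).1, copy n k (ends n e).2)

/-- The Gibbs weight of a bond with spins `x`, `y` (`true` is `+1`): `z⁻¹ t^(-1/2)` for `++`,
`z t^(-1/2)` for `--`, `t^(1/2)` for `+-`; all multiplied by `t^(1/2)`. -/
def bondWeight (z t : ℂ) (x y : Bool) : ℂ :=
  if x = y then (if x = true then z⁻¹ else z) else t

/-- The partition function `∑ t^(-I(σ)/2) z^(-M(σ))` of the Ising model on `Γₙ`, multiplied by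
`t^(|E|/2)`, where `|E| = 4ⁿ` is the number of edges. -/
def partitionFn (n : ℕ) (z t : ℂ) : ℂ :=
  ∑ σ : Vertex n → Bool, ∏ e : Edge n, bondWeight z t (σ (ends n e).1) (σ (ends n e).2)

/-- The Lee-Yang locus of level `n`, as the family of the proper curves of zeros of the partition
function in the cylinder. -/
def leeYang (n : ℕ) : Set Curve :=
  {γ | ∀ t : unitInterval, partitionFn n (γ t : ℂ) ((t : ℝ) : ℂ) = 0}

end

end DHL

/-!
The proof takes place on the universal cover of the topless cylinder, in the coordinates `(φ, ψ)`
with `t = sin ψ`, `0 ≤ ψ < π/2`. There the renormalization map lifts to a map `liftMap` of a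
strip, and the algebraic cones become the constant cones `|dψ| < |dφ|`, so that the geometry is
that of two-dimensional Minkowski space with `ψ` as the time. Two points are *causal* if `|Δφ| ≤
|Δψ|`, and a curve is causal if all pairs of its points are, i.e. if it is the graph of a
1-Lipschitz function of `ψ`.

Everything rests on the cone estimates for the differential, `le_jA_add` and `abs_jC_add_le`: for
`|e| ≤ 1` a vector `(1, e)` is mapped to a vector of horizontal size at least `2 - |e|` whose
slope is at most `3/4`. They are checked on null vectors, where they reduce to explicit polynomial
inequalities, and extend by convexity. Integrated along segments (`liftMap_expansion`) they say
that pairs of points which are not causal stay so, and that points at the same height separate at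
least by the factor `5/4` at each step (`iterate_expansion`). Hence every horizontal line meets
the preimage of a causal curve in one point, these preimages are again causal (`pull`), and two
curves of which the `n`-th images stay at a bounded angular distance are `O((4/5)ⁿ)`-close
(`dist_le_of_image`). This is the only source of the exponential rate.

A curve is *central* if all its images are causal. Through each point there is one, a limit of
pullbacks of vertical segments (`exists_isCentralOn`), and it is unique since two central curves
which meet have images at a bounded distance (`IsCentralOn.eqOn`). Infinitesimally, a vector is
central if all its images lie in the vertical cones; the cones contract projectively by `24/25` at
each step (`form_le_of_cone`, `area_le`), so there is one central direction at each point. Its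
slope has a closed graph and so is continuous. Central curves are exactly the integral curves of
this slope: limit slopes of central curves are central, and along the images of an integral curve
`ψ ± φ` are monotone. This gives the central line field, its uniqueness and its unique
integrability. Near the top of the cylinder the invariance of the line field bounds it by `2 / (t²
|cos φ|)` (`centralField_bound`), which puts it inside the modified cones, and shows that it tends
to the kernel `dφ/dt = tan φ` of the differential on the top circle.

The leaves of an invariant strictly vertical foliation have only causal images, so they are
central; thus the central foliation is unique. If `F` is a lamination, then the `n`-th image of a
curve of its `n`-fold pullback lies in a causal curve, as does that of a central leaf, and both
vary by `π/2` at most, so these curves and leaves approximate each other.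

The partition functions of `Γₙ` conditioned on the spins of the marked vertices satisfy the
recursion `condPart_succ`, whence they are those of a single edge at the `n`-times renormalized
parameters, up to a nonvanishing factor. So the Lee-Yang locus of level `n` consists of the curves
which the `n`-th iterate maps into the set `t = - cos φ` (`mem_leeYang_iff`). In our coordinates
this set is made of the causal curves `φ = π/2 + ψ`, `φ = -π/2 - ψ` and their translates by `2π`.
There `cos φ ≤ 0`, so the angle of the `n`-th image cannot vary by more than `2π`, and the same
comparison applies.
-/

namespace DHL

open Filter Topology
open Real hiding pi

/-! ### The renormalization map on the universal cover -/

/-- The square modulus of `z² + t²` for `z = exp (i φ)`. -/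
noncomputable def den (φ t : ℝ) : ℝ := (1 - t ^ 2) ^ 2 + 4 * t ^ 2 * cos φ ^ 2

/-- A continuous branch of the angle of the first coordinate of the renormalization map. -/
noncomputable def angleMap (φ t : ℝ) : ℝ :=
  4 * φ - 2 * arctan (2 * t ^ 2 * sin φ * cos φ / (1 - t ^ 2 + 2 * t ^ 2 * cos φ ^ 2))

/-- The second coordinate of the renormalization map. -/
noncomputable def heightMap (φ t : ℝ) : ℝ := 4 * t ^ 2 * cos φ ^ 2 / den φ t

/-- `∂φ'/∂φ`. -/
noncomputable def dA (φ t : ℝ) : ℝ := 4 * (1 - t ^ 2 + 2 * t ^ 2 * cos φ ^ 2) / den φ t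

/-- `∂φ'/∂t`. -/
noncomputable def dB (φ t : ℝ) : ℝ := -(8 * t * sin φ * cos φ) / den φ t

/-- `∂t'/∂φ`. -/
noncomputable def dC (φ t : ℝ) : ℝ :=
  -(8 * t ^ 2 * sin φ * cos φ * (1 - t ^ 2) ^ 2) / den φ t ^ 2

/-- `∂t'/∂t`. -/
noncomputable def dD (φ t : ℝ) : ℝ :=
  8 * t * cos φ ^ 2 * (1 - t ^ 2) * (1 + t ^ 2) / den φ t ^ 2

/-- The topless cylinder `t < 1` in the coordinates `(φ, ψ)`, `t = sin ψ`, on its universal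
cover. -/
def strip : Set (ℝ × ℝ) := {x | x.2 ∈ Ico 0 (π / 2)}

/-- The lift of the renormalization map to the universal cover of the topless cylinder, in the
coordinates `(φ, ψ)`, `t = sin ψ`, in which the algebraic cones become `|dψ| < |dφ|`. -/
noncomputable def liftMap (x : ℝ × ℝ) : ℝ × ℝ :=
  (angleMap x.1 (sin x.2), arcsin (heightMap x.1 (sin x.2)))

/-- `√(1 - t'²)`, the conversion factor between `dψ'` and `dt'`. -/
noncomputable def cosHeight (φ t : ℝ) : ℝ := √(1 - heightMap φ t ^ 2)

/-- `∂φ'/∂φ` in the coordinates `(φ, ψ)`. -/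
noncomputable def jA (x : ℝ × ℝ) : ℝ := dA x.1 (sin x.2)

/-- `∂φ'/∂ψ` in the coordinates `(φ, ψ)`. -/
noncomputable def jB (x : ℝ × ℝ) : ℝ := dB x.1 (sin x.2) * cos x.2

/-- `∂ψ'/∂φ` in the coordinates `(φ, ψ)`. -/
noncomputable def jC (x : ℝ × ℝ) : ℝ := dC x.1 (sin x.2) / cosHeight x.1 (sin x.2)

/-- `∂ψ'/∂ψ` in the coordinates `(φ, ψ)`. -/
noncomputable def jD (x : ℝ × ℝ) : ℝ := dD x.1 (sin x.2) * cos x.2 / cosHeight x.1 (sin x.2)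

/-- The differential of the lifted map. -/
noncomputable def jac (x : ℝ × ℝ) : ℝ × ℝ →L[ℝ] ℝ × ℝ :=
  (jA x • ContinuousLinearMap.fst ℝ ℝ ℝ + jB x • ContinuousLinearMap.snd ℝ ℝ ℝ).prod
    (jC x • ContinuousLinearMap.fst ℝ ℝ ℝ + jD x • ContinuousLinearMap.snd ℝ ℝ ℝ)

lemma jac_apply (x v : ℝ × ℝ) :
    jac x v = (jA x * v.1 + jB x * v.2, jC x * v.1 + jD x * v.2) := by
  simp [jac]

lemma den_pos {φ t : ℝ} (h0 : 0 ≤ t) (h1 : t < 1) : 0 < den φ t := by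
  have : 0 < 1 - t ^ 2 := by nlinarith
  unfold den; positivity

lemma num_pos {φ t : ℝ} (h0 : 0 ≤ t) (h1 : t < 1) : 0 < 1 - t ^ 2 + 2 * t ^ 2 * cos φ ^ 2 := by
  have : 0 < 1 - t ^ 2 := by nlinarith
  positivity

lemma heightMap_nonneg {φ t : ℝ} : 0 ≤ heightMap φ t := by
  unfold heightMap den; positivity

lemma heightMap_lt_one {φ t : ℝ} (h0 : 0 ≤ t) (h1 : t < 1) : heightMap φ t < 1 := by
  have h2 := den_pos (φ := φ) h0 h1
  have : 0 < 1 - t ^ 2 := by nlinarith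
  rw [heightMap, div_lt_one h2, den]
  have : 0 < (1 - t ^ 2) ^ 2 := by positivity
  linarith

lemma sin_mem {ψ : ℝ} (h : ψ ∈ Ico 0 (π / 2)) : 0 ≤ sin ψ ∧ sin ψ < 1 := by
  refine ⟨sin_nonneg_of_nonneg_of_le_pi h.1 (by linarith [h.2, pi_pos]), ?_⟩
  rw [← sin_pi_div_two]
  exact sin_lt_sin_of_lt_of_le_pi_div_two (by linarith [h.1, pi_pos]) le_rfl h.2

lemma cos_pos_of_mem {ψ : ℝ} (h : ψ ∈ Ico 0 (π / 2)) : 0 < cos ψ :=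
  cos_pos_of_mem_Ioo ⟨by linarith [h.1, pi_pos], h.2⟩

lemma arcsin_mem {t : ℝ} (h0 : 0 ≤ t) (h1 : t < 1) : arcsin t ∈ Ico 0 (π / 2) :=
  ⟨arcsin_nonneg.2 h0, arcsin_lt_pi_div_two.2 h1⟩

lemma liftMap_mem {x : ℝ × ℝ} (hx : x ∈ strip) : liftMap x ∈ strip :=
  arcsin_mem heightMap_nonneg (heightMap_lt_one (sin_mem hx).1 (sin_mem hx).2)

lemma sin_liftMap {x : ℝ × ℝ} (hx : x ∈ strip) :
    sin (liftMap x).2 = heightMap x.1 (sin x.2) :=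
  sin_arcsin (by linarith [heightMap_nonneg (φ := x.1) (t := sin x.2)])
    (heightMap_lt_one (sin_mem hx).1 (sin_mem hx).2).le

lemma iterate_mem {x : ℝ × ℝ} (hx : x ∈ strip) (n : ℕ) : liftMap^[n] x ∈ strip := by
  induction n with
  | zero => exact hx
  | succ n ih => rw [Function.iterate_succ_apply']; exact liftMap_mem ih

lemma cosHeight_pos {φ t : ℝ} (h0 : 0 ≤ t) (h1 : t < 1) : 0 < cosHeight φ t := by
  have := heightMap_lt_one (φ := φ) h0 h1
  have := heightMap_nonneg (φ := φ) (t := t)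
  exact sqrt_pos.2 (by nlinarith)

/-- The derivative of the angle along a curve `(φ(r), t(r))`. -/
lemma hasDerivAt_angleMap {φ t : ℝ → ℝ} {φ' t' r : ℝ} (hφ : HasDerivAt φ φ' r)
    (ht : HasDerivAt t t' r) (h0 : 0 ≤ t r) (h1 : t r < 1) :
    HasDerivAt (fun r => angleMap (φ r) (t r)) (dA (φ r) (t r) * φ' + dB (φ r) (t r) * t') r := by
  have hW := (den_pos (φ := φ r) h0 h1).ne'
  have hN := (num_pos (φ := φ r) h0 h1).ne'
  have t2 := ht.fun_pow 2
  have c2 := hφ.cos.fun_pow 2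
  have hn := ((t2.const_mul 2).fun_mul hφ.sin).fun_mul hφ.cos
  have hd := (t2.const_sub 1).fun_add ((t2.const_mul 2).fun_mul c2)
  have h := (hφ.const_mul 4).fun_sub (((hn.fun_div hd hN).arctan).const_mul 2)
  refine h.congr_deriv ?_
  have key : (1 - t r ^ 2 + 2 * t r ^ 2 * cos (φ r) ^ 2) ^ 2
      + (2 * t r ^ 2 * sin (φ r) * cos (φ r)) ^ 2 = den (φ r) (t r) := by
    unfold den
    linear_combination (4 * (t r ^ 4) * cos (φ r) ^ 2) * (sin_sq_add_cos_sq (φ r))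
  have key2 : 1 + ((2 * t r ^ 2 * sin (φ r) * cos (φ r)) /
      (1 - t r ^ 2 + 2 * t r ^ 2 * cos (φ r) ^ 2)) ^ 2
      = den (φ r) (t r) / (1 - t r ^ 2 + 2 * t r ^ 2 * cos (φ r) ^ 2) ^ 2 := by
    rw [← key]; field_simp
  rw [key2, dA, dB]
  have hs : sin (φ r) ^ 2 = 1 - cos (φ r) ^ 2 := sin_sq _
  field_simp
  unfold den
  norm_num
  ring_nf
  simp only [hs]
  ring

lemma hasDerivAt_heightMap {φ t : ℝ → ℝ} {φ' t' r : ℝ} (hφ : HasDerivAt φ φ' r)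
    (ht : HasDerivAt t t' r) (h0 : 0 ≤ t r) (h1 : t r < 1) :
    HasDerivAt (fun r => heightMap (φ r) (t r))
      (dC (φ r) (t r) * φ' + dD (φ r) (t r) * t') r := by
  have hW := (den_pos (φ := φ r) h0 h1).ne'
  have t2 := ht.fun_pow 2
  have c2 := hφ.cos.fun_pow 2
  have hden := ((t2.const_sub 1).fun_pow 2).fun_add ((t2.const_mul 4).fun_mul c2)
  have h := ((t2.const_mul 4).fun_mul c2).fun_div hden hW
  refine h.congr_deriv ?_
  rw [dC, dD, div_mul_eq_mul_div, div_mul_eq_mul_div, ← add_div]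
  change _ / (den (φ r) (t r)) ^ 2 = _
  congr 1
  norm_num
  ring

lemma differentiableAt_liftMap {x : ℝ × ℝ} (hx : x ∈ strip) : DifferentiableAt ℝ liftMap x := by
  obtain ⟨h0, h1⟩ := sin_mem hx
  have hW := (den_pos (φ := x.1) h0 h1).ne'
  have hN := (num_pos (φ := x.1) h0 h1).ne'
  have hT := heightMap_lt_one (φ := x.1) h0 h1
  have hT0 := heightMap_nonneg (φ := x.1) (t := sin x.2)
  have hH : DifferentiableAt ℝ (fun y : ℝ × ℝ => heightMap y.1 (sin y.2)) x := by
    unfold heightMap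
    unfold den at hW ⊢
    fun_prop (disch := exact hW)
  have hP : DifferentiableAt ℝ arcsin (heightMap x.1 (sin x.2)) :=
    differentiableAt_arcsin.2 ⟨by linarith, by linarith⟩
  have hA : DifferentiableAt ℝ (fun y : ℝ × ℝ => angleMap y.1 (sin y.2)) x := by
    have h1 : DifferentiableAt ℝ (fun y : ℝ × ℝ => 2 * sin y.2 ^ 2 * sin y.1 * cos y.1 /
        (1 - sin y.2 ^ 2 + 2 * sin y.2 ^ 2 * cos y.1 ^ 2)) x := by
      fun_prop (disch := exact hN)
    have h2 : DifferentiableAt ℝ (fun y : ℝ × ℝ => 4 * y.1) x := by fun_prop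
    exact h2.fun_sub (h1.arctan.const_mul 2)
  exact hA.prodMk (DifferentiableAt.comp (g := arcsin) x hP hH)

/-- The lifted map along a curve. -/
lemma hasDerivAt_liftMap_comp {φ ψ : ℝ → ℝ} {φ' ψ' r : ℝ} (hφ : HasDerivAt φ φ' r)
    (hψ : HasDerivAt ψ ψ' r) (hx : (φ r, ψ r) ∈ strip) :
    HasDerivAt (fun r => liftMap (φ r, ψ r)) (jac (φ r, ψ r) (φ', ψ')) r := by
  obtain ⟨h0, h1⟩ := sin_mem hx
  have hT := heightMap_lt_one (φ := φ r) h0 h1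
  have hT0 := heightMap_nonneg (φ := φ r) (t := sin (ψ r))
  have hA := hasDerivAt_angleMap hφ hψ.sin h0 h1
  have hH := hasDerivAt_heightMap hφ hψ.sin h0 h1
  have hP := (hasDerivAt_arcsin (x := heightMap (φ r) (sin (ψ r))) (by linarith)
    (by linarith)).comp r hH
  refine (hA.prodMk hP).congr_deriv ?_
  rw [jac_apply, jA, jB, jC, jD, cosHeight]
  ext <;> simp <;> ring

lemma hasFDerivAt_liftMap {x : ℝ × ℝ} (hx : x ∈ strip) : HasFDerivAt liftMap (jac x) x := by
  have h := (differentiableAt_liftMap hx).hasFDerivAt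
  refine h.congr_fderiv (ContinuousLinearMap.ext fun v => ?_)
  have h1 : HasDerivAt (fun r => x.1 + r * v.1) v.1 0 := by
    simpa using ((hasDerivAt_id (0 : ℝ)).mul_const v.1).const_add x.1
  have h2 : HasDerivAt (fun r => x.2 + r * v.2) v.2 0 := by
    simpa using ((hasDerivAt_id (0 : ℝ)).mul_const v.2).const_add x.2
  have h3 := hasDerivAt_liftMap_comp h1 h2 (by simpa using hx)
  have h' : HasFDerivAt liftMap (fderiv ℝ liftMap x) (x.1 + 0 * v.1, x.2 + 0 * v.2) := by
    simpa using h
  have h4 := h'.comp_hasDerivAt (0 : ℝ) (h1.prodMk h2)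
  simpa using h4.unique h3

lemma continuousAt_liftMap {x : ℝ × ℝ} (hx : x ∈ strip) : ContinuousAt liftMap x :=
  (hasFDerivAt_liftMap hx).continuousAt

@[fun_prop]
lemma continuous_den {α : Type*} [TopologicalSpace α] {f g : α → ℝ} (hf : Continuous f)
    (hg : Continuous g) : Continuous fun a => den (f a) (g a) := by
  unfold den; fun_prop

lemma continuousOn_jac_apply :
    ContinuousOn (fun p : (ℝ × ℝ) × (ℝ × ℝ) => jac p.1 p.2) (strip ×ˢ univ) := by
  have hW : ∀ p : (ℝ × ℝ) × (ℝ × ℝ), p ∈ strip ×ˢ univ → den p.1.1 (sin p.1.2) ≠ 0 :=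
    fun p hp => (den_pos (sin_mem hp.1).1 (sin_mem hp.1).2).ne'
  have hW2 : ∀ p : (ℝ × ℝ) × (ℝ × ℝ), p ∈ strip ×ˢ univ → den p.1.1 (sin p.1.2) ^ 2 ≠ 0 :=
    fun p hp => pow_ne_zero 2 (hW p hp)
  have hS : ∀ p : (ℝ × ℝ) × (ℝ × ℝ), p ∈ strip ×ˢ univ → cosHeight p.1.1 (sin p.1.2) ≠ 0 :=
    fun p hp => (cosHeight_pos (sin_mem hp.1).1 (sin_mem hp.1).2).ne'
  have hd : ContinuousOn (fun p : (ℝ × ℝ) × (ℝ × ℝ) => den p.1.1 (sin p.1.2)) (strip ×ˢ univ) :=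
    Continuous.continuousOn (by fun_prop)
  have hSc : ContinuousOn (fun p : (ℝ × ℝ) × (ℝ × ℝ) => cosHeight p.1.1 (sin p.1.2))
      (strip ×ˢ univ) := by
    unfold cosHeight heightMap
    refine ContinuousOn.sqrt (continuousOn_const.sub (ContinuousOn.pow (ContinuousOn.div ?_ hd hW) 2))
    fun_prop
  have hA : ContinuousOn (fun p : (ℝ × ℝ) × (ℝ × ℝ) => jA p.1) (strip ×ˢ univ) :=
    ContinuousOn.div (by fun_prop) hd hW
  have hB : ContinuousOn (fun p : (ℝ × ℝ) × (ℝ × ℝ) => jB p.1) (strip ×ˢ univ) :=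
    (ContinuousOn.div (by fun_prop) hd hW).mul (by fun_prop)
  have hC : ContinuousOn (fun p : (ℝ × ℝ) × (ℝ × ℝ) => jC p.1) (strip ×ˢ univ) :=
    (ContinuousOn.div (by fun_prop) (hd.pow 2) hW2).div hSc hS
  have hD : ContinuousOn (fun p : (ℝ × ℝ) × (ℝ × ℝ) => jD p.1) (strip ×ˢ univ) :=
    ((ContinuousOn.div (by fun_prop) (hd.pow 2) hW2).mul (by fun_prop)).div hSc hS
  simp only [jac_apply]
  fun_prop

/-! ### Domination: the cone estimates for the differential -/

lemma one_sub_heightMap_sq {φ t : ℝ} (h : den φ t ≠ 0) :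
    1 - heightMap φ t ^ 2 =
      (1 - t ^ 2) ^ 2 * ((1 - t ^ 2) ^ 2 + 8 * t ^ 2 * cos φ ^ 2) / den φ t ^ 2 := by
  rw [heightMap]
  field_simp
  unfold den
  ring

/-- The inequality behind the invariance of the cones, with `X = cos φ`, `s = sin φ`, `t = sin ψ`,
`σ = cos ψ`, for the null direction `dψ = e dφ`.  After the substitution `Y = t X - e σ s` the right
hand side is `X² + Y²`. -/
lemma cone_null {X s t σ e : ℝ} (h1 : X ^ 2 + s ^ 2 = 1) (h2 : t ^ 2 + σ ^ 2 = 1)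
    (he : e ^ 2 = 1) :
    |σ * ((1 + t ^ 2) * X * e - t * σ * s)| ≤ 1 - t ^ 2 + 2 * t ^ 2 * X ^ 2 - 2 * e * t * σ * s * X
      := by
  set Y := t * X - e * σ * s with hY
  have hP : 1 - t ^ 2 + 2 * t ^ 2 * X ^ 2 - 2 * e * t * σ * s * X = X ^ 2 + Y ^ 2 := by
    rw [hY]
    linear_combination (-σ ^ 2) * h1 - s ^ 2 * σ ^ 2 * he + (X ^ 2 - 1) * h2
  have hσ : σ ^ 2 = X ^ 2 + Y ^ 2 - 2 * t * X * Y := by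
    rw [hY]
    linear_combination (-σ ^ 2) * h1 - s ^ 2 * σ ^ 2 * he + X ^ 2 * h2
  have hZ : σ * ((1 + t ^ 2) * X * e - t * σ * s) = e * (σ * (X + t * Y)) := by
    rw [hY]; linear_combination (-(t * σ ^ 2 * s)) * he * (-1)
  rw [hP, hZ]
  apply abs_le_of_sq_le_sq _ (by positivity)
  have : (X ^ 2 + Y ^ 2) ^ 2 - (e * (σ * (X + t * Y))) ^ 2
      = 4 * t ^ 2 * X ^ 2 * Y ^ 2 + (σ ^ 2) ^ 2 * Y ^ 2 := by
    linear_combination (-σ ^ 2 * Y ^ 2) * h2 - (X ^ 2 + Y ^ 2 + 2 * t * X * Y) * hσ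
      - (σ ^ 2 * (X + t * Y) ^ 2) * he
  nlinarith [sq_nonneg (t * X * Y), sq_nonneg (σ ^ 2 * Y)]

/-- A lower bound for `√(1 - t'²)`, from `one_sub_heightMap_sq` and `(8 / 3)² ≤ 8`; the factor
`8 / 3` gives the ratio `3 / 4 = 2 / (8 / 3)` in the cone estimates. -/
lemma le_cosHeight {φ t : ℝ} (h0 : 0 ≤ t) (h1 : t < 1) :
    8 / 3 * t * |cos φ| * (1 - t ^ 2) / den φ t ≤ cosHeight φ t := by
  have hW := den_pos (φ := φ) h0 h1
  apply Real.le_sqrt_of_sq_le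
  rw [one_sub_heightMap_sq hW.ne', div_pow]
  gcongr
  have : (8 / 3 * t * |cos φ| * (1 - t ^ 2)) ^ 2
      = (1 - t ^ 2) ^ 2 * (64 / 9 * t ^ 2 * cos φ ^ 2) := by
    rw [mul_pow, mul_pow, sq_abs]; ring
  rw [this]
  gcongr
  nlinarith [sq_nonneg (t * cos φ), sq_nonneg (1 - t ^ 2)]

lemma two_le_jA {x : ℝ × ℝ} (hx : x ∈ strip) : 2 ≤ jA x := by
  obtain ⟨h0, h1⟩ := sin_mem hx
  have hW := den_pos (φ := x.1) h0 h1
  rw [jA, dA, le_div_iff₀ hW, den]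
  have : 0 ≤ (1 - sin x.2 ^ 2) * (1 + sin x.2 ^ 2) := mul_nonneg (by nlinarith) (by positivity)
  nlinarith

lemma jA_add_eq {x : ℝ × ℝ} (e : ℝ) :
    jA x + e * jB x = 4 * (1 - sin x.2 ^ 2 + 2 * sin x.2 ^ 2 * cos x.1 ^ 2
      - 2 * e * sin x.2 * cos x.2 * sin x.1 * cos x.1) / den x.1 (sin x.2) := by
  rw [jA, jB, dA, dB]; ring

/-- Null vectors are not contracted in the horizontal direction. -/
lemma one_le_jA_add {x : ℝ × ℝ} (hx : x ∈ strip) {e : ℝ} (he : e ^ 2 = 1) :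
    1 ≤ jA x + e * jB x := by
  obtain ⟨h0, h1⟩ := sin_mem hx
  have hW := den_pos (φ := x.1) h0 h1
  rw [jA_add_eq, le_div_iff₀ hW, one_mul, den]
  clear hW h0 h1 hx
  have h1 := sin_sq_add_cos_sq x.1
  have h2 := sin_sq_add_cos_sq x.2
  generalize cos x.1 = X at *
  generalize sin x.1 = s at *
  generalize sin x.2 = t at *
  generalize cos x.2 = σ at *
  set Y := t * X - e * σ * s with hY
  have hP : 1 - t ^ 2 + 2 * t ^ 2 * X ^ 2 - 2 * e * t * σ * s * X = X ^ 2 + Y ^ 2 := by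
    rw [hY]
    linear_combination (-σ ^ 2) * h1 - s ^ 2 * σ ^ 2 * he + (X ^ 2 - 1) * h2
  have hσ : σ ^ 2 = X ^ 2 + Y ^ 2 - 2 * t * X * Y := by
    rw [hY]
    linear_combination (-σ ^ 2) * h1 - s ^ 2 * σ ^ 2 * he + X ^ 2 * h2
  rw [hP, show 1 - t ^ 2 = σ ^ 2 by linarith]
  have h3 : σ ^ 2 ≤ 2 * X ^ 2 + 2 * Y ^ 2 := by
    nlinarith [sq_nonneg (t * X + Y), sq_nonneg (σ * X)]
  nlinarith [mul_le_mul_of_nonneg_left h3 (sq_nonneg σ), sq_nonneg (σ * Y), sq_nonneg (σ * X),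
    sq_nonneg (t * Y)]

/-- The images of the null vectors lie well inside the horizontal cone. -/
lemma abs_jC_add_le_null {x : ℝ × ℝ} (hx : x ∈ strip) {e : ℝ} (he : e ^ 2 = 1) :
    |jC x + e * jD x| ≤ 3 / 4 * (jA x + e * jB x) := by
  obtain ⟨h0, h1⟩ := sin_mem hx
  have hW := den_pos (φ := x.1) h0 h1
  have hS := cosHeight_pos (φ := x.1) h0 h1
  have hc := cos_pos_of_mem hx
  have h2 := sin_sq_add_cos_sq x.2
  have hN := cone_null (X := cos x.1) (s := sin x.1) (t := sin x.2) (σ := cos x.2)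
    (by rw [add_comm]; exact sin_sq_add_cos_sq x.1) h2 he
  have hL := le_cosHeight (φ := x.1) h0 h1
  have hE : jC x + e * jD x = 8 * sin x.2 * cos x.1 * cos x.2 ^ 2 *
      (cos x.2 * ((1 + sin x.2 ^ 2) * cos x.1 * e - sin x.2 * cos x.2 * sin x.1)) /
        den x.1 (sin x.2) ^ 2 / cosHeight x.1 (sin x.2) := by
    rw [jC, jD, dC, dD, show 1 - sin x.2 ^ 2 = cos x.2 ^ 2 by linarith]
    ring
  rw [hE, jA_add_eq, abs_div, abs_div, abs_of_pos hS, abs_of_pos (pow_pos hW 2), div_le_iff₀ hS,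
    abs_mul]
  rw [show 1 - sin x.2 ^ 2 = cos x.2 ^ 2 by linarith] at hN hL ⊢
  set P := cos x.2 ^ 2 + 2 * sin x.2 ^ 2 * cos x.1 ^ 2
      - 2 * e * sin x.2 * cos x.2 * sin x.1 * cos x.1
  have hP : 0 ≤ P := (abs_nonneg _).trans hN
  have h8 : |8 * sin x.2 * cos x.1 * cos x.2 ^ 2| = 8 * sin x.2 * |cos x.1| * cos x.2 ^ 2 := by
    rw [abs_mul, abs_mul, abs_of_nonneg (sq_nonneg (cos x.2)),
      abs_of_nonneg (by positivity : 0 ≤ 8 * sin x.2)]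
  rw [h8]
  calc 8 * sin x.2 * |cos x.1| * cos x.2 ^ 2 *
        |cos x.2 * ((1 + sin x.2 ^ 2) * cos x.1 * e - sin x.2 * cos x.2 * sin x.1)| /
          den x.1 (sin x.2) ^ 2
      ≤ 8 * sin x.2 * |cos x.1| * cos x.2 ^ 2 * P / den x.1 (sin x.2) ^ 2 := by gcongr
    _ = 3 / 4 * (4 * P / den x.1 (sin x.2)) *
        (8 / 3 * sin x.2 * |cos x.1| * cos x.2 ^ 2 / den x.1 (sin x.2)) := by
        field_simp
    _ ≤ _ := by gcongr

/-- Uniform horizontal expansion in the horizontal cone, by convexity from the horizontal and the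
null vectors. -/
lemma le_jA_add {x : ℝ × ℝ} (hx : x ∈ strip) {e : ℝ} (he : |e| ≤ 1) :
    2 - |e| ≤ jA x + e * jB x := by
  have h1 := one_le_jA_add hx (e := 1) (by norm_num)
  have h2 := one_le_jA_add hx (e := -1) (by norm_num)
  have h3 := two_le_jA hx
  rcases abs_cases e with ⟨h, h'⟩ | ⟨h, h'⟩ <;> rw [h] at he ⊢ <;> nlinarith

/-- The horizontal cone is mapped into the cone `|dψ| ≤ 3/4 |dφ|`, since its extremal vectors
are. -/
lemma abs_jC_add_le {x : ℝ × ℝ} (hx : x ∈ strip) {e : ℝ} (he : |e| ≤ 1) :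
    |jC x + e * jD x| ≤ 3 / 4 * (jA x + e * jB x) := by
  have h1 := abs_le.1 (abs_jC_add_le_null hx (e := 1) (by norm_num))
  have h2 := abs_le.1 (abs_jC_add_le_null hx (e := -1) (by norm_num))
  obtain ⟨h3, h4⟩ := abs_le.1 he
  rw [abs_le]
  constructor <;> nlinarith

lemma dA_mul_dD_sub {φ t : ℝ} (h : den φ t ≠ 0) : dA φ t * dD φ t - dB φ t * dC φ t =
    32 * t * cos φ ^ 2 * (1 - t ^ 2) / den φ t ^ 2 := by
  have h1 : dA φ t * dD φ t - dB φ t * dC φ t = 32 * t * cos φ ^ 2 * (1 - t ^ 2) *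
      ((1 - t ^ 2 + 2 * t ^ 2 * cos φ ^ 2) * (1 + t ^ 2) - 2 * t ^ 2 * sin φ ^ 2 * (1 - t ^ 2)) /
        den φ t ^ 3 := by
    rw [dA, dB, dC, dD]
    field_simp
    ring
  have h2 : (1 - t ^ 2 + 2 * t ^ 2 * cos φ ^ 2) * (1 + t ^ 2) - 2 * t ^ 2 * sin φ ^ 2 * (1 - t ^ 2)
      = den φ t := by
    rw [den, sin_sq]; ring
  rw [h1, h2]
  field_simp

lemma jac_det_eq {x : ℝ × ℝ} (hx : x ∈ strip) : jA x * jD x - jB x * jC x =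
    32 * sin x.2 * cos x.1 ^ 2 * (1 - sin x.2 ^ 2) / den x.1 (sin x.2) ^ 2 * cos x.2 /
      cosHeight x.1 (sin x.2) := by
  rw [← dA_mul_dD_sub (den_pos (sin_mem hx).1 (sin_mem hx).2).ne', jA, jB, jC, jD]
  ring

lemma jac_det_nonneg {x : ℝ × ℝ} (hx : x ∈ strip) : 0 ≤ jA x * jD x - jB x * jC x := by
  obtain ⟨h0, h1⟩ := sin_mem hx
  have := (cosHeight_pos (φ := x.1) h0 h1).le
  have := (cos_pos_of_mem hx).le
  have : 0 ≤ 1 - sin x.2 ^ 2 := by nlinarith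
  rw [jac_det_eq hx]
  positivity

/-- At its critical points the map collapses every vector to a horizontal one. -/
lemma jC_jD_eq_zero {x : ℝ × ℝ} (hx : x ∈ strip) (h : jA x * jD x - jB x * jC x = 0) :
    jC x = 0 ∧ jD x = 0 := by
  obtain ⟨h0, h1⟩ := sin_mem hx
  have hS := (cosHeight_pos (φ := x.1) h0 h1).ne'
  have hc := (cos_pos_of_mem hx).ne'
  have hW := (den_pos (φ := x.1) h0 h1).ne'
  have h2 : 1 - sin x.2 ^ 2 ≠ 0 := by nlinarith
  rw [jac_det_eq hx] at h
  have : sin x.2 = 0 ∨ cos x.1 = 0 := by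
    simpa [hS, hc, hW, h2] using h
  rcases this with h | h <;> simp [jC, jD, dC, dD, h]

/-! ### Expansion of horizontal pairs and pullback of causal curves -/

lemma le_of_hasDerivAt_nonneg {f f' : ℝ → ℝ} {a b : ℝ} (hab : a ≤ b)
    (hf : ∀ r ∈ Icc a b, HasDerivAt f (f' r) r) (h : ∀ r ∈ Icc a b, 0 ≤ f' r) : f a ≤ f b := by
  refine monotoneOn_of_deriv_nonneg (convex_Icc a b)
    (fun r hr => (hf r hr).continuousAt.continuousWithinAt)
    (fun r hr => (hf r (interior_subset hr)).differentiableAt.differentiableWithinAt)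
    (fun r hr => ?_) (left_mem_Icc.2 hab) (right_mem_Icc.2 hab) hab
  rw [(hf r (interior_subset hr)).deriv]
  exact h r (interior_subset hr)

/-- The infinitesimal cone estimates, integrated along the segment from `x` to `y`. -/
lemma liftMap_expansion {x y : ℝ × ℝ} {m : ℝ} (hx : x ∈ strip) (hy : y ∈ strip) (hm : m ≤ 1)
    (hxy : x.1 ≤ y.1) (h : |y.2 - x.2| ≤ m * (y.1 - x.1)) :
    (2 - m) * (y.1 - x.1) ≤ (liftMap y).1 - (liftMap x).1 ∧
      |(liftMap y).2 - (liftMap x).2| ≤ 3 / 4 * ((liftMap y).1 - (liftMap x).1) := by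
  rcases hxy.eq_or_lt with h0 | h0
  · rw [h0, sub_self, mul_zero] at h
    have h2 : y.2 = x.2 := by linarith [abs_nonpos_iff.1 h]
    have : y = x := Prod.ext h0.symm h2
    simp [this]
  have hd : 0 < y.1 - x.1 := sub_pos.2 h0
  set e := (y.2 - x.2) / (y.1 - x.1) with he
  have hem : |e| ≤ m := by rwa [he, abs_div, abs_of_pos hd, div_le_iff₀ hd]
  have hey : x.2 + (y.1 - x.1) * e = y.2 := by rw [he]; field_simp; ring
  have hmem : ∀ r ∈ Icc 0 (y.1 - x.1), (x.1 + r, x.2 + r * e) ∈ strip := by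
    intro r hr
    have : Convex ℝ (Ico 0 (π / 2)) := convex_Ico _ _
    have h3 : r / (y.1 - x.1) ∈ Icc (0 : ℝ) 1 :=
      ⟨div_nonneg hr.1 hd.le, (div_le_one hd).2 hr.2⟩
    have h4 := this.add_smul_sub_mem hx hy h3
    have h5 : x.2 + (r / (y.1 - x.1)) • (y.2 - x.2) = x.2 + r * e := by
      rw [he, smul_eq_mul]; ring
    rwa [h5] at h4
  have hder : ∀ r ∈ Icc 0 (y.1 - x.1), HasDerivAt (fun r => liftMap (x.1 + r, x.2 + r * e))
      (jac (x.1 + r, x.2 + r * e) (1, e)) r := by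
    intro r hr
    refine hasDerivAt_liftMap_comp ((hasDerivAt_id r).const_add x.1) ?_ (hmem r hr)
    simpa using ((hasDerivAt_id r).mul_const e).const_add x.2
  have hd1 : ∀ r ∈ Icc 0 (y.1 - x.1), HasDerivAt (fun r => (liftMap (x.1 + r, x.2 + r * e)).1)
      (jA (x.1 + r, x.2 + r * e) + e * jB (x.1 + r, x.2 + r * e)) r := by
    intro r hr
    refine (hasFDerivAt_fst.comp_hasDerivAt r (hder r hr)).congr_deriv ?_
    simp [jac_apply]; ring
  have hd2 : ∀ r ∈ Icc 0 (y.1 - x.1), HasDerivAt (fun r => (liftMap (x.1 + r, x.2 + r * e)).2)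
      (jC (x.1 + r, x.2 + r * e) + e * jD (x.1 + r, x.2 + r * e)) r := by
    intro r hr
    refine (hasFDerivAt_snd.comp_hasDerivAt r (hder r hr)).congr_deriv ?_
    simp [jac_apply]; ring
  have hA := fun r hr => le_jA_add (hmem r hr) (hem.trans hm)
  have hC := fun r hr => abs_le.1 (abs_jC_add_le (hmem r hr) (hem.trans hm))
  have i1 := le_of_hasDerivAt_nonneg hd.le
    (fun r hr => (hd1 r hr).fun_sub ((hasDerivAt_id' r).const_mul (2 - m)))
    (fun r hr => by linarith [hA r hr])
  have i2 := le_of_hasDerivAt_nonneg hd.le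
    (fun r hr => ((hd1 r hr).const_mul (3 / 4)).fun_sub (hd2 r hr))
    (fun r hr => by linarith [(hC r hr).2])
  have i3 := le_of_hasDerivAt_nonneg hd.le
    (fun r hr => ((hd1 r hr).const_mul (3 / 4)).fun_add (hd2 r hr))
    (fun r hr => by linarith [(hC r hr).1])
  have hy' : (x.1 + (y.1 - x.1), x.2 + (y.1 - x.1) * e) = y := Prod.ext (by simp) hey
  have hx' : (x.1 + 0, x.2 + 0 * e) = x := Prod.ext (by simp) (by simp)
  rw [hy', hx'] at i1 i2 i3
  exact ⟨by linarith, abs_le.2 ⟨by linarith, by linarith⟩⟩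

/-- Two points of the universal cover lie in the (closed) vertical cones of each other. -/
def Causal (x y : ℝ × ℝ) : Prop := |x.1 - y.1| ≤ |x.2 - y.2|

lemma Causal.symm {x y : ℝ × ℝ} (h : Causal x y) : Causal y x := by
  rwa [Causal, abs_sub_comm, abs_sub_comm y.2]

/-- Pairs of points which are not in vertical position stay so. -/
lemma Causal.of_liftMap {x y : ℝ × ℝ} (hx : x ∈ strip) (hy : y ∈ strip)
    (h : Causal (liftMap x) (liftMap y)) : Causal x y := by
  wlog hxy : x.1 ≤ y.1 generalizing x y
  · exact (this hy hx h.symm (not_le.1 hxy).le).symm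
  by_contra hn
  rw [Causal, not_le, abs_sub_comm x.1, abs_of_nonneg (sub_nonneg.2 hxy), abs_sub_comm] at hn
  obtain ⟨h1, h2⟩ := liftMap_expansion hx hy le_rfl hxy (by linarith)
  rw [Causal, abs_sub_comm, abs_sub_comm (liftMap x).2] at h
  have := abs_nonneg (y.2 - x.2)
  have h3 := le_abs_self ((liftMap y).1 - (liftMap x).1)
  linarith

lemma Causal.of_iterate {x y : ℝ × ℝ} (hx : x ∈ strip) (hy : y ∈ strip) (n : ℕ)
    (h : Causal (liftMap^[n] x) (liftMap^[n] y)) : Causal x y := by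
  induction n with
  | zero => exact h
  | succ n ih =>
    rw [Function.iterate_succ_apply', Function.iterate_succ_apply'] at h
    exact ih (h.of_liftMap (iterate_mem hx n) (iterate_mem hy n))

/-- The horizontal distance is expanded exponentially. -/
lemma iterate_expansion {x y : ℝ × ℝ} (hx : x ∈ strip) (hy : y ∈ strip) (h : x.2 = y.2) (n : ℕ) :
    (5 / 4) ^ n * |x.1 - y.1| ≤ |(liftMap^[n] x).1 - (liftMap^[n] y).1| := by
  wlog hxy : x.1 ≤ y.1 generalizing x y
  · rw [abs_sub_comm, abs_sub_comm (liftMap^[n] x).1]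
    exact this hy hx h.symm (not_le.1 hxy).le
  suffices (5 / 4) ^ n * (y.1 - x.1) ≤ (liftMap^[n] y).1 - (liftMap^[n] x).1 ∧
      |(liftMap^[n] y).2 - (liftMap^[n] x).2|
        ≤ 3 / 4 * ((liftMap^[n] y).1 - (liftMap^[n] x).1) by
    rw [abs_sub_comm, abs_of_nonneg (sub_nonneg.2 hxy), abs_sub_comm]
    exact this.1.trans (le_abs_self _)
  induction n with
  | zero => simpa [h] using hxy
  | succ n ih =>
    obtain ⟨ih1, ih2⟩ := ih
    have hp : 0 ≤ (5 / 4 : ℝ) ^ n * (y.1 - x.1) := mul_nonneg (by positivity) (by linarith)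
    obtain ⟨h1, h2⟩ := liftMap_expansion (iterate_mem hx n) (iterate_mem hy n)
      (by norm_num) (by linarith) ih2
    rw [Function.iterate_succ_apply', Function.iterate_succ_apply']
    refine ⟨?_, h2⟩
    rw [pow_succ]
    linarith

/-- A causal curve, given by the angle as a function of `ψ`: it is tangent to the algebraic vertical
cones in the sense of finite differences. -/
def IsCausal (k : ℝ → ℝ) : Prop :=
  ∀ a ∈ Ico 0 (π / 2), ∀ b ∈ Ico 0 (π / 2), |k a - k b| ≤ |a - b|

lemma IsCausal.continuousOn {k : ℝ → ℝ} (hk : IsCausal k) : ContinuousOn k (Ico 0 (π / 2)) := by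
  have : LipschitzOnWith 1 k (Ico 0 (π / 2)) :=
    LipschitzOnWith.of_dist_le_mul fun a ha b hb => by
      simpa [Real.dist_eq] using hk a ha b hb
  exact this.continuousOn

lemma IsCausal.abs_sub_le {k : ℝ → ℝ} (hk : IsCausal k) {a b : ℝ} (ha : a ∈ Ico 0 (π / 2))
    (hb : b ∈ Ico 0 (π / 2)) : |k a - k b| ≤ π / 2 :=
  (hk a ha b hb).trans (abs_le.2 ⟨by linarith [ha.1, hb.2], by linarith [hb.1, ha.2]⟩)

lemma abs_angleMap_sub_le (φ t : ℝ) : |angleMap φ t - 4 * φ| ≤ π := by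
  rw [angleMap, sub_sub_cancel_left, abs_neg, abs_mul, abs_two]
  have : |arctan (2 * t ^ 2 * sin φ * cos φ / (1 - t ^ 2 + 2 * t ^ 2 * cos φ ^ 2))| ≤ π / 2 :=
    abs_le.2 ⟨(neg_pi_div_two_lt_arctan _).le, (arctan_lt_pi_div_two _).le⟩
  linarith

/-- Along a horizontal line the angle of the image runs from `-∞` to `∞`, so the image meets every
causal curve. -/
lemma exists_pull {k : ℝ → ℝ} (hk : IsCausal k) {ψ : ℝ} (hψ : ψ ∈ Ico 0 (π / 2)) :
    ∃ φ, (liftMap (φ, ψ)).1 = k (liftMap (φ, ψ)).2 := by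
  have hm : ∀ φ : ℝ, (φ, ψ) ∈ strip := fun φ => hψ
  have hc : Continuous fun φ => liftMap (φ, ψ) := continuous_iff_continuousAt.2 fun φ =>
    ContinuousAt.comp (g := liftMap) (continuousAt_liftMap (hm φ)) (by fun_prop)
  have hc2 : Continuous fun φ => k (liftMap (φ, ψ)).2 :=
    hk.continuousOn.comp_continuous hc.snd fun φ => liftMap_mem (hm φ)
  have hc3 : Continuous fun φ => (liftMap (φ, ψ)).1 - k (liftMap (φ, ψ)).2 := hc.fst.sub hc2
  have h0 : (0 : ℝ) ∈ Ico 0 (π / 2) := ⟨le_rfl, by positivity⟩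
  have hb : ∀ φ, |(liftMap (φ, ψ)).1 - k (liftMap (φ, ψ)).2 - (4 * φ - k 0)| ≤ 2 * π := by
    intro φ
    have h1 := abs_le.1 (abs_angleMap_sub_le φ (sin ψ))
    have h2 := abs_le.1 (hk.abs_sub_le (liftMap_mem (hm φ)) h0)
    change |angleMap φ (sin ψ) - _ - _| ≤ _
    rw [abs_le]
    constructor <;> linarith [pi_pos]
  obtain ⟨φ, hφ⟩ := mem_range_of_exists_le_of_exists_ge hc3 (c := 0)
    ⟨(k 0 - 2 * π) / 4, by have := abs_le.1 (hb ((k 0 - 2 * π) / 4)); linarith⟩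
    ⟨(k 0 + 2 * π) / 4, by have := abs_le.1 (hb ((k 0 + 2 * π) / 4)); linarith⟩
  exact ⟨φ, sub_eq_zero.1 hφ⟩

/-- The pullback of a causal curve by the lifted map, again as a function of `ψ`.  On each horizontal
line there is exactly one point which the map sends to the curve. -/
noncomputable def pull (k : ℝ → ℝ) (ψ : ℝ) : ℝ :=
  Classical.epsilon fun φ => (liftMap (φ, ψ)).1 = k (liftMap (φ, ψ)).2

lemma pull_spec {k : ℝ → ℝ} (hk : IsCausal k) {ψ : ℝ} (hψ : ψ ∈ Ico 0 (π / 2)) :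
    (liftMap (pull k ψ, ψ)).1 = k (liftMap (pull k ψ, ψ)).2 :=
  Classical.epsilon_spec (exists_pull hk hψ)

lemma eq_of_iterate_causal {φ φ' ψ : ℝ} (hψ : ψ ∈ Ico 0 (π / 2)) (n : ℕ)
    (h : Causal (liftMap^[n] (φ, ψ)) (liftMap^[n] (φ', ψ))) : φ = φ' := by
  have := Causal.of_iterate (x := (φ, ψ)) (y := (φ', ψ)) hψ hψ n h
  simpa [Causal, sub_eq_zero] using this

lemma eq_pull {k : ℝ → ℝ} (hk : IsCausal k) {φ ψ : ℝ} (hψ : ψ ∈ Ico 0 (π / 2))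
    (h : (liftMap (φ, ψ)).1 = k (liftMap (φ, ψ)).2) : φ = pull k ψ := by
  refine eq_of_iterate_causal hψ 1 ?_
  simp only [Function.iterate_one]
  rw [Causal, h, pull_spec hk hψ]
  exact hk _ (liftMap_mem (x := (φ, ψ)) hψ) _ (liftMap_mem (x := (pull k ψ, ψ)) hψ)

lemma IsCausal.pull {k : ℝ → ℝ} (hk : IsCausal k) : IsCausal (pull k) := by
  intro a ha b hb
  refine Causal.of_liftMap (x := (DHL.pull k a, a)) (y := (DHL.pull k b, b)) ha hb ?_
  rw [Causal, pull_spec hk ha, pull_spec hk hb]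
  exact hk _ (liftMap_mem (x := (DHL.pull k a, a)) ha) _ (liftMap_mem (x := (DHL.pull k b, b)) hb)

lemma IsCausal.iterate_pull {k : ℝ → ℝ} (hk : IsCausal k) (n : ℕ) : IsCausal (DHL.pull^[n] k) := by
  induction n with
  | zero => exact hk
  | succ n ih => rw [Function.iterate_succ_apply']; exact ih.pull

/-- The `m`-th image of the `(n+m)`-fold pullback is the `n`-fold pullback. -/
lemma iterate_pull_spec {k : ℝ → ℝ} (hk : IsCausal k) {ψ : ℝ} (hψ : ψ ∈ Ico 0 (π / 2)) (n m : ℕ) :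
    (liftMap^[m] (pull^[n + m] k ψ, ψ)).1 = pull^[n] k (liftMap^[m] (pull^[n + m] k ψ, ψ)).2 := by
  induction m generalizing n with
  | zero => rfl
  | succ m ih =>
    have h := ih (n + 1)
    rw [show n + 1 + m = n + (m + 1) by ring] at h
    rw [Function.iterate_succ_apply']
    set y := liftMap^[m] (pull^[n + (m + 1)] k ψ, ψ) with hy
    have hym : y ∈ strip := iterate_mem (x := (_, ψ)) hψ m
    have := pull_spec (hk.iterate_pull n) hym
    rw [Function.iterate_succ_apply'] at h
    rw [← h] at this
    exact this

lemma eq_iterate_pull {k : ℝ → ℝ} (hk : IsCausal k) {φ ψ : ℝ} (hψ : ψ ∈ Ico 0 (π / 2)) (n : ℕ)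
    (h : (liftMap^[n] (φ, ψ)).1 = k (liftMap^[n] (φ, ψ)).2) : φ = pull^[n] k ψ := by
  refine eq_of_iterate_causal hψ n ?_
  have h2 := iterate_pull_spec hk hψ 0 n
  rw [zero_add] at h2
  rw [Causal, h, h2]
  exact hk _ (iterate_mem (x := (φ, ψ)) hψ n) _ (iterate_mem (x := (pull^[n] k ψ, ψ)) hψ n)

/-! ### Central curves -/

/-- A central curve over a set `I` of values of `ψ`: all its images by the iterates are causal. -/
def IsCentralOn (k : ℝ → ℝ) (I : Set ℝ) : Prop :=
  ∀ n : ℕ, ∀ a ∈ I, ∀ b ∈ I, Causal (liftMap^[n] (k a, a)) (liftMap^[n] (k b, b))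

lemma IsCentralOn.isCausal {k : ℝ → ℝ} (h : IsCentralOn k (Ico 0 (π / 2))) : IsCausal k :=
  fun a ha b hb => h 0 a ha b hb

lemma abs_sub_le_of_causal {x y : ℝ × ℝ} (hx : x ∈ strip) (hy : y ∈ strip) (h : Causal x y) :
    |x.1 - y.1| ≤ π / 2 :=
  le_trans h (abs_le.2 ⟨by linarith [hx.1, hy.2], by linarith [hy.1, hx.2]⟩)

/-- Curves with the same rough itinerary are exponentially close: if the `n`-th images of two points
at the same height differ by the angle `d` at most, the points differ by `d (4/5)ⁿ`. -/
lemma abs_sub_le_of_iterate {φ φ' ψ d : ℝ} (hψ : ψ ∈ Ico 0 (π / 2)) (n : ℕ)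
    (h : |(liftMap^[n] (φ, ψ)).1 - (liftMap^[n] (φ', ψ)).1| ≤ d) : |φ - φ'| ≤ d * (4 / 5) ^ n := by
  have h1 := iterate_expansion (x := (φ, ψ)) (y := (φ', ψ)) hψ hψ rfl n
  have h2 : (4 / 5 : ℝ) ^ n * (5 / 4) ^ n = 1 := by rw [← mul_pow]; norm_num
  calc |φ - φ'| = (4 / 5 : ℝ) ^ n * ((5 / 4) ^ n * |φ - φ'|) := by rw [← mul_assoc, h2, one_mul]
    _ ≤ (4 / 5 : ℝ) ^ n * d := by gcongr; exact h1.trans h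
    _ = _ := mul_comm _ _

lemma eq_of_forall_iterate {φ φ' ψ d : ℝ} (hψ : ψ ∈ Ico 0 (π / 2))
    (h : ∀ n, |(liftMap^[n] (φ, ψ)).1 - (liftMap^[n] (φ', ψ)).1| ≤ d) : φ = φ' := by
  have h1 : Tendsto (fun n : ℕ => d * (4 / 5 : ℝ) ^ n) atTop (𝓝 (d * 0)) :=
    (tendsto_pow_atTop_nhds_zero_of_lt_one (by norm_num) (by norm_num)).const_mul d
  have h2 := ge_of_tendsto' h1 fun n => abs_sub_le_of_iterate hψ n (h n)
  rw [mul_zero, abs_nonpos_iff] at h2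
  linarith

/-- Two central curves which meet coincide. -/
lemma IsCentralOn.eqOn {k k' : ℝ → ℝ} {I : Set ℝ} (hI : I ⊆ Ico 0 (π / 2)) (hk : IsCentralOn k I)
    (hk' : IsCentralOn k' I) {a : ℝ} (ha : a ∈ I) (h : k a = k' a) : EqOn k k' I := by
  intro b hb
  refine eq_of_forall_iterate (d := π) (hI hb) fun n => ?_
  have h1 := abs_le.1 (abs_sub_le_of_causal (iterate_mem (x := (_, b)) (hI hb) n)
    (iterate_mem (x := (_, a)) (hI ha) n) (hk n b hb a ha))
  have h2 := abs_le.1 (abs_sub_le_of_causal (iterate_mem (x := (_, b)) (hI hb) n)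
    (iterate_mem (x := (_, a)) (hI ha) n) (hk' n b hb a ha))
  rw [h] at h1
  rw [abs_le]
  constructor <;> linarith

lemma continuousAt_iterate {x : ℝ × ℝ} (hx : x ∈ strip) (n : ℕ) :
    ContinuousAt (liftMap^[n]) x := by
  induction n with
  | zero => exact continuousAt_id
  | succ n ih =>
    rw [Function.iterate_succ']
    exact (continuousAt_liftMap (iterate_mem hx n)).comp ih

/-- Through every point passes a central curve, a limit of pullbacks of vertical segments. -/
lemma exists_isCentralOn {x : ℝ × ℝ} (hx : x ∈ strip) :
    ∃ k, IsCentralOn k (Ico 0 (π / 2)) ∧ k x.2 = x.1 := by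
  let U : Ultrafilter ℕ := hyperfilter ℕ
  set c : ℕ → ℝ → ℝ := fun n _ => (liftMap^[n] x).1 with hc
  have hcc : ∀ n, IsCausal (c n) := fun n a _ b _ => by simp [hc]
  set p : ℕ → ℝ → ℝ := fun n => pull^[n] (c n) with hp
  have hpc : ∀ n, IsCausal (p n) := fun n => (hcc n).iterate_pull n
  have hpx : ∀ n, p n x.2 = x.1 := fun n => (eq_iterate_pull (hcc n) hx n rfl).symm
  have hlim : ∀ ψ ∈ Ico 0 (π / 2), ∃ y, Tendsto (fun n => p n ψ) U (𝓝 y) := by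
    intro ψ hψ
    have hK : IsCompact (Icc (x.1 - π / 2) (x.1 + π / 2)) := isCompact_Icc
    have hev : ∀ n, p n ψ ∈ Icc (x.1 - π / 2) (x.1 + π / 2) := fun n => by
      have := abs_le.1 ((hpc n).abs_sub_le hψ hx)
      rw [hpx] at this
      exact ⟨by linarith, by linarith⟩
    obtain ⟨y, -, hy⟩ := hK.ultrafilter_le_nhds (U.map fun n => p n ψ)
      (le_principal_iff.2 (Filter.mem_map.2 (Filter.univ_mem' hev)))
    exact ⟨y, hy⟩
  choose! k hk using hlim
  refine ⟨k, fun n a ha b hb => ?_, ?_⟩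
  · have hlim : ∀ a ∈ Ico 0 (π / 2),
        Tendsto (fun m => liftMap^[n] (p m a, a)) U (𝓝 (liftMap^[n] (k a, a))) := fun a ha =>
      (continuousAt_iterate (x := (k a, a)) ha n).tendsto.comp
        ((hk a ha).prodMk_nhds tendsto_const_nhds)
    have ha' := hlim a ha
    have hb' := hlim b hb
    refine le_of_tendsto_of_tendsto ((ha'.fst_nhds.sub hb'.fst_nhds).abs)
      ((ha'.snd_nhds.sub hb'.snd_nhds).abs) ?_
    have hge : ∀ᶠ m in (U : Filter ℕ), n ≤ m :=
      (Nat.hyperfilter_le_atTop) (eventually_ge_atTop n)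
    filter_upwards [hge] with m hm
    obtain ⟨j, rfl⟩ := Nat.exists_eq_add_of_le' hm
    have h1 := iterate_pull_spec (hcc (j + n)) ha j n
    have h2 := iterate_pull_spec (hcc (j + n)) hb j n
    simp only [hp]
    rw [h1, h2]
    exact (hcc _).iterate_pull j _ (iterate_mem (x := (_, a)) ha n) _
      (iterate_mem (x := (_, b)) hb n)
  · have h1 := hk x.2 hx
    simp only [hpx] at h1
    exact tendsto_nhds_unique h1 tendsto_const_nhds |>.symm ▸ rfl

/-- The pullback of a central curve is central. -/
lemma isCentralOn_of_image {k k' : ℝ → ℝ} {I : Set ℝ} (hI : I ⊆ Ico 0 (π / 2))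
    (hk : IsCentralOn k (Ico 0 (π / 2)))
    (h : ∀ a ∈ I, (liftMap (k' a, a)).1 = k (liftMap (k' a, a)).2) : IsCentralOn k' I := by
  have key : ∀ n : ℕ, ∀ a ∈ I, ∀ b ∈ I,
      Causal (liftMap^[n + 1] (k' a, a)) (liftMap^[n + 1] (k' b, b)) := by
    intro n a ha b hb
    have h1 := hk n _ (liftMap_mem (x := (k' a, a)) (hI ha)) _
      (liftMap_mem (x := (k' b, b)) (hI hb))
    rw [← h a ha, ← h b hb] at h1
    exact h1
  rintro (_ | n) a ha b hb
  · exact (key 0 a ha b hb).of_liftMap (hI ha) (hI hb)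
  · exact key n a ha b hb

/-! ### Contraction of the vertical cones -/

/-- The differential of the `n`-th iterate of the lifted map. -/
noncomputable def jacIter (x : ℝ × ℝ) : ℕ → (ℝ × ℝ →L[ℝ] ℝ × ℝ)
  | 0 => ContinuousLinearMap.id ℝ (ℝ × ℝ)
  | n + 1 => (jac (liftMap^[n] x)).comp (jacIter x n)

lemma jacIter_succ' (x : ℝ × ℝ) (n : ℕ) :
    jacIter x (n + 1) = (jacIter (liftMap x) n).comp (jac x) := by
  induction n with
  | zero => rfl
  | succ n ih =>
    rw [jacIter, ih, jacIter, ContinuousLinearMap.comp_assoc]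
    rfl

lemma hasFDerivAt_iterate {x : ℝ × ℝ} (hx : x ∈ strip) (n : ℕ) :
    HasFDerivAt (liftMap^[n]) (jacIter x n) x := by
  induction n with
  | zero => exact hasFDerivAt_id x
  | succ n ih =>
    rw [Function.iterate_succ']
    exact (hasFDerivAt_liftMap (iterate_mem hx n)).comp x ih

lemma continuousOn_jacIter (n : ℕ) :
    ContinuousOn (fun p : (ℝ × ℝ) × (ℝ × ℝ) => jacIter p.1 n p.2) (strip ×ˢ univ) := by
  induction n with
  | zero => exact continuousOn_snd
  | succ n ih =>
    have h1 : ContinuousOn (fun p : (ℝ × ℝ) × (ℝ × ℝ) => liftMap^[n] p.1) (strip ×ˢ univ) :=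
      fun p hp => (ContinuousAt.comp (g := liftMap^[n]) (continuousAt_iterate hp.1 n)
        continuousAt_fst).continuousWithinAt
    exact ContinuousOn.comp (g := fun p : (ℝ × ℝ) × (ℝ × ℝ) => jac p.1 p.2)
      (f := fun p : (ℝ × ℝ) × (ℝ × ℝ) => (liftMap^[n] p.1, jacIter p.1 n p.2))
      continuousOn_jac_apply (h1.prodMk ih) fun p hp => ⟨iterate_mem hp.1 n, mem_univ _⟩

/-- A vector is central if all its images lie in the vertical cones. -/
def IsCentralVec (x v : ℝ × ℝ) : Prop := ∀ n, |(jacIter x n v).1| ≤ |(jacIter x n v).2|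

lemma IsCentralVec.jac {x v : ℝ × ℝ} (h : IsCentralVec x v) :
    IsCentralVec (liftMap x) (jac x v) := fun n => by
  have := h (n + 1)
  rwa [jacIter_succ'] at this

lemma abs_jC_lt {x : ℝ × ℝ} (hx : x ∈ strip) : |jC x| < jA x := by
  have h1 := abs_jC_add_le hx (e := 0) (by simp)
  have h2 := two_le_jA hx
  simp only [zero_mul, add_zero] at h1
  linarith

/-- The lifted map respects the direction of time along vertical vectors. -/
lemma jac_snd_nonneg {x v : ℝ × ℝ} (hx : x ∈ strip) (hv : 0 ≤ v.2)
    (hV : |(jac x v).1| ≤ |(jac x v).2|) : 0 ≤ (jac x v).2 := by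
  by_contra hn
  push Not at hn
  have h1 : (jA x * jD x - jB x * jC x) * v.2 = jA x * (jac x v).2 - jC x * (jac x v).1 := by
    rw [jac_apply]; ring
  have h2 := mul_nonneg (jac_det_nonneg hx) hv
  rw [abs_of_neg hn] at hV
  have h3 := abs_jC_lt hx
  have h4 : -(jC x * (jac x v).1) ≤ |jC x| * -(jac x v).2 :=
    (neg_le_abs _).trans (by rw [abs_mul]; gcongr)
  nlinarith

/-- The algebra of the cone contraction, in null coordinates. -/
lemma form_le_of_cone {A B C D v₁ v₂ w₁ w₂ V₁ V₂ W₁ W₂ : ℝ}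
    (i1 : |C + D| ≤ 3 / 4 * (A + B)) (i2 : |C - D| ≤ 3 / 4 * (A - B))
    (hV₁ : V₁ = A * v₁ + B * v₂) (hV₂ : V₂ = C * v₁ + D * v₂)
    (hW₁ : W₁ = A * w₁ + B * w₂) (hW₂ : W₂ = C * w₁ + D * w₂)
    (hV : |V₁| ≤ V₂) (hW : |W₁| ≤ W₂) :
    25 / 24 * (A * D - B * C) * (V₂ * W₂ - V₁ * W₁) ≤
      (A * D - B * C) ^ 2 * (v₂ * w₂ - v₁ * w₁) := by
  have p0 : 0 ≤ A + B := by linarith [abs_nonneg (C + D)]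
  have q0 : 0 ≤ A - B := by linarith [abs_nonneg (C - D)]
  rw [abs_le] at i1 i2 hV hW
  obtain ⟨p, hp⟩ : ∃ p, p = A + B := ⟨_, rfl⟩
  obtain ⟨q, hq⟩ : ∃ q, q = A - B := ⟨_, rfl⟩
  obtain ⟨r, hr⟩ : ∃ r, r = C + D := ⟨_, rfl⟩
  obtain ⟨s, hs⟩ : ∃ s, s = D - C := ⟨_, rfl⟩
  obtain ⟨a, ha⟩ : ∃ a, a = V₂ + V₁ := ⟨_, rfl⟩
  obtain ⟨a', ha'⟩ : ∃ a, a = V₂ - V₁ := ⟨_, rfl⟩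
  obtain ⟨b, hb⟩ : ∃ a, a = W₂ + W₁ := ⟨_, rfl⟩
  obtain ⟨b', hb'⟩ : ∃ a, a = W₂ - W₁ := ⟨_, rfl⟩
  have a0 : 0 ≤ a := by linarith
  have a0' : 0 ≤ a' := by linarith
  have b0 : 0 ≤ b := by linarith
  have b0' : 0 ≤ b' := by linarith
  have r1 : r ≤ 3 / 4 * p := by rw [hr, hp]; exact i1.2
  have s1 : s ≤ 3 / 4 * q := by linarith
  have hdet' : A * D - B * C = (q * r + p * s) / 2 := by
    rw [hp, hq, hr, hs]; ring
  have hB : V₂ * W₂ - V₁ * W₁ = (a * b' + a' * b) / 2 := by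
    rw [ha, ha', hb, hb']; ring
  have hv : (A * D - B * C) ^ 2 * (v₂ * w₂ - v₁ * w₁) =
      ((q + s) * (p - r) * (a * b) + (q - s) * (p + r) * (a' * b')
        + (a * b' + a' * b) * (p * q + r * s)) / 4 := by
    have j1 : (A * D - B * C) * (v₂ + v₁) = ((q + s) * a + (q - s) * a') / 2 := by
      rw [ha, ha', hq, hs, hV₁, hV₂]; ring
    have j2 : (A * D - B * C) * (v₂ - v₁) = ((p - r) * a + (p + r) * a') / 2 := by
      rw [ha, ha', hp, hr, hV₁, hV₂]; ring
    have j3 : (A * D - B * C) * (w₂ + w₁) = ((q + s) * b + (q - s) * b') / 2 := by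
      rw [hb, hb', hq, hs, hW₁, hW₂]; ring
    have j4 : (A * D - B * C) * (w₂ - w₁) = ((p - r) * b + (p + r) * b') / 2 := by
      rw [hb, hb', hp, hr, hW₁, hW₂]; ring
    calc (A * D - B * C) ^ 2 * (v₂ * w₂ - v₁ * w₁)
        = ((A * D - B * C) * (v₂ + v₁) * ((A * D - B * C) * (w₂ - w₁)) +
          (A * D - B * C) * (v₂ - v₁) * ((A * D - B * C) * (w₂ + w₁))) / 2 := by ring
      _ = _ := by rw [j1, j2, j3, j4]; ring
  have k1 : 0 ≤ (q + s) * (p - r) * (a * b) := by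
    have : 0 ≤ q + s := by linarith
    have : 0 ≤ p - r := by linarith
    positivity
  have k2 : 0 ≤ (q - s) * (p + r) * (a' * b') := by
    have : 0 ≤ q - s := by linarith
    have : 0 ≤ p + r := by linarith
    positivity
  have k3 : 25 / 24 * (q * r + p * s) ≤ p * q + r * s := by
    rw [← hp] at p0
    rw [← hq] at q0
    nlinarith [mul_nonneg (sub_nonneg.2 r1) (sub_nonneg.2 s1),
      mul_nonneg q0 (sub_nonneg.2 r1), mul_nonneg p0 (sub_nonneg.2 s1)]
  have k4 := mul_le_mul_of_nonneg_left k3 (by positivity : 0 ≤ a * b' + a' * b)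
  rw [hv, hdet', hB]
  linarith

/-- The cone contraction: on pairs of vertical vectors the form `v₂ w₂ - v₁ w₁` grows slower than
the area `v₁ w₂ - v₂ w₁`. -/
lemma form_jac_le {x v w : ℝ × ℝ} (hx : x ∈ strip) (hV : |(jac x v).1| ≤ (jac x v).2)
    (hW : |(jac x w).1| ≤ (jac x w).2) :
    25 / 24 * (jA x * jD x - jB x * jC x) *
        ((jac x v).2 * (jac x w).2 - (jac x v).1 * (jac x w).1) ≤
      (jA x * jD x - jB x * jC x) ^ 2 * (v.2 * w.2 - v.1 * w.1) := by
  have i1 := abs_jC_add_le hx (e := 1) (by simp)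
  have i2 := abs_jC_add_le hx (e := -1) (by simp)
  rw [one_mul, one_mul] at i1
  rw [neg_one_mul, neg_one_mul, ← sub_eq_add_neg, ← sub_eq_add_neg] at i2
  rw [jac_apply] at hV hW ⊢
  rw [jac_apply]
  exact form_le_of_cone i1 i2 rfl rfl rfl rfl hV hW

/-- Central vectors are unique up to scale: the projective distance of two vectors whose first `n`
images are vertical is exponentially small. -/
lemma area_le {x v w : ℝ × ℝ} (hx : x ∈ strip) (hv0 : 0 ≤ v.2) (hw0 : 0 ≤ w.2)
    (hv : IsCentralVec x v) (hw : IsCentralVec x w) (n : ℕ) :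
    |v.1 * w.2 - v.2 * w.1| ≤ (24 / 25) ^ n * (v.2 * w.2 - v.1 * w.1) := by
  have key : ∀ {v w : ℝ × ℝ}, 0 ≤ v.2 → 0 ≤ w.2 → |v.1| ≤ |v.2| → |w.1| ≤ |w.2| →
      |v.1 * w.2 - v.2 * w.1| ≤ v.2 * w.2 - v.1 * w.1 := by
    intro v w hv0 hw0 hv hw
    rw [abs_of_nonneg hv0, abs_le] at hv
    rw [abs_of_nonneg hw0, abs_le] at hw
    rw [abs_le]
    constructor <;> nlinarith
  induction n generalizing x v w with
  | zero => simpa using key hv0 hw0 (hv 0) (hw 0)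
  | succ n ih =>
    have hV : |(jac x v).1| ≤ |(jac x v).2| := hv 1
    have hW : |(jac x w).1| ≤ |(jac x w).2| := hw 1
    have hV0 := jac_snd_nonneg hx hv0 hV
    have hW0 := jac_snd_nonneg hx hw0 hW
    have h1 := ih (liftMap_mem hx) hV0 hW0 hv.jac hw.jac
    have h3 : (jac x v).1 * (jac x w).2 - (jac x v).2 * (jac x w).1
        = (jA x * jD x - jB x * jC x) * (v.1 * w.2 - v.2 * w.1) := by
      rw [jac_apply, jac_apply]; ring
    rw [abs_of_nonneg hV0] at hV
    rw [abs_of_nonneg hW0] at hW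
    have h2 := form_jac_le hx hV hW
    rcases (jac_det_nonneg hx).eq_or_lt with h0 | h0
    · -- at a critical point the central direction is the kernel of the differential
      obtain ⟨hC, hD⟩ := jC_jD_eq_zero hx h0.symm
      have hA := two_le_jA hx
      have h4 : (jac x v).1 = 0 := by
        rw [jac_apply, hC, hD] at hV; rw [jac_apply]; simpa using hV
      have h5 : (jac x w).1 = 0 := by
        rw [jac_apply, hC, hD] at hW; rw [jac_apply]; simpa using hW
      rw [jac_apply] at h4 h5
      simp only at h4 h5
      have h6 : jA x * (v.1 * w.2 - v.2 * w.1) = 0 := by linear_combination w.2 * h4 - v.2 * h5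
      have h7 : v.1 * w.2 - v.2 * w.1 = 0 := by
        rcases mul_eq_zero.1 h6 with h | h
        · linarith
        · exact h
      have h8 := key hv0 hw0 (hv 0) (hw 0)
      rw [h7, abs_zero] at h8 ⊢
      positivity
    · rw [h3, abs_mul, abs_of_pos h0] at h1
      set d := jA x * jD x - jB x * jC x
      have h4 : d * (d * |v.1 * w.2 - v.2 * w.1|) ≤
          d * (d * ((24 / 25) ^ (n + 1) * (v.2 * w.2 - v.1 * w.1))) := by
        have h5 : (0 : ℝ) < (24 / 25) ^ n := by positivity
        calc d * (d * |v.1 * w.2 - v.2 * w.1|)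
            ≤ d * ((24 / 25) ^ n * ((jac x v).2 * (jac x w).2 - (jac x v).1 * (jac x w).1)) := by
              gcongr
          _ = (24 / 25) ^ (n + 1) * (25 / 24 * d *
              ((jac x v).2 * (jac x w).2 - (jac x v).1 * (jac x w).1)) := by
              rw [pow_succ]; ring
          _ ≤ (24 / 25) ^ (n + 1) * (d ^ 2 * (v.2 * w.2 - v.1 * w.1)) := by gcongr
          _ = _ := by ring
      exact le_of_mul_le_mul_left (le_of_mul_le_mul_left h4 h0) h0

lemma central_unique {x v w : ℝ × ℝ} (hx : x ∈ strip) (hv0 : 0 ≤ v.2) (hw0 : 0 ≤ w.2)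
    (hv : IsCentralVec x v) (hw : IsCentralVec x w) : v.1 * w.2 = v.2 * w.1 := by
  have h1 : Tendsto (fun n : ℕ => (24 / 25 : ℝ) ^ n * (v.2 * w.2 - v.1 * w.1)) atTop
      (𝓝 (0 * (v.2 * w.2 - v.1 * w.1))) :=
    (tendsto_pow_atTop_nhds_zero_of_lt_one (by norm_num) (by norm_num)).mul_const _
  have h2 := ge_of_tendsto' h1 fun n => area_le hx hv0 hw0 hv hw n
  rw [zero_mul, abs_nonpos_iff] at h2
  linarith

/-! ### The central slope -/

/-- Every limit slope of a central curve is central. -/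
lemma isCentralVec_of_ultrafilter {k : ℝ → ℝ} {I : Set ℝ} (hI : I ⊆ Ico 0 (π / 2))
    (hk : IsCentralOn k I) {a : ℝ} (ha : a ∈ I) {U : Filter ℝ} [U.NeBot] (hU : U ≤ 𝓝[I \ {a}] a)
    {q : ℝ} (hq : Tendsto (slope k a) U (𝓝 q)) : IsCentralVec (k a, a) (q, 1) := by
  intro n
  have hx : (k a, a) ∈ strip := hI ha
  have hmem : ∀ᶠ b in U, b ∈ I \ {a} := hU self_mem_nhdsWithin
  have hUa : Tendsto (fun b => b) U (𝓝 a) := hU.trans inf_le_left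
  have hkc : Tendsto k U (𝓝 (k a)) := by
    rw [tendsto_iff_dist_tendsto_zero]
    refine squeeze_zero' (.of_forall fun _ => dist_nonneg) ?_
      (tendsto_iff_dist_tendsto_zero.1 hUa)
    filter_upwards [hmem] with b hb
    simpa [Real.dist_eq, Causal] using hk 0 b hb.1 a ha
  have h1 : Tendsto (fun b => (b - a)⁻¹ • ((k b, b) - (k a, a))) U (𝓝 ((q, 1) : ℝ × ℝ)) := by
    refine (hq.prodMk_nhds (tendsto_const_nhds (x := (1 : ℝ)))).congr' ?_
    filter_upwards [hmem] with b hb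
    have : b - a ≠ 0 := sub_ne_zero.2 hb.2
    ext
    · simp [slope]
    · simp [this]
  have h2 := ((hasFDerivAt_iterate hx n).hasFDerivWithinAt (s := univ)).lim (l := U)
    (c := fun b => (b - a)⁻¹) (d := fun b => (k b, b) - (k a, a)) (v := (q, 1))
    (by simpa using (hkc.prodMk_nhds hUa).sub_const (k a, a)) (by simp) h1
  refine le_of_tendsto_of_tendsto h2.fst_nhds.abs h2.snd_nhds.abs ?_
  filter_upwards [hmem] with b hb
  have h3 := hk n b hb.1 a ha
  simp only [Prod.smul_fst, Prod.smul_snd, Prod.fst_sub, Prod.snd_sub, smul_eq_mul, abs_mul,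
    add_sub_cancel]
  exact mul_le_mul_of_nonneg_left h3 (abs_nonneg _)

lemma slope_mem {k : ℝ → ℝ} {I : Set ℝ} (hk : IsCentralOn k I) {a b : ℝ} (ha : a ∈ I)
    (hb : b ∈ I \ {a}) : slope k a b ∈ Icc (-1 : ℝ) 1 := by
  have h0 : 0 < |b - a| := abs_pos.2 (sub_ne_zero.2 hb.2)
  have h1 : |k b - k a| ≤ |b - a| := hk 0 b hb.1 a ha
  rw [mem_Icc, ← abs_le, slope_def_field, abs_div]
  exact (div_le_one h0).2 h1

/-- If all limit slopes agree with `q`, the central curve has the derivative `q`. -/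
lemma IsCentralOn.hasDerivWithinAt_of_unique {k : ℝ → ℝ} {I : Set ℝ} (hI : I ⊆ Ico 0 (π / 2))
    (hk : IsCentralOn k I) {a : ℝ} (ha : a ∈ I) {q : ℝ}
    (hq : ∀ q', IsCentralVec (k a, a) (q', 1) → q' = q) : HasDerivWithinAt k q I a := by
  rw [hasDerivWithinAt_iff_tendsto_slope, tendsto_iff_ultrafilter]
  intro U hU
  have hmem : ∀ᶠ b in U, b ∈ I \ {a} := hU self_mem_nhdsWithin
  obtain ⟨q', -, hq'⟩ := (isCompact_Icc (a := (-1 : ℝ)) (b := 1)).ultrafilter_le_nhds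
    (U.map (slope k a)) (le_principal_iff.2 (hmem.mono fun b hb => slope_mem hk ha hb))
  have := hq q' (isCentralVec_of_ultrafilter hI hk ha hU hq')
  rwa [this] at hq'

lemma exists_isCentralVec {x : ℝ × ℝ} (hx : x ∈ strip) : ∃ q, IsCentralVec x (q, 1) := by
  obtain ⟨k, hk, hkx⟩ := exists_isCentralOn hx
  have hne : (𝓝[Ico 0 (π / 2) \ {x.2}] x.2).NeBot := by
    have h1 : (𝓝[>] x.2) ≤ 𝓝[Ico 0 (π / 2) \ {x.2}] x.2 := by
      refine nhdsWithin_le_iff.2 ?_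
      filter_upwards [Ioo_mem_nhdsGT hx.2] with b hb
      exact ⟨⟨hx.1.trans hb.1.le, hb.2⟩, hb.1.ne'⟩
    exact NeBot.mono inferInstance h1
  let U := Ultrafilter.of (𝓝[Ico 0 (π / 2) \ {x.2}] x.2)
  have hU : (U : Filter ℝ) ≤ 𝓝[Ico 0 (π / 2) \ {x.2}] x.2 := Ultrafilter.of_le _
  have hmem : ∀ᶠ b in U, b ∈ Ico 0 (π / 2) \ {x.2} := hU self_mem_nhdsWithin
  obtain ⟨q, -, hq⟩ := (isCompact_Icc (a := (-1 : ℝ)) (b := 1)).ultrafilter_le_nhds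
    (U.map (slope k x.2)) (le_principal_iff.2 (hmem.mono fun b hb => slope_mem hk hx hb))
  have := isCentralVec_of_ultrafilter subset_rfl hk hx hU hq
  rw [hkx] at this
  exact ⟨q, this⟩

/-- The slope `dφ/dψ` of the central line field on the universal cover, i.e. the unique slope of a
central vector. -/
noncomputable def centralSlope (x : ℝ × ℝ) : ℝ := Classical.epsilon fun q => IsCentralVec x (q, 1)

lemma isCentralVec_centralSlope {x : ℝ × ℝ} (hx : x ∈ strip) :
    IsCentralVec x (centralSlope x, 1) :=
  Classical.epsilon_spec (exists_isCentralVec hx)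

lemma eq_centralSlope {x : ℝ × ℝ} (hx : x ∈ strip) {q : ℝ} (hq : IsCentralVec x (q, 1)) :
    q = centralSlope x := by
  simpa using central_unique hx (by simp) (by simp) hq (isCentralVec_centralSlope hx)

lemma abs_centralSlope_le {x : ℝ × ℝ} (hx : x ∈ strip) : |centralSlope x| ≤ 1 := by
  simpa [jacIter] using isCentralVec_centralSlope hx 0

/-- The central slope lies in the interior of the algebraic cone. -/
lemma abs_centralSlope_lt {x : ℝ × ℝ} (hx : x ∈ strip) : |centralSlope x| < 1 := by
  refine (abs_centralSlope_le hx).lt_of_ne fun h => ?_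
  have h1 : |jA x * centralSlope x + jB x| ≤ |jC x * centralSlope x + jD x| := by
    simpa [jacIter, jac_apply] using isCentralVec_centralSlope hx 1
  have key : ∀ e : ℝ, |e| ≤ 1 → |jC x + e * jD x| < |jA x + e * jB x| := fun e he => by
    have h2 := le_jA_add hx he
    have h3 := abs_jC_add_le hx he
    have h4 := le_abs_self (jA x + e * jB x)
    linarith
  rcases eq_or_eq_neg_of_abs_eq h with h | h <;> rw [h] at h1
  · have := key 1 (by simp)
    simp only [mul_one, one_mul] at *
    linarith
  · have := key (-1) (by simp)
    rw [← abs_neg, ← abs_neg (jC x * -1 + jD x)] at h1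
    rw [show jC x + -1 * jD x = -(jC x * -1 + jD x) by ring,
      show jA x + -1 * jB x = -(jA x * -1 + jB x) by ring] at this
    linarith

/-- The invariance of the central slope. -/
lemma jac_centralSlope {x : ℝ × ℝ} (hx : x ∈ strip) :
    (jac x (centralSlope x, 1)).1 =
      centralSlope (liftMap x) * (jac x (centralSlope x, 1)).2 := by
  have h1 := (isCentralVec_centralSlope hx).jac
  have h2 : 0 ≤ (jac x (centralSlope x, 1)).2 := jac_snd_nonneg hx (by simp) (h1 0)
  have h3 := central_unique (liftMap_mem hx) h2 (by simp) h1
    (isCentralVec_centralSlope (liftMap_mem hx))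
  simpa [mul_comm] using h3

/-- The central slope has a closed graph and bounded values, so it is continuous. -/
lemma continuousOn_centralSlope : ContinuousOn centralSlope strip := by
  intro x hx
  rw [ContinuousWithinAt, tendsto_iff_ultrafilter]
  intro U hU
  have hmem : ∀ᶠ y in U, y ∈ strip := hU self_mem_nhdsWithin
  obtain ⟨q, -, hq⟩ := (isCompact_Icc (a := (-1 : ℝ)) (b := 1)).ultrafilter_le_nhds
    (U.map centralSlope)
    (le_principal_iff.2 (hmem.mono fun y hy => abs_le.1 (abs_centralSlope_le hy)))
  suffices IsCentralVec x (q, 1) by rwa [eq_centralSlope hx this] at hq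
  intro n
  have h1 : Tendsto (fun y => (y, ((centralSlope y, 1) : ℝ × ℝ))) U
      (𝓝[strip ×ˢ univ] (x, ((q, 1) : ℝ × ℝ))) := by
    refine tendsto_nhdsWithin_iff.2 ⟨?_, hmem.mono fun y hy => ⟨hy, mem_univ _⟩⟩
    have hy : Tendsto (fun y => y) (U : Filter (ℝ × ℝ)) (𝓝 x) := hU.trans inf_le_left
    have hq' : Tendsto centralSlope U (𝓝 q) := hq
    exact hy.prodMk_nhds (hq'.prodMk_nhds tendsto_const_nhds)
  have h2 := (continuousOn_jacIter n (x, (q, 1)) ⟨hx, mem_univ _⟩).tendsto.comp h1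
  exact le_of_tendsto_of_tendsto h2.fst_nhds.abs h2.snd_nhds.abs
    (hmem.mono fun y hy => isCentralVec_centralSlope hy n)

/-- Central curves are integral curves of the central slope. -/
lemma IsCentralOn.hasDerivWithinAt {k : ℝ → ℝ} {I : Set ℝ} (hI : I ⊆ Ico 0 (π / 2))
    (hk : IsCentralOn k I) {a : ℝ} (ha : a ∈ I) :
    HasDerivWithinAt k (centralSlope (k a, a)) I a :=
  hk.hasDerivWithinAt_of_unique hI ha fun _ h => eq_centralSlope (hI ha) h

/-- Integral curves of the central slope are central curves: along the images of an integral curve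
both `ψ + φ` and `ψ - φ` increase. -/
lemma isCentralOn_of_hasDerivWithinAt {k : ℝ → ℝ} {I : Set ℝ} (hI : I ⊆ Ico 0 (π / 2))
    (hc : Convex ℝ I)
    (h : ∀ a ∈ I, HasDerivWithinAt k (centralSlope (k a, a)) I a) : IsCentralOn k I := by
  intro n
  have hd : ∀ a ∈ I, HasDerivWithinAt (fun a => liftMap^[n] (k a, a))
      (jacIter (k a, a) n (centralSlope (k a, a), 1)) I a := fun a ha =>
    (hasFDerivAt_iterate (x := (k a, a)) (hI ha) n).comp_hasDerivWithinAt (f := fun a => (k a, a)) a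
      ((h a ha).prodMk (hasDerivWithinAt_id a I))
  have hpos : ∀ a ∈ I, 0 ≤ (jacIter (k a, a) n (centralSlope (k a, a), 1)).2 := by
    intro a ha
    have hv := isCentralVec_centralSlope (x := (k a, a)) (hI ha)
    induction n with
    | zero => simp [jacIter]
    | succ n ih =>
      refine jac_snd_nonneg (iterate_mem (x := (k a, a)) (hI ha) n) (ih fun b hb => ?_) (hv (n + 1))
      exact (hasFDerivAt_iterate (x := (k b, b)) (hI hb) n).comp_hasDerivWithinAt
        (f := fun b => (k b, b)) b
        ((h b hb).prodMk (hasDerivWithinAt_id b I))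
  have hv : ∀ a ∈ I, |(jacIter (k a, a) n (centralSlope (k a, a), 1)).1| ≤
      (jacIter (k a, a) n (centralSlope (k a, a), 1)).2 := fun a ha => by
    have := isCentralVec_centralSlope (x := (k a, a)) (hI ha) n
    rwa [abs_of_nonneg (hpos a ha)] at this
  have hd1 := fun a ha => hasFDerivAt_fst.comp_hasDerivWithinAt a (hd a ha)
  have hd2 := fun a ha => hasFDerivAt_snd.comp_hasDerivWithinAt a (hd a ha)
  have hmono : ∀ {f f' : ℝ → ℝ}, (∀ a ∈ I, HasDerivWithinAt f (f' a) I a) →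
      (∀ a ∈ I, 0 ≤ f' a) → MonotoneOn f I := fun {f f'} hf hf' =>
    monotoneOn_of_deriv_nonneg hc (fun a ha => (hf a ha).continuousWithinAt)
      (fun a ha => ((hf a (interior_subset ha)).mono interior_subset).differentiableWithinAt)
      (fun a ha => by
        rw [((hf a (interior_subset ha)).hasDerivAt (mem_interior_iff_mem_nhds.1 ha)).deriv]
        exact hf' a (interior_subset ha))
  have m1 := hmono (fun a ha => (hd2 a ha).fun_add (hd1 a ha)) fun a ha => by
    have := (abs_le.1 (hv a ha)).1
    simp only [ContinuousLinearMap.coe_fst', ContinuousLinearMap.coe_snd']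
    linarith
  have m2 := hmono (fun a ha => (hd2 a ha).fun_sub (hd1 a ha)) fun a ha => by
    have := (abs_le.1 (hv a ha)).2
    simp only [ContinuousLinearMap.coe_fst', ContinuousLinearMap.coe_snd']
    linarith
  intro a ha b hb
  wlog hab : a ≤ b generalizing a b
  · exact (this b hb a ha (not_le.1 hab).le).symm
  have i1 := m1 ha hb hab
  have i2 := m2 ha hb hab
  simp only [Function.comp_apply] at i1 i2
  refine Causal.symm ?_
  refine le_trans ?_ (le_abs_self _)
  rw [abs_le]
  constructor <;> linarith

/-! ### The renormalization map and its differential on the cylinder -/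

open Complex (I) in
/-- `z² + t²`, in real and imaginary parts, for `z = exp (i φ)`. -/
lemma exp_sq_add (φ t : ℝ) : (Complex.exp (φ * I)) ^ 2 + (t : ℂ) ^ 2 =
    Complex.exp (φ * I) ^ 2 * (((1 - t ^ 2 + 2 * t ^ 2 * cos φ ^ 2 : ℝ) : ℂ) -
      ((2 * t ^ 2 * sin φ * cos φ : ℝ) : ℂ) * I) := by
  have h1 : Complex.exp (φ * I) = Complex.cos φ + Complex.sin φ * I := Complex.exp_mul_I _
  have h2 : Complex.cos φ ^ 2 + Complex.sin φ ^ 2 = 1 := by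
    rw [add_comm]; exact Complex.sin_sq_add_cos_sq _
  rw [h1]
  push_cast
  generalize Complex.cos φ = c at *
  generalize Complex.sin φ = s at *
  have hI : I ^ 2 = -1 := Complex.I_sq
  -- the identity is `1 = z² z⁻²`, where `z⁻¹ = c - s i`
  have h3 : (c + s * I) * (c - s * I) = 1 := by linear_combination h2 - s ^ 2 * hI
  have h4 : 1 - (t : ℂ) ^ 2 + 2 * (t : ℂ) ^ 2 * c ^ 2 - 2 * (t : ℂ) ^ 2 * s * c * I =
      1 + (t : ℂ) ^ 2 * (c - s * I) ^ 2 := by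
    linear_combination (-(t : ℂ) ^ 2 * s ^ 2) * hI + (t : ℂ) ^ 2 * h2
  rw [h4]
  linear_combination (-(t : ℂ) ^ 2 * ((c + s * I) * (c - s * I) + 1)) * h3

lemma mul_den_eq (φ t : ℝ) : ((Complex.exp (φ * Complex.I)) ^ 2 + (t : ℂ) ^ 2) *
    (((Complex.exp (φ * Complex.I)) ^ 2)⁻¹ + (t : ℂ) ^ 2) = (den φ t : ℂ) := by
  have h0 : Complex.exp (φ * Complex.I) ≠ 0 := Complex.exp_ne_zero _
  have hc : (cos φ : ℂ) = (Complex.exp (φ * Complex.I) + (Complex.exp (φ * Complex.I))⁻¹) / 2 := by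
    rw [← Complex.exp_neg, Complex.ofReal_cos, Complex.cos, neg_mul]
  rw [den]
  push_cast [hc]
  field_simp
  ring

/-- The embedded point of the cylinder over a point of the strip. -/
noncomputable def coverEmb (x : ℝ × ℝ) : ℂ × ℂ := (Complex.exp (x.1 * Complex.I), (sin x.2 : ℝ))

lemma exp_neg_two_arctan (P Q : ℝ) (hP : 0 < P) :
    Complex.exp (((-2 * arctan (Q / P) : ℝ) : ℂ) * Complex.I) =
      (P - Q * Complex.I) / (P + Q * Complex.I) := by
  set θ := arctan (Q / P)
  have hc : 0 < cos θ := cos_arctan_pos _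
  have hs : sin θ = Q / P * cos θ := by
    rw [← tan_arctan (Q / P), tan_eq_sin_div_cos]; field_simp; rfl
  have hd : (P : ℂ) + Q * Complex.I ≠ 0 := fun h => hP.ne' (by simpa using congrArg Complex.re h)
  have e1 : Complex.exp (((-2 * θ : ℝ) : ℂ) * Complex.I) =
      Complex.exp (-(θ * Complex.I)) / Complex.exp (θ * Complex.I) := by
    rw [← Complex.exp_sub]; congr 1; push_cast; ring
  have e2 : Complex.exp (θ * Complex.I) = (cos θ / P : ℝ) * (P + Q * Complex.I) := by
    rw [Complex.exp_mul_I, ← Complex.ofReal_cos, ← Complex.ofReal_sin, hs]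
    have : (P : ℂ) ≠ 0 := by exact_mod_cast hP.ne'
    push_cast
    field_simp
  have e3 : Complex.exp (-(θ * Complex.I)) = (cos θ / P : ℝ) * (P - Q * Complex.I) := by
    rw [show -((θ : ℂ) * Complex.I) = ((-θ : ℝ) : ℂ) * Complex.I by push_cast; ring,
      Complex.exp_mul_I, ← Complex.ofReal_cos, ← Complex.ofReal_sin, cos_neg, sin_neg, hs]
    have : (P : ℂ) ≠ 0 := by exact_mod_cast hP.ne'
    push_cast
    field_simp
    ring
  have hk : ((cos θ / P : ℝ) : ℂ) ≠ 0 := by exact_mod_cast (div_pos hc hP).ne'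
  rw [e1, e2, e3, mul_div_mul_left _ _ hk]

lemma RG_snd (φ t : ℝ) :
    (RG (Complex.exp (φ * Complex.I), (t : ℂ))).2 = (heightMap φ t : ℂ) := by
  have h0 : Complex.exp (φ * Complex.I) ≠ 0 := Complex.exp_ne_zero _
  have hc : (cos φ : ℂ) = (Complex.exp (φ * Complex.I) + (Complex.exp (φ * Complex.I))⁻¹) / 2 := by
    rw [← Complex.exp_neg, Complex.ofReal_cos, Complex.cos, neg_mul]
  have hd := mul_den_eq φ t
  rw [RG, heightMap, Complex.ofReal_div, ← hd]
  push_cast [hc]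
  congr 1
  · field_simp
    ring
  · field_simp
    ring

lemma RG_coverEmb {x : ℝ × ℝ} (hx : x ∈ strip) : RG (coverEmb x) = coverEmb (liftMap x) := by
  obtain ⟨h0, h1⟩ := sin_mem hx
  have hW := (den_pos (φ := x.1) h0 h1).ne'
  have hN := num_pos (φ := x.1) h0 h1
  refine Prod.ext ?_ ?_
  · change _ = Complex.exp ((angleMap x.1 (sin x.2) : ℝ) * Complex.I)
    have e0 : Complex.exp (x.1 * Complex.I) ≠ 0 := Complex.exp_ne_zero _
    have e1 : Complex.exp ((angleMap x.1 (sin x.2) : ℝ) * Complex.I) =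
        Complex.exp (x.1 * Complex.I) ^ 4 * Complex.exp (((-2 * arctan
          (2 * sin x.2 ^ 2 * sin x.1 * cos x.1 / (1 - sin x.2 ^ 2 + 2 * sin x.2 ^ 2 * cos x.1 ^ 2))
            : ℝ) : ℂ) * Complex.I) := by
      rw [← Complex.exp_nat_mul, ← Complex.exp_add, angleMap]
      congr 1
      push_cast
      ring
    have e2 := exp_sq_add x.1 (sin x.2)
    have e3 := mul_den_eq x.1 (sin x.2)
    rw [e1, exp_neg_two_arctan _ _ hN]
    have e4 := exp_sq_add (-x.1) (sin x.2)
    have e5 : Complex.exp (((-x.1 : ℝ) : ℂ) * Complex.I) = (Complex.exp (x.1 * Complex.I))⁻¹ := by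
      rw [← Complex.exp_neg]; congr 1; push_cast; ring
    rw [e5, cos_neg, sin_neg] at e4
    have e6 : ((Complex.exp (x.1 * Complex.I)) ^ 2)⁻¹ + ((sin x.2 : ℝ) : ℂ) ^ 2 ≠ 0 := fun h => by
      rw [h, mul_zero] at e3; exact hW (by exact_mod_cast e3.symm)
    change (Complex.exp (x.1 * Complex.I) ^ 2 + ((sin x.2 : ℝ) : ℂ) ^ 2) /
      ((Complex.exp (x.1 * Complex.I) ^ 2)⁻¹ + ((sin x.2 : ℝ) : ℂ) ^ 2) = _
    have e7 : ((1 - sin x.2 ^ 2 + 2 * sin x.2 ^ 2 * cos x.1 ^ 2 : ℝ) : ℂ) +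
        ((2 * sin x.2 ^ 2 * sin x.1 * cos x.1 : ℝ) : ℂ) * Complex.I ≠ 0 := fun h =>
      hN.ne' (by simpa only [Complex.add_re, Complex.ofReal_re, Complex.re_ofReal_mul,
        Complex.I_re, mul_zero, add_zero, Complex.zero_re] using congrArg Complex.re h)
    have e8 : (Complex.exp (x.1 * Complex.I) ^ 2)⁻¹ + ((sin x.2 : ℝ) : ℂ) ^ 2 =
        (Complex.exp (x.1 * Complex.I) ^ 2)⁻¹ *
        (((1 - sin x.2 ^ 2 + 2 * sin x.2 ^ 2 * cos x.1 ^ 2 : ℝ) : ℂ) +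
        ((2 * sin x.2 ^ 2 * sin x.1 * cos x.1 : ℝ) : ℂ) * Complex.I) := by
      rw [← inv_pow, e4]
      push_cast
      ring
    rw [e2, e8]
    field_simp
  · change (RG (Complex.exp (x.1 * Complex.I), ((sin x.2 : ℝ) : ℂ))).2 = ((sin (liftMap x).2 : ℝ) : ℂ)
    rw [sin_liftMap hx, RG_snd]

lemma fderiv_RG {φ t : ℝ} (h : den φ t ≠ 0) (v : ℝ) :
    fderiv ℂ RG (Complex.exp (φ * Complex.I), (t : ℂ))
      ((v : ℂ) * (Complex.I * Complex.exp (φ * Complex.I)), 1) =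
      (((dA φ t * v + dB φ t : ℝ) : ℂ) *
        (Complex.I * (RG (Complex.exp (φ * Complex.I), (t : ℂ))).1),
        ((dC φ t * v + dD φ t : ℝ) : ℂ)) := by
  have hI : Complex.I ^ 2 = -1 := Complex.I_sq
  have h0 : Complex.exp (φ * Complex.I) ≠ 0 := Complex.exp_ne_zero _
  have hc : (cos φ : ℂ) = (Complex.exp (φ * Complex.I) + (Complex.exp (φ * Complex.I))⁻¹) / 2 := by
    rw [← Complex.exp_neg, Complex.ofReal_cos, Complex.cos, neg_mul]
  have hs : (sin φ : ℂ) = ((Complex.exp (φ * Complex.I))⁻¹ - Complex.exp (φ * Complex.I)) *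
      Complex.I / 2 := by
    rw [← Complex.exp_neg, Complex.ofReal_sin, Complex.sin, neg_mul]
  have hd := mul_den_eq φ t
  have hd0 : (den φ t : ℂ) ≠ 0 := by exact_mod_cast h
  rw [dA, dB, dC, dD]
  push_cast [hc, hs]
  rw [← hd]
  rw [← hd] at hd0
  clear hc hs hd h
  generalize Complex.exp (φ * Complex.I) = z at *
  generalize (t : ℂ) = t at *
  generalize (v : ℂ) = v at *
  have hN := left_ne_zero_of_mul hd0
  have hM := right_ne_zero_of_mul hd0
  have hK : t ^ 2 * (z ^ 2 + (z ^ 2)⁻¹) + t ^ 4 + 1 ≠ 0 := by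
    convert hd0 using 1
    field_simp
    ring
  have hM' : (1 : ℂ) + z ^ 2 * t ^ 2 ≠ 0 := fun h' => hM (by field_simp; linear_combination h')
  have f1 : HasFDerivAt (fun p : ℂ × ℂ => p.1) (ContinuousLinearMap.fst ℂ ℂ ℂ) (z, t) :=
    hasFDerivAt_fst
  have hdiff : DifferentiableAt ℂ RG (z, t) := by
    have hz2 : ((z, t) : ℂ × ℂ).1 ^ 2 ≠ 0 := pow_ne_zero 2 h0
    unfold RG
    fun_prop (disch := assumption)
  have a1 : HasDerivAt (fun r : ℂ => z + r * (v * (Complex.I * z))) (v * (Complex.I * z)) 0 := by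
    simpa using ((hasDerivAt_id (0 : ℂ)).mul_const (v * (Complex.I * z))).const_add z
  have a2 : HasDerivAt (fun r : ℂ => t + r) 1 0 := (hasDerivAt_id (0 : ℂ)).const_add t
  have hdiff' : HasFDerivAt RG (fderiv ℂ RG (z, t)) (z + 0 * (v * (Complex.I * z)), t + 0) := by
    simpa using hdiff.hasFDerivAt
  have a3 := hdiff'.comp_hasDerivAt (0 : ℂ) (a1.prodMk a2)
  have z0 : z + 0 * (v * (Complex.I * z)) ≠ 0 := by simpa using h0
  have b1 := a1.fun_pow 2
  have b2 := a2.fun_pow 2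
  have b3 := b1.fun_inv (pow_ne_zero 2 z0)
  have b4 := (b1.fun_add b2).fun_div (b3.fun_add b2) (by simpa using hM)
  have b5 := (b2.fun_mul ((b1.fun_add b3).add_const 2)).fun_div
    (((b2.fun_mul (b1.fun_add b3)).fun_add (a2.fun_pow 4)).add_const 1) (by simpa using hK)
  have h5 := a3.unique (b4.prodMk b5)
  rw [h5]
  simp only [zero_mul, add_zero, RG]
  refine Prod.ext ?_ ?_
  · simp only
    norm_num
    field_simp
    ring_nf
    simp only [hI]
    ring_nf
  · simp only
    norm_num
    have hN' : z ^ 2 + t ^ 2 ≠ 0 := hN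
    have hM'' : 1 + t ^ 2 * z ^ 2 ≠ 0 := by rwa [mul_comm]
    field_simp
    rw [show t ^ 2 * (z ^ 4 + 1 + t ^ 2 * z ^ 2) + z ^ 2 = (z ^ 2 + t ^ 2) * (1 + t ^ 2 * z ^ 2) by
      ring]
    field_simp
    ring

/-! ### The central line field on the cylinder -/

/-- The point of the cylinder under a point of the universal cover. -/
noncomputable def down (p : ℝ × ℝ) : Cyl := (Circle.exp p.1, projIcc 0 1 zero_le_one (sin p.2))

lemma eq_one_of_not_lt {t : unitInterval} (h : ¬ (t : ℝ) < 1) : t = 1 := by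
  by_contra h'
  exact h (unitInterval.lt_one_iff_ne_one.2 h')

/-- `p` is a point of the universal cover over the point `x` of the topless cylinder. -/
def IsOver (p : ℝ × ℝ) (x : Cyl) : Prop := p ∈ strip ∧ Circle.exp p.1 = x.1 ∧ sin p.2 = x.2

/-- The deck transformations of the universal cover. -/
noncomputable def shift (m : ℤ) (p : ℝ × ℝ) : ℝ × ℝ := (p.1 + m * (2 * π), p.2)

lemma coe_projIcc_sin {ψ : ℝ} (h : ψ ∈ Ico 0 (π / 2)) :
    ((projIcc 0 1 zero_le_one (sin ψ) : unitInterval) : ℝ) = sin ψ := by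
  rw [projIcc_of_mem _ ⟨(sin_mem h).1, (sin_mem h).2.le⟩]

lemma isOver_down {p : ℝ × ℝ} (hp : p ∈ strip) : IsOver p (down p) :=
  ⟨hp, rfl, (coe_projIcc_sin hp).symm⟩

lemma IsOver.down_eq {p : ℝ × ℝ} {x : Cyl} (h : IsOver p x) : down p = x :=
  Prod.ext h.2.1 (Subtype.ext ((coe_projIcc_sin h.1).trans h.2.2))

lemma IsOver.lt_one {p : ℝ × ℝ} {x : Cyl} (h : IsOver p x) : (x.2 : ℝ) < 1 :=
  h.2.2 ▸ (sin_mem h.1).2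

/-- The heights correspond by `t = sin ψ`. -/
lemma isOver_arcsin {x : Cyl} {φ : ℝ} (h : (x.2 : ℝ) < 1) (hφ : Circle.exp φ = x.1) :
    IsOver (φ, arcsin x.2) x :=
  ⟨arcsin_mem x.2.2.1 h, hφ, sin_arcsin (by linarith [x.2.2.1]) x.2.2.2⟩

lemma exists_isOver {x : Cyl} (h : (x.2 : ℝ) < 1) : ∃ p, IsOver p x :=
  ⟨_, isOver_arcsin h (Circle.exp_arg x.1)⟩

lemma IsOver.emb_eq {p : ℝ × ℝ} {x : Cyl} (h : IsOver p x) : emb x = coverEmb p := by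
  rw [emb, coverEmb, ← h.2.1, h.2.2, Circle.coe_exp]

lemma eq_of_sin_eq {a b : ℝ} (ha : a ∈ Ico 0 (π / 2)) (hb : b ∈ Ico 0 (π / 2))
    (h : sin a = sin b) : a = b :=
  injOn_sin ⟨by linarith [ha.1, pi_pos], ha.2.le⟩ ⟨by linarith [hb.1, pi_pos], hb.2.le⟩ h

lemma IsOver.exists_shift {p p' : ℝ × ℝ} {x : Cyl} (h : IsOver p x) (h' : IsOver p' x) :
    ∃ m, p' = shift m p := by
  obtain ⟨m, hm⟩ := Circle.exp_eq_exp.1 (h'.2.1.trans h.2.1.symm)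
  exact ⟨m, Prod.ext hm (eq_of_sin_eq h'.1 h.1 (h'.2.2.trans h.2.2.symm))⟩

lemma IsOver.liftMap {p : ℝ × ℝ} {x y : Cyl} (h : IsOver p x) (hxy : RG (emb x) = emb y) :
    IsOver (liftMap p) y := by
  have h1 := RG_coverEmb h.1
  rw [← h.emb_eq, hxy] at h1
  refine ⟨liftMap_mem h.1, ?_, ?_⟩
  · have := congrArg Prod.fst h1
    rw [emb, coverEmb] at this
    ext
    rw [Circle.coe_exp]
    exact this.symm
  · have := congrArg Prod.snd h1
    rw [emb, coverEmb] at this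
    exact (Complex.ofReal_injective this).symm

lemma IsOver.iterate {p : ℝ × ℝ} {x : Cyl} (h : IsOver p x) (n : ℕ) :
    RG^[n] (emb x) = coverEmb (DHL.liftMap^[n] p) := by
  induction n with
  | zero => exact h.emb_eq
  | succ n ih =>
    rw [Function.iterate_succ_apply', Function.iterate_succ_apply', ih,
      RG_coverEmb (iterate_mem h.1 n)]

lemma liftMap_shift (m : ℤ) (p : ℝ × ℝ) : liftMap (shift m p) = shift (4 * m) (liftMap p) := by
  simp only [liftMap, shift, angleMap, heightMap, den, sin_add_int_mul_two_pi,
    cos_add_int_mul_two_pi]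
  ext
  · push_cast; ring
  · rfl

lemma jac_shift (m : ℤ) (p : ℝ × ℝ) : jac (shift m p) = jac p := by
  simp only [jac, jA, jB, jC, jD, dA, dB, dC, dD, cosHeight, heightMap, shift, den,
    sin_add_int_mul_two_pi, cos_add_int_mul_two_pi]

lemma jacIter_shift (m : ℤ) (p : ℝ × ℝ) (n : ℕ) : jacIter (shift m p) n = jacIter p n := by
  induction n generalizing m p with
  | zero => rfl
  | succ n ih => rw [jacIter_succ', jacIter_succ', jac_shift, liftMap_shift, ih]

lemma centralSlope_shift (m : ℤ) (p : ℝ × ℝ) : centralSlope (shift m p) = centralSlope p := by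
  simp only [centralSlope, IsCentralVec, jacIter_shift]

open Classical in
/-- The central line field, as the function `dφ/dt`.  Below the top it is the central slope
`dφ/dψ`, divided by `dt/dψ = cos ψ`.  On the top of the cylinder it is `dφ/dt = tan φ`, the kernel
of the differential of the renormalization map; at the indeterminacy points, where `cos φ = 0`, the
value is irrelevant. -/
noncomputable def centralField (x : Cyl) : ℝ :=
  if (x.2 : ℝ) < 1 then
    centralSlope (Complex.arg x.1, arcsin x.2) / cos (arcsin x.2)
  else (x.1 : ℂ).im / (x.1 : ℂ).re

lemma IsOver.centralField_eq {p : ℝ × ℝ} {x : Cyl} (h : IsOver p x) :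
    centralField x = centralSlope p / cos p.2 := by
  have h1 := isOver_arcsin h.lt_one (Circle.exp_arg x.1)
  obtain ⟨m, rfl⟩ := h1.exists_shift h
  rw [centralField, if_pos h.lt_one, centralSlope_shift]
  rfl

lemma centralField_top {x : Cyl} (h : x.2 = 1) {φ : ℝ} (hφ : Circle.exp φ = x.1) :
    centralField x = tan φ := by
  rw [centralField, if_neg (by simp [h]), ← hφ, Circle.coe_exp, Complex.exp_ofReal_mul_I_re,
    Complex.exp_ofReal_mul_I_im, tan_eq_sin_div_cos]

lemma mem_Indet_iff {x : Cyl} {φ : ℝ} (hφ : Circle.exp φ = x.1) :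
    x ∈ Indet ↔ cos φ = 0 ∧ x.2 = 1 := by
  have h1 : (x.1 : ℂ) = cos φ + sin φ * Complex.I := by
    rw [← hφ, Circle.coe_exp, Complex.exp_mul_I, Complex.ofReal_cos, Complex.ofReal_sin]
  have h2 : (x.1 : ℂ) ^ 2 = -1 ↔ cos φ = 0 := by
    have h3 := sin_sq_add_cos_sq φ
    rw [h1]
    constructor
    · intro h
      have h4 := congrArg Complex.re h
      simp [pow_two, -Complex.ofReal_cos, -Complex.ofReal_sin] at h4
      exact pow_eq_zero_iff (two_ne_zero) |>.1 (by nlinarith : cos φ ^ 2 = 0)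
    · intro h
      rw [h] at h3 ⊢
      have h4 : ((sin φ : ℝ) : ℂ) ^ 2 = 1 := by
        rw [← Complex.ofReal_pow]; exact_mod_cast (by linarith : sin φ ^ 2 = 1)
      rw [Complex.ofReal_zero, zero_add, mul_pow, h4, Complex.I_sq, one_mul]
  rw [Indet, mem_ofPred_eq, h2]

lemma den_ne_zero_iff {x : Cyl} {φ : ℝ} (hφ : Circle.exp φ = x.1) :
    den φ x.2 ≠ 0 ↔ x ∉ Indet := by
  rw [mem_Indet_iff hφ]
  by_cases h : x.2 = 1
  · simp [h, den]
  · have : (x.2 : ℝ) < 1 := unitInterval.lt_one_iff_ne_one.2 h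
    simp [h, (den_pos (φ := φ) x.2.2.1 this).ne']

lemma not_mem_Indet {x : Cyl} (h : (x.2 : ℝ) < 1) : x ∉ Indet := fun h' => by
  rw [h'.2] at h; simp at h

lemma not_mem_PreIndet {x : Cyl} (h : (x.2 : ℝ) < 1) : x ∉ PreIndet := by
  rintro ⟨-, y, hy, hxy⟩
  obtain ⟨p, hp⟩ := exists_isOver h
  exact not_mem_Indet (hp.liftMap hxy).lt_one hy

lemma not_mem_exceptional {x : Cyl} (h : (x.2 : ℝ) < 1) : x ∉ Indet ∪ PreIndet :=
  fun h' => h'.elim (not_mem_Indet h) (not_mem_PreIndet h)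

/-- The action of the differential on slopes. -/
lemma fderiv_eq_smul_iff {x y : Cyl} {φ v w c : ℝ} (hφ : Circle.exp φ = x.1) (hx : x ∉ Indet)
    (hxy : RG (emb x) = emb y) :
    fderiv ℂ RG (emb x) (tangentVec x v) = c • tangentVec y w ↔
      dC φ x.2 * v + dD φ x.2 = c ∧ dA φ x.2 * v + dB φ x.2 = c * w := by
  have h1 := fderiv_RG ((den_ne_zero_iff hφ).2 hx) v
  have h2 : emb x = (Complex.exp (φ * Complex.I), ((x.2 : ℝ) : ℂ)) := by
    rw [emb, ← hφ, Circle.coe_exp]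
  have h3 : tangentVec x v = ((v : ℂ) * (Complex.I * Complex.exp (φ * Complex.I)), 1) := by
    rw [tangentVec, ← hφ, Circle.coe_exp]
  have h4 : (Complex.I * (y.1 : ℂ)) ≠ 0 := mul_ne_zero Complex.I_ne_zero (Circle.coe_ne_zero _)
  rw [h3, h2, h1, ← h2, hxy, tangentVec, Prod.smul_mk, Prod.mk.injEq, emb]
  simp only [Complex.real_smul, ← mul_assoc, mul_one]
  rw [mul_assoc, mul_assoc _ Complex.I, mul_left_inj' h4, ← Complex.ofReal_mul, Complex.ofReal_inj,
    Complex.ofReal_inj, and_comm]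

lemma cos_liftMap {p : ℝ × ℝ} : cos (liftMap p).2 = cosHeight p.1 (sin p.2) := by
  rw [liftMap, cos_arcsin, cosHeight]

/-- The differential in the coordinates `(φ, t)` and `(φ, ψ)`. -/
lemma jac_mul_cos (p : ℝ × ℝ) (v : ℝ) : jac p (v * cos p.2, 1) =
    (cos p.2 * (dA p.1 (sin p.2) * v + dB p.1 (sin p.2)),
      cos p.2 * (dC p.1 (sin p.2) * v + dD p.1 (sin p.2)) / cos (liftMap p).2) := by
  rw [jac_apply, cos_liftMap, jA, jB, jC, jD]
  ext <;> simp only <;> ring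

lemma centralField_slope_eq {x y : Cyl} {p : ℝ × ℝ} (hp : IsOver p x)
    (hxy : RG (emb x) = emb y) :
    dA p.1 x.2 * centralField x + dB p.1 x.2 =
      centralField y * (dC p.1 x.2 * centralField x + dD p.1 x.2) := by
  have hc := (cos_pos_of_mem hp.1).ne'
  have h1 := jac_centralSlope hp.1
  have h2 : centralSlope p = centralField x * cos p.2 := by
    rw [hp.centralField_eq]; field_simp
  have hc' := (cos_pos_of_mem (liftMap_mem hp.1)).ne'
  rw [(hp.liftMap hxy).centralField_eq]
  rw [h2, jac_mul_cos, hp.2.2] at h1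
  simp only at h1
  field_simp
  have h3 : cos p.2 * ((dA p.1 x.2 * centralField x + dB p.1 x.2) * cos (liftMap p).2) =
      cos p.2 * (centralSlope (liftMap p) * (dC p.1 x.2 * centralField x + dD p.1 x.2)) := by
    rw [← mul_assoc, h1]; field_simp
  rw [mul_comm (dC _ _)] at h3
  exact mul_left_cancel₀ hc h3

/-- The formulas for the differential on the top of the cylinder. -/
lemma partials_top {φ : ℝ} (h : cos φ ≠ 0) :
    dA φ 1 = 2 ∧ dB φ 1 = -(2 * tan φ) ∧ dC φ 1 = 0 ∧ dD φ 1 = 0 := by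
  rw [dA, dB, dC, dD, den, tan_eq_sin_div_cos]
  refine ⟨?_, ?_, ?_, ?_⟩ <;> field_simp <;> norm_num <;> ring

/-- On the top of the cylinder the renormalization map is `z ↦ z²`. -/
lemma RG_top {x : Cyl} (hx : x ∉ Indet) (h : x.2 = 1) : RG (emb x) = emb (x.1 ^ 2, 1) := by
  have h0 : (x.1 : ℂ) ≠ 0 := Circle.coe_ne_zero _
  have h1 : (x.1 : ℂ) ^ 2 + 1 ≠ 0 := fun h' => hx ⟨eq_neg_of_add_eq_zero_left h', h⟩
  have h2 : 1 + (x.1 : ℂ) ^ 2 ≠ 0 := by rwa [add_comm]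
  have h3 : (x.1 : ℂ) ^ 2 + ((x.1 : ℂ) ^ 2)⁻¹ + 2 ≠ 0 := by
    have : (x.1 : ℂ) ^ 2 + ((x.1 : ℂ) ^ 2)⁻¹ + 2 = ((x.1 : ℂ) ^ 2 + 1) ^ 2 / (x.1 : ℂ) ^ 2 := by
      field_simp; ring
    rw [this]
    positivity
  rw [RG, emb, emb, h]
  ext
  · simp
    field_simp
    ring
  · simp only [Icc.coe_one, Complex.ofReal_one, one_pow, one_mul]
    rw [add_assoc _ (1 : ℂ), one_add_one_eq_two, div_self h3]

lemma centralField_invariant {x y : Cyl} (hx : x ∉ Indet) (hxy : RG (emb x) = emb y) :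
    ∃ c : ℝ, fderiv ℂ RG (emb x) (tangentVec x (centralField x)) =
      c • tangentVec y (centralField y) := by
  by_cases h : (x.2 : ℝ) < 1
  · obtain ⟨p, hp⟩ := exists_isOver h
    refine ⟨_, (fderiv_eq_smul_iff hp.2.1 hx hxy).2 ⟨rfl, ?_⟩⟩
    rw [centralField_slope_eq hp hxy, mul_comm]
  · have h1 := eq_one_of_not_lt h
    have hφ := Circle.exp_arg x.1
    refine ⟨_, (fderiv_eq_smul_iff hφ hx hxy).2 ⟨rfl, ?_⟩⟩
    have hc : cos (Complex.arg x.1) ≠ 0 := fun h' => hx ((mem_Indet_iff hφ).2 ⟨h', h1⟩)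
    obtain ⟨hA, hB, hC, hD⟩ := partials_top hc
    rw [centralField_top h1 hφ, h1, Set.Icc.coe_one, hA, hB, hC, hD]
    ring

/-- A line field in the algebraic cones invariant under the differential is the central one: below
the top its vectors are central, and on the top it must be the kernel of the differential. -/
lemma eq_centralField {s l : Cyl → ℝ} (hs : ∀ x, algSlope x ≤ s x)
    (hl : IsCentralLineField s l) : EqOn l centralField (Indet ∪ PreIndet)ᶜ := by
  have hinv : ∀ p ∈ strip, ∃ c : ℝ, jac p (l (down p) * cos p.2, 1) =
      c • (l (down (liftMap p)) * cos (liftMap p).2, 1) := by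
    intro p hp
    have ho := isOver_down hp
    have ho' := isOver_down (liftMap_mem hp)
    have hxy : RG (emb (down p)) = emb (down (liftMap p)) := by
      rw [ho.emb_eq, ho'.emb_eq, RG_coverEmb hp]
    obtain ⟨c, hc⟩ := hl.invariant _ _ (not_mem_Indet ho.lt_one) (not_mem_Indet ho'.lt_one) hxy
    obtain ⟨h1, h2⟩ := (fderiv_eq_smul_iff ho.2.1 (not_mem_Indet ho.lt_one) hxy).1 hc
    rw [← ho.2.2] at h1 h2
    have hc' := (cos_pos_of_mem (liftMap_mem hp)).ne'
    refine ⟨cos p.2 * c / cos (liftMap p).2, ?_⟩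
    rw [jac_mul_cos, h1, h2]
    ext
    · simp only [Prod.smul_fst, smul_eq_mul]
      field_simp
    · simp
  have hvert : ∀ p ∈ strip, |l (down p) * cos p.2| ≤ 1 := by
    intro p hp
    have ho := isOver_down hp
    have h1 := hl.vertical _ (not_mem_Indet ho.lt_one)
    have h2 : algSlope (down p) = cos p.2 := by
      rw [algSlope, ← ho.2.2, cos_eq_sqrt_one_sub_sin_sq (by linarith [hp.1, pi_pos]) hp.2.le]
    rw [abs_mul, abs_of_pos (cos_pos_of_mem hp), ← h2, mul_comm]
    exact (mul_le_mul_of_nonneg_right (hs _) (abs_nonneg _)).trans h1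
  have hcen : ∀ p ∈ strip, IsCentralVec p (l (down p) * cos p.2, 1) := by
    intro p hp n
    obtain ⟨c, hc⟩ : ∃ c : ℝ, jacIter p n (l (down p) * cos p.2, 1) =
        c • (l (down (liftMap^[n] p)) * cos (liftMap^[n] p).2, 1) := by
      induction n with
      | zero => exact ⟨1, by simp [jacIter]⟩
      | succ n ih =>
        obtain ⟨c, hc⟩ := ih
        obtain ⟨d, hd⟩ := hinv _ (iterate_mem hp n)
        refine ⟨c * d, ?_⟩
        rw [jacIter, ContinuousLinearMap.comp_apply, hc, map_smul, hd, smul_smul,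
          Function.iterate_succ_apply']
    rw [hc]
    simp only [Prod.smul_fst, Prod.smul_snd, smul_eq_mul, abs_mul c]
    refine mul_le_mul_of_nonneg_left ?_ (abs_nonneg c)
    rw [abs_one]
    exact hvert _ (iterate_mem hp n)
  intro x hx
  have hx1 : x ∉ Indet := fun h => hx (Or.inl h)
  by_cases h : (x.2 : ℝ) < 1
  · obtain ⟨p, hp⟩ := exists_isOver h
    have h1 := eq_centralSlope hp.1 (hcen p hp.1)
    rw [hp.down_eq] at h1
    rw [hp.centralField_eq, ← h1]
    have := (cos_pos_of_mem hp.1).ne'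
    field_simp
  · have h1 := eq_one_of_not_lt h
    have hφ := Circle.exp_arg x.1
    have hc : cos (Complex.arg x.1) ≠ 0 := fun h' => hx1 ((mem_Indet_iff hφ).2 ⟨h', h1⟩)
    have hy := RG_top hx1 h1
    have hy1 : (x.1 ^ 2, 1) ∉ Indet := fun h' => hx (Or.inr ⟨hx1, _, h', hy⟩)
    obtain ⟨c, h2⟩ := hl.invariant _ _ hx1 hy1 hy
    obtain ⟨h3, h4⟩ := (fderiv_eq_smul_iff hφ hx1 hy).1 h2
    obtain ⟨hA, hB, hC, hD⟩ := partials_top hc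
    rw [h1, Icc.coe_one, hC, hD] at h3
    rw [h1, Icc.coe_one, hA, hB, ← h3] at h4
    rw [centralField_top h1 hφ]
    linarith

/-! ### Bounds and continuity of the central line field near the top -/

lemma coe_re_eq_cos {z : Circle} {φ : ℝ} (h : Circle.exp φ = z) : (z : ℂ).re = cos φ := by
  rw [← h, Circle.coe_exp, Complex.exp_ofReal_mul_I_re]

lemma exists_RG_eq {x : Cyl} (hx : x ∉ Indet) : ∃ y, RG (emb x) = emb y := by
  by_cases h : (x.2 : ℝ) < 1
  · obtain ⟨p, hp⟩ := exists_isOver h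
    exact ⟨down (liftMap p), by
      rw [hp.emb_eq, RG_coverEmb hp.1, (isOver_down (liftMap_mem hp.1)).emb_eq]⟩
  · exact ⟨_, RG_top hx (eq_one_of_not_lt h)⟩

lemma abs_centralField_mul_cos_lt {x : Cyl} {p : ℝ × ℝ} (hp : IsOver p x) :
    |centralField x| * cos p.2 < 1 := by
  have hc := cos_pos_of_mem hp.1
  rw [hp.centralField_eq, abs_div, abs_of_pos hc, div_mul_cancel₀ _ hc.ne']
  exact abs_centralSlope_lt hp.1

/-- Near the top the central line field is at most of the order of `1 / |ε|`, where
`|cos φ| = sin |ε|`: the image of the central line lies in the algebraic cone, which bounds the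
slope of the line itself by the invariance equation. -/
lemma centralField_bound {x : Cyl} (hx : x ∉ Indet) :
    (x.2 : ℝ) ^ 2 * |(x.1 : ℂ).re| * |centralField x| ≤ 2 := by
  by_cases h : (x.2 : ℝ) < 1
  · obtain ⟨p, hp⟩ := exists_isOver h
    obtain ⟨y, hy⟩ := exists_RG_eq hx
    have h0 : 0 ≤ (x.2 : ℝ) := x.2.2.1
    rw [coe_re_eq_cos hp.2.1]
    rcases eq_or_ne (x.2 * |cos p.1|) 0 with h2 | h2
    · rw [pow_two, mul_assoc (x.2 : ℝ), h2]; simp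
    have hX : 0 < x.2 * |cos p.1| := (by positivity : 0 ≤ x.2 * |cos p.1|).lt_of_ne' h2
    have hX' : 0 < |cos p.1| := pos_of_mul_pos_right hX h0
    have ht : (0 : ℝ) < x.2 := pos_of_mul_pos_left hX (abs_nonneg _)
    have hσ : 0 < 1 - (x.2 : ℝ) ^ 2 := by nlinarith
    have hW := den_pos (φ := p.1) h0 h
    have h3 := centralField_slope_eq hp hy
    have h4 := abs_centralField_mul_cos_lt (hp.liftMap hy)
    have h5 := le_cosHeight (φ := p.1) h0 h
    have hS := cosHeight_pos (φ := p.1) h0 h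
    rw [cos_liftMap, hp.2.2] at h4
    set v := centralField x
    have h6 : cosHeight p.1 x.2 * |dA p.1 x.2 * v + dB p.1 x.2| ≤
        |dC p.1 x.2 * v + dD p.1 x.2| := by
      rw [h3, abs_mul, ← mul_assoc, mul_comm (cosHeight p.1 _)]
      exact mul_le_of_le_one_left (abs_nonneg _) h4.le
    have h7 := (mul_le_mul_of_nonneg_right h5 (abs_nonneg _)).trans h6
    have e1 : dA p.1 x.2 * v + dB p.1 x.2 = 4 / den p.1 x.2 *
        ((1 - (x.2 : ℝ) ^ 2 + 2 * x.2 ^ 2 * cos p.1 ^ 2) * v - 2 * x.2 * sin p.1 * cos p.1) := by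
      rw [dA, dB]; ring
    have e2 : dC p.1 x.2 * v + dD p.1 x.2 =
        8 * x.2 * cos p.1 * (1 - (x.2 : ℝ) ^ 2) / den p.1 x.2 ^ 2 *
        (cos p.1 * (1 + x.2 ^ 2) - x.2 * sin p.1 * (1 - (x.2 : ℝ) ^ 2) * v) := by
      rw [dC, dD]; ring
    have e3 : |8 * x.2 * cos p.1 * (1 - (x.2 : ℝ) ^ 2) / den p.1 x.2 ^ 2| =
        8 * x.2 * |cos p.1| * (1 - (x.2 : ℝ) ^ 2) / den p.1 x.2 ^ 2 := by
      rw [abs_div, abs_mul, abs_mul, abs_mul, abs_of_pos hσ, abs_of_pos ht,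
        abs_of_pos (pow_pos hW 2), abs_of_pos (by norm_num : (0 : ℝ) < 8)]
    rw [e1, e2, abs_mul, abs_mul, e3, abs_of_pos (by positivity : 0 < 4 / den p.1 x.2)] at h7
    set a := (1 - (x.2 : ℝ) ^ 2 + 2 * x.2 ^ 2 * cos p.1 ^ 2) * v - 2 * x.2 * sin p.1 * cos p.1
    set b := cos p.1 * (1 + (x.2 : ℝ) ^ 2) - x.2 * sin p.1 * (1 - (x.2 : ℝ) ^ 2) * v
    have hk : 0 < 8 * x.2 * |cos p.1| * (1 - (x.2 : ℝ) ^ 2) / den p.1 x.2 ^ 2 := by positivity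
    have h8 : |a| ≤ |b| := by
      refine le_of_mul_le_mul_left ?_ hk
      refine le_trans ?_ h7
      have : 8 / 3 * x.2 * |cos p.1| * (1 - (x.2 : ℝ) ^ 2) / den p.1 x.2 * (4 / den p.1 x.2 * |a|) =
        4 / 3 * (8 * x.2 * |cos p.1| * (1 - (x.2 : ℝ) ^ 2) / den p.1 x.2 ^ 2 * |a|) := by
        field_simp
      rw [this]
      have h9 := mul_nonneg hk.le (abs_nonneg a)
      linarith
    have hs : |sin p.1| ≤ 1 := abs_sin_le_one _
    have h9 : (1 - (x.2 : ℝ) ^ 2 + 2 * x.2 ^ 2 * cos p.1 ^ 2) * |v| - 2 * x.2 * |cos p.1| ≤ |a| := by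
      have := abs_sub_abs_le_abs_sub ((1 - (x.2 : ℝ) ^ 2 + 2 * x.2 ^ 2 * cos p.1 ^ 2) * v)
        (2 * x.2 * sin p.1 * cos p.1)
      rw [abs_mul, abs_of_nonneg (by positivity : 0 ≤ 1 - (x.2 : ℝ) ^ 2 +
        2 * x.2 ^ 2 * cos p.1 ^ 2), abs_mul, abs_mul _ (sin p.1),
        abs_of_nonneg (by positivity : (0 : ℝ) ≤ 2 * x.2)] at this
      have h10 : 2 * x.2 * |sin p.1| * |cos p.1| ≤ 2 * x.2 * 1 * |cos p.1| := by gcongr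
      linarith
    have h10 : |b| ≤ |cos p.1| * (1 + (x.2 : ℝ) ^ 2) + x.2 * (1 - (x.2 : ℝ) ^ 2) * |v| := by
      have := abs_sub (cos p.1 * (1 + (x.2 : ℝ) ^ 2)) (x.2 * sin p.1 * (1 - (x.2 : ℝ) ^ 2) * v)
      rw [abs_mul, abs_mul (_ * _) v, abs_mul _ (1 - (x.2 : ℝ) ^ 2), abs_mul _ (sin p.1),
        abs_of_nonneg (by positivity : 0 ≤ 1 + (x.2 : ℝ) ^ 2), abs_of_pos hσ, abs_of_pos ht] at this
      have h11 : x.2 * |sin p.1| * (1 - (x.2 : ℝ) ^ 2) * |v| ≤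
        x.2 * 1 * (1 - (x.2 : ℝ) ^ 2) * |v| := by gcongr
      linarith
    have h11 : 0 ≤ (1 - (x.2 : ℝ)) * (1 - (x.2 : ℝ) ^ 2) * |v| :=
      mul_nonneg (mul_nonneg (by linarith) hσ.le) (abs_nonneg _)
    have h12 : |cos p.1| * (x.2 ^ 2 * |cos p.1| * |v|) ≤ |cos p.1| * 2 := by
      have : cos p.1 ^ 2 = |cos p.1| ^ 2 := (sq_abs _).symm
      rw [this] at h9
      nlinarith
    exact le_of_mul_le_mul_left h12 hX'
  · have h1 := eq_one_of_not_lt h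
    have hφ := Circle.exp_arg x.1
    have hc : cos (Complex.arg x.1) ≠ 0 := fun h' => hx ((mem_Indet_iff hφ).2 ⟨h', h1⟩)
    rw [centralField_top h1 hφ, h1, Icc.coe_one, coe_re_eq_cos hφ, tan_eq_sin_div_cos, abs_div]
    have := abs_sin_le_one (Complex.arg x.1)
    have hc' := abs_pos.2 hc
    field_simp
    linarith

lemma abs_re_eq_sin_epsAbs (x : Cyl) : |(x.1 : ℂ).re| = sin (epsAbs x) := by
  have h1 := Complex.abs_arg_le_pi (x.1 : ℂ)
  have h2 := abs_nonneg (Complex.arg (x.1 : ℂ))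
  rw [coe_re_eq_cos (Circle.exp_arg x.1), ← cos_abs, ← sin_pi_div_two_sub, epsAbs,
    abs_sin_eq_sin_abs_of_abs_le_pi]
  rw [abs_le]
  constructor <;> linarith

lemma epsAbs_le (x : Cyl) : epsAbs x ≤ π / 2 := by
  have h1 := Complex.abs_arg_le_pi (x.1 : ℂ)
  have h2 := abs_nonneg (Complex.arg (x.1 : ℂ))
  rw [epsAbs, abs_le]
  constructor <;> linarith

/-- The central line field lies in the interiors of the modified vertical cones.  Where `s` is not
the algebraic slope, `s ≤ 11/30 m` with `m = min (|ε|, εb)`, which `centralField_bound` beats. -/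
lemma centralField_vertical {εb : ℝ} {s : Cyl → ℝ} (h0 : 0 < εb) (h1 : εb < 1 / 10)
    (hs : IsModifiedSlope (1 / 10) εb s) {x : Cyl} (hx : x ∉ Indet) :
    s x * |centralField x| < 1 := by
  by_cases hw : tau x ≤ εb ^ 2 / 18 ∧ tau x ≤ epsAbs x ^ 2 / 18
  · have he : 0 ≤ epsAbs x := abs_nonneg _
    have key : ∃ m, 0 < m ∧ m < 1 / 10 ∧ m ≤ epsAbs x ∧ s x ≤ 11 / 30 * m := by
      rcases lt_or_ge (epsAbs x) εb with h2 | h2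
      · refine ⟨epsAbs x, he.lt_of_ne' fun h3 => hx ?_, by linarith, le_rfl, ?_⟩
        · have h4 := hw.2
          rw [h3, tau] at h4
          have h5 := x.2.2.2
          have h6 : x.2 = 1 := Subtype.ext (le_antisymm h5 (by norm_num at h4; simpa using h4))
          have h7 := abs_re_eq_sin_epsAbs x
          rw [h3, sin_zero, coe_re_eq_cos (Circle.exp_arg x.1), abs_eq_zero] at h7
          exact (mem_Indet_iff (Circle.exp_arg x.1)).2 ⟨h7, h6⟩
        · have := (abs_le.1 (hs.grey x hw.2 h2)).2
          linarith
      · refine ⟨εb, h0, h1, h2, ?_⟩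
        rw [hs.black x hw.1 h2]
        have : √(εb ^ 2 / 18 * (2 - εb ^ 2 / 18)) ≤ εb / 3 := by
          apply Real.sqrt_le_iff.2 ⟨by positivity, ?_⟩
          nlinarith [sq_nonneg (εb ^ 2)]
        linarith
    obtain ⟨m, hm0, hm1, hm2, hm3⟩ := key
    have h3 := centralField_bound hx
    rw [abs_re_eq_sin_epsAbs] at h3
    have h4 : 99 / 100 * m ≤ sin (epsAbs x) := by
      have h5 : sin m ≤ sin (epsAbs x) :=
        sin_le_sin_of_le_of_le_pi_div_two (by linarith [pi_pos]) (epsAbs_le x) hm2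
      have h6 := sin_gt_sub_cube hm0
      nlinarith [mul_pos hm0 hm0]
    have h5 : 99 / 100 ≤ (x.2 : ℝ) ^ 2 := by
      have h6 := hw.1
      rw [tau] at h6
      have : 999 / 1000 ≤ (x.2 : ℝ) := by nlinarith
      nlinarith
    have h6 : 99 / 100 * (99 / 100 * m) * |centralField x| ≤ 2 := le_trans (by gcongr) h3
    calc s x * |centralField x| ≤ 11 / 30 * m * |centralField x| := by gcongr
      _ < 1 := by linarith
  · rw [hs.white x hw]
    by_cases h : (x.2 : ℝ) < 1
    · obtain ⟨p, hp⟩ := exists_isOver h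
      have h2 : algSlope x = cos p.2 := by
        rw [algSlope, ← hp.2.2,
          cos_eq_sqrt_one_sub_sin_sq (by linarith [hp.1.1, pi_pos]) hp.1.2.le]
      rw [h2, mul_comm]
      exact abs_centralField_mul_cos_lt hp
    · simp [algSlope, eq_one_of_not_lt h]

/-- A local branch of the angle on the circle. -/
lemma exists_local_angle (φ₀ : ℝ) : ∃ g : Circle → ℝ, ContinuousAt g (Circle.exp φ₀) ∧
    g (Circle.exp φ₀) = φ₀ ∧ ∀ z, Circle.exp (g z) = z := by
  refine ⟨fun z => φ₀ + Complex.arg ((z / Circle.exp φ₀ : Circle) : ℂ), ?_, by simp, fun z => ?_⟩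
  · refine continuousAt_const.add (ContinuousAt.comp (g := Complex.arg) ?_ ?_)
    · exact Complex.continuousAt_arg (by simp)
    · exact Continuous.continuousAt (by fun_prop)
  · rw [Circle.exp_add, Circle.exp_arg, mul_div_cancel]

lemma continuousAt_centralField {x : Cyl} (h : (x.2 : ℝ) < 1) : ContinuousAt centralField x := by
  obtain ⟨g, hg1, hg2, hg3⟩ := exists_local_angle (Complex.arg x.1)
  rw [Circle.exp_arg] at hg1 hg2
  have hev : ∀ᶠ y : Cyl in 𝓝 x, (y.2 : ℝ) < 1 :=
    (isOpen_lt (by fun_prop : Continuous fun y : Cyl => (y.2 : ℝ)) continuous_const).mem_nhds h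
  have hx : ContinuousAt (fun y : Cyl => (g y.1, arcsin (y.2 : ℝ))) x :=
    (ContinuousAt.comp (g := g) hg1 continuousAt_fst).prodMk
      (continuous_arcsin.continuousAt.comp (by fun_prop))
  have hs : (g x.1, arcsin (x.2 : ℝ)) ∈ strip := arcsin_mem x.2.2.1 h
  have h1 : ContinuousAt (fun y : Cyl => centralSlope (g y.1, arcsin (y.2 : ℝ))) x :=
    (continuousOn_centralSlope _ hs).tendsto.comp
      (tendsto_nhdsWithin_iff.2 ⟨hx, hev.mono fun y hy => arcsin_mem y.2.2.1 hy⟩)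
  have h2 : ContinuousAt (fun y : Cyl => cos (arcsin (y.2 : ℝ))) x :=
    Continuous.continuousAt (by fun_prop)
  refine (h1.div h2 (cos_pos_of_mem hs).ne').congr ?_
  filter_upwards [hev] with y hy
  exact ((isOver_arcsin hy (hg3 y.1)).centralField_eq).symm

lemma continuous_emb : Continuous emb := by
  unfold emb
  fun_prop

lemma differentiableAt_RG {x : Cyl} (hx : x ∉ Indet) : DifferentiableAt ℂ RG (emb x) := by
  have hφ := Circle.exp_arg x.1
  have hd := mul_den_eq (Complex.arg x.1) x.2
  have hd0 : (den (Complex.arg x.1) x.2 : ℂ) ≠ 0 := by exact_mod_cast (den_ne_zero_iff hφ).2 hx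
  rw [← Circle.coe_exp, hφ] at hd
  rw [← hd] at hd0
  have hM : ((emb x).1 ^ 2)⁻¹ + (emb x).2 ^ 2 ≠ 0 := right_ne_zero_of_mul hd0
  have h0 : (x.1 : ℂ) ≠ 0 := Circle.coe_ne_zero _
  have hz2 : (emb x).1 ^ 2 ≠ 0 := pow_ne_zero 2 h0
  have hK : (emb x).2 ^ 2 * ((emb x).1 ^ 2 + ((emb x).1 ^ 2)⁻¹) + (emb x).2 ^ 4 + 1 ≠ 0 := by
    convert hd0 using 1
    simp only [emb]
    field_simp
    ring
  unfold RG
  fun_prop (disch := assumption)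

/-- On the top of the cylinder the central line field is determined by the formula `l = - B / A`
for the kernel of the differential, and it is approached since the other terms of the invariance
equation vanish there. -/
lemma continuousAt_centralField_top {x : Cyl} (hx : x ∉ Indet) (hx' : x ∉ PreIndet)
    (h : x.2 = 1) : ContinuousAt centralField x := by
  obtain ⟨g, hg1, hg2, hg3⟩ := exists_local_angle (Complex.arg x.1)
  have hφ := Circle.exp_arg x.1
  rw [hφ] at hg1 hg2
  set φ := Complex.arg (x.1 : ℂ)
  have hc : cos φ ≠ 0 := fun h' => hx ((mem_Indet_iff hφ).2 ⟨h', h⟩)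
  have hy : (x.1 ^ 2, 1) ∉ Indet := fun h' => hx' ⟨hx, _, h', RG_top hx h⟩
  have hre : ((x.1 ^ 2 : Circle) : ℂ).re ≠ 0 := by
    rw [coe_re_eq_cos (Circle.exp_arg (x.1 ^ 2))]
    exact fun h' => hy ((mem_Indet_iff (Circle.exp_arg _)).2 ⟨h', rfl⟩)
  have hxre : (x.1 : ℂ).re ≠ 0 := by rwa [coe_re_eq_cos hφ]
  have hd0 : den φ 1 ≠ 0 := by simpa [den] using hc
  have hG : ContinuousAt (fun y : Cyl => (g y.1, (y.2 : ℝ))) x :=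
    (ContinuousAt.comp (g := g) hg1 continuousAt_fst).prodMk
      (Continuous.continuousAt (by fun_prop))
  have hGx : (g x.1, (x.2 : ℝ)) = (φ, 1) := by rw [hg2, h, Icc.coe_one]
  have lift : ∀ {f : ℝ × ℝ → ℝ}, ContinuousAt f (φ, 1) →
      Tendsto (fun y : Cyl => f (g y.1, y.2)) (𝓝 x) (𝓝 (f (φ, 1))) := fun {f} hf => by
    have hG' := hG.tendsto
    rw [hGx] at hG'
    exact hf.tendsto.comp hG'
  have hden : ContinuousAt (fun p : ℝ × ℝ => den p.1 p.2) (φ, 1) :=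
    Continuous.continuousAt (by fun_prop)
  have tA := lift (f := fun p => dA p.1 p.2) (ContinuousAt.div (by fun_prop) hden hd0)
  have tB := lift (f := fun p => dB p.1 p.2) (ContinuousAt.div (by fun_prop) hden hd0)
  have tC := lift (f := fun p => dC p.1 p.2)
    (ContinuousAt.div (by fun_prop) (hden.pow 2) (pow_ne_zero 2 hd0))
  have tD := lift (f := fun p => dD p.1 p.2)
    (ContinuousAt.div (by fun_prop) (hden.pow 2) (pow_ne_zero 2 hd0))
  obtain ⟨hA, hB, hC, hD⟩ := partials_top hc
  simp only [hA, hB, hC, hD] at tA tB tC tD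
  have tR : Tendsto (fun y => RG (emb y)) (𝓝 x) (𝓝 (emb (x.1 ^ 2, 1))) := by
    rw [← RG_top hx h]
    exact (differentiableAt_RG hx).continuousAt.tendsto.comp continuous_emb.continuousAt.tendsto
  have t1 : Tendsto (fun y => |(RG (emb y)).1.re|) (𝓝 x) (𝓝 |((x.1 ^ 2 : Circle) : ℂ).re|) :=
    ((Complex.continuous_re.tendsto _).comp tR.fst_nhds).abs
  have t2 : Tendsto (fun y => (RG (emb y)).2.re) (𝓝 x) (𝓝 1) := by
    have := (Complex.continuous_re.tendsto _).comp tR.snd_nhds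
    simpa [emb, Function.comp_def] using this
  have t3 : Tendsto (fun y : Cyl => |(y.1 : ℂ).re|) (𝓝 x) (𝓝 |(x.1 : ℂ).re|) :=
    (Continuous.tendsto (by fun_prop) x)
  have t4 : Tendsto (fun y : Cyl => (y.2 : ℝ)) (𝓝 x) (𝓝 1) := by
    have : Continuous fun y : Cyl => (y.2 : ℝ) := by fun_prop
    simpa [h] using this.tendsto x
  have q1 : (1 : ℝ) ^ 2 * |((x.1 ^ 2 : Circle) : ℂ).re| ≠ 0 := by simpa using hre
  have q2 : (1 : ℝ) ^ 2 * |(x.1 : ℂ).re| ≠ 0 := by simpa using hxre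
  have p1 := ((t2.pow 2).mul t1).eventually_ne q1
  have p2 := ((t4.pow 2).mul t3).eventually_ne q2
  have p3 := tA.eventually_const_lt (show (1 : ℝ) < 2 by norm_num)
  have tM := (tendsto_const_nhds (x := (2 : ℝ))).div ((t2.pow 2).mul t1) q1
  have tN := (tendsto_const_nhds (x := (2 : ℝ))).div ((t4.pow 2).mul t3) q2
  have tE := tM.mul ((tC.abs.mul tN).add tD.abs)
  rw [abs_zero, zero_mul, add_zero, mul_zero] at tE
  have tBA := tB.neg.div tA two_ne_zero
  rw [neg_neg, mul_div_cancel_left₀ _ two_ne_zero, ← centralField_top h hφ] at tBA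
  have tdiff : Tendsto (fun y : Cyl => centralField y - -dB (g y.1) y.2 / dA (g y.1) y.2) (𝓝 x)
      (𝓝 0) := by
    refine squeeze_zero_norm' ?_ tE
    filter_upwards [p1, p2, p3] with y hp1 hp2 hp3
    have hyI : y ∉ Indet := fun hy => hp2 (by
      have := ((mem_Indet_iff (hg3 y.1)).1 hy).1
      rw [coe_re_eq_cos (hg3 y.1), this, abs_zero, mul_zero])
    have b1 : |centralField y| ≤ 2 / ((y.2 : ℝ) ^ 2 * |(y.1 : ℂ).re|) := by
      rw [le_div_iff₀ (lt_of_le_of_ne (by positivity) hp2.symm), mul_comm]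
      exact centralField_bound hyI
    have b2 : |dA (g y.1) y.2 * centralField y + dB (g y.1) y.2| ≤
        2 / ((RG (emb y)).2.re ^ 2 * |(RG (emb y)).1.re|) * (|dC (g y.1) y.2| *
          (2 / ((y.2 : ℝ) ^ 2 * |(y.1 : ℂ).re|)) + |dD (g y.1) y.2|) := by
      by_cases hlt : (y.2 : ℝ) < 1
      · have hp := isOver_arcsin hlt (hg3 y.1)
        obtain ⟨y', hy'⟩ := exists_RG_eq hyI
        rw [centralField_slope_eq hp hy', abs_mul, hy']
        have b3 := centralField_bound (not_mem_Indet (hp.liftMap hy').lt_one)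
        rw [hy'] at hp1
        have b4 : |centralField y'| ≤ 2 / ((emb y').2.re ^ 2 * |(emb y').1.re|) := by
          rw [le_div_iff₀ (lt_of_le_of_ne (by positivity) hp1.symm), mul_comm]
          exact b3
        gcongr
        refine (abs_add_le _ _).trans ?_
        rw [abs_mul]
        gcongr
      · have hy1 := eq_one_of_not_lt hlt
        have hcy : cos (g y.1) ≠ 0 := fun h' => hyI ((mem_Indet_iff (hg3 y.1)).2 ⟨h', hy1⟩)
        obtain ⟨hA, hB, -, -⟩ := partials_top hcy
        have : dA (g y.1) y.2 * centralField y + dB (g y.1) y.2 = 0 := by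
          rw [centralField_top hy1 (hg3 y.1), hy1, Icc.coe_one, hA, hB]
          ring
        rw [this, abs_zero]
        positivity
    have b5 : centralField y - -dB (g y.1) y.2 / dA (g y.1) y.2 =
        (dA (g y.1) y.2 * centralField y + dB (g y.1) y.2) / dA (g y.1) y.2 := by
      have : dA (g y.1) y.2 ≠ 0 := by linarith
      field_simp
      ring
    rw [b5, Real.norm_eq_abs, abs_div, abs_of_pos (by linarith : 0 < dA (g y.1) y.2)]
    exact (div_le_self (abs_nonneg _) hp3.le).trans b2
  have := tdiff.add tBA
  rw [ContinuousAt]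
  simpa using this

lemma isCentralLineField_centralField {εb : ℝ} {s : Cyl → ℝ} (h0 : 0 < εb) (h1 : εb < 1 / 10)
    (hs : IsModifiedSlope (1 / 10) εb s) : IsCentralLineField s centralField where
  vertical x hx := (centralField_vertical h0 h1 hs hx).le
  invariant x y hx _ hxy := centralField_invariant hx hxy
  continuousOn x hx := by
    by_cases h : (x.2 : ℝ) < 1
    · exact (continuousAt_centralField h).continuousWithinAt
    · exact (continuousAt_centralField_top (fun h' => hx (Or.inl h')) (fun h' => hx (Or.inr h'))
        (eq_one_of_not_lt h)).continuousWithinAt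

/-! ### Lifts of proper curves -/

/-- A continuous choice of the angle along a proper curve, as a function of `ψ`. -/
def IsLift (γ : Curve) (k : ℝ → ℝ) : Prop :=
  Continuous k ∧ ∀ ψ, Circle.exp (k ψ) = γ (projIcc 0 1 zero_le_one (sin ψ))

lemma IsLift.add {γ : Curve} {k : ℝ → ℝ} (h : IsLift γ k) (m : ℤ) :
    IsLift γ fun ψ => k ψ + m * (2 * π) :=
  ⟨h.1.add continuous_const, fun ψ => by
    rw [← h.2 ψ]; exact Circle.exp_eq_exp.2 ⟨m, rfl⟩⟩

lemma exists_isLift (γ : Curve) : ∃ k, IsLift γ k := by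
  obtain ⟨φ₀, hφ⟩ := Circle.exp_surjective (γ 0)
  obtain ⟨Γ, hΓ, -⟩ := Circle.isCoveringMap_exp.exists_path_lifts γ φ₀ hφ.symm
  exact ⟨fun ψ => Γ (projIcc 0 1 zero_le_one (sin ψ)),
    Γ.continuous.comp (by fun_prop), fun ψ => congrFun hΓ _⟩

lemma exists_isLift_eq (γ : Curve) {φ ψ : ℝ}
    (h : Circle.exp φ = γ (projIcc 0 1 zero_le_one (sin ψ))) : ∃ k, IsLift γ k ∧ k ψ = φ := by
  obtain ⟨k, hk⟩ := exists_isLift γ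
  obtain ⟨m, hm⟩ := Circle.exp_eq_exp.1 (h.trans (hk.2 ψ).symm)
  exact ⟨_, hk.add m, hm.symm⟩

/-- Two lifts of the same path which agree at a point coincide. -/
lemma eqOn_of_exp_eq {k k' : ℝ → ℝ} {S : Set ℝ} (hS : IsPreconnected S) (hk : ContinuousOn k S)
    (hk' : ContinuousOn k' S) (h : ∀ a ∈ S, Circle.exp (k a) = Circle.exp (k' a)) {a : ℝ}
    (ha : a ∈ S) (hka : k a = k' a) : EqOn k k' S :=
  Circle.isCoveringMap_exp.eqOn_of_comp_eqOn hS hk hk' h ha hka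

lemma IsLift.isOver {γ : Curve} {k : ℝ → ℝ} (h : IsLift γ k) {ψ : ℝ} (hψ : ψ ∈ Ico 0 (π / 2)) :
    IsOver (k ψ, ψ) (pt γ (projIcc 0 1 zero_le_one (sin ψ))) :=
  ⟨hψ, h.2 ψ, (coe_projIcc_sin hψ).symm⟩

lemma projIcc_sin_arcsin (t : unitInterval) : projIcc 0 1 zero_le_one (sin (arcsin t)) = t := by
  rw [sin_arcsin (by linarith [t.2.1]) t.2.2, projIcc_val]

lemma IsLift.isOver_arcsin {γ : Curve} {k : ℝ → ℝ} (h : IsLift γ k) {t : unitInterval}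
    (ht : t < 1) : IsOver (k (arcsin t), arcsin t) (pt γ t) := by
  have := h.isOver (arcsin_mem t.2.1 ht)
  rwa [projIcc_sin_arcsin] at this

lemma toFun_eq {γ : Curve} {k : ℝ → ℝ} (h : IsLift γ k) (ψ : ℝ) :
    toFun γ (sin ψ) = Complex.exp (k ψ * Complex.I) := by
  rw [toFun, ← h.2, Circle.coe_exp]

lemma toFun_coe (γ : Curve) (t : unitInterval) : toFun γ t = γ t := by
  rw [toFun, projIcc_val]

/-- Every causal curve is the lift of a proper curve: being Lipschitz it extends to the top. -/
lemma IsCausal.exists_curve {k : ℝ → ℝ} (hk : IsCausal k) :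
    ∃ (γ : Curve) (k' : ℝ → ℝ), IsLift γ k' ∧ EqOn k' k (Ico 0 (π / 2)) := by
  have hL : LipschitzOnWith 1 k (Ico 0 (π / 2)) :=
    LipschitzOnWith.of_dist_le_mul fun a ha b hb => by
      simpa [Real.dist_eq] using hk a ha b hb
  obtain ⟨g, hg, hgk⟩ := hL.extend_real
  have hgc := hg.continuous
  refine ⟨⟨fun t => Circle.exp (g (arcsin t)), by fun_prop⟩,
    fun ψ => g (arcsin (projIcc 0 1 zero_le_one (sin ψ))), ⟨?_, fun ψ => rfl⟩, fun ψ hψ => ?_⟩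
  · exact hgc.comp (continuous_arcsin.comp (by fun_prop))
  · simp only
    rw [coe_projIcc_sin hψ, arcsin_sin (by linarith [hψ.1, pi_pos]) hψ.2.le]
    exact (hgk hψ).symm

lemma dense_Iio_one : Dense (Iio (1 : unitInterval)) := by
  rw [dense_iff_closure_eq, closure_Iio' ⟨0, zero_lt_one⟩]
  exact eq_univ_of_forall fun t => t.2.2

lemma dist_le_of_forall_lt {γ γ' : Curve} {C : ℝ} (hC : 0 ≤ C)
    (h : ∀ t : unitInterval, t < 1 → dist (γ t) (γ' t) ≤ C) : dist γ γ' ≤ C := by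
  rw [ContinuousMap.dist_le hC]
  have hcl : IsClosed {t : unitInterval | dist (γ t) (γ' t) ≤ C} :=
    isClosed_le (by fun_prop) continuous_const
  intro t
  have : closure (Iio (1 : unitInterval)) ⊆ {t : unitInterval | dist (γ t) (γ' t) ≤ C} :=
    hcl.closure_subset_iff.2 h
  rw [dense_Iio_one.closure_eq] at this
  exact this (mem_univ t)

lemma dist_exp_le (a b : ℝ) : dist (Circle.exp a) (Circle.exp b) ≤ |a - b| := by
  have h1 : Circle.exp a = Circle.exp b * Circle.exp (a - b) := by
    rw [← Circle.exp_add]; congr 1; ring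
  change dist (Circle.exp a : ℂ) (Circle.exp b) ≤ _
  rw [dist_eq_norm, h1, Circle.coe_mul]
  have h2 : (Circle.exp b : ℂ) * Circle.exp (a - b) - Circle.exp b =
      Circle.exp b * (Circle.exp (a - b) - 1) := by ring
  rw [h2, norm_mul, Circle.norm_coe, one_mul, Circle.coe_exp, mul_comm, ← Real.norm_eq_abs]
  exact norm_exp_I_mul_ofReal_sub_one_le

/-! ### Integral curves of the central line field -/

/-- The angular derivative of a curve gives the derivative of its lift. -/
lemma IsLift.hasDerivWithinAt {γ : Curve} {k : ℝ → ℝ} (h : IsLift γ k) {ψ v : ℝ} {S J : Set ℝ}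
    {t : unitInterval} (ht : (t : ℝ) = sin ψ) (hJ : MapsTo sin J S)
    (hγ : HasAngDerivWithin γ v S t) : HasDerivWithinAt k (v * cos ψ) J ψ := by
  rw [HasAngDerivWithin, ht] at hγ
  have h1 := hγ.scomp ψ (hasDerivAt_sin ψ).hasDerivWithinAt hJ
  have h0 : (γ t : ℂ) ≠ 0 := Circle.coe_ne_zero _
  have hG : ∀ a, (toFun γ ∘ sin) a = Complex.exp (k a * Complex.I) := toFun_eq h
  have hGt : (toFun γ ∘ sin) ψ = γ t := by rw [Function.comp_apply, ← ht, toFun_coe]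
  have h2 := (h1.div_const (γ t : ℂ)).clog_real (by rw [hGt, div_self h0]; simp)
  have h3 := (Complex.imCLM.hasFDerivAt.comp_hasDerivWithinAt ψ h2).const_add (k ψ)
  have h4 : Complex.imCLM (cos ψ • ((v : ℂ) * (Complex.I * (γ t : ℂ))) / (γ t : ℂ) /
      ((toFun γ ∘ sin) ψ / (γ t : ℂ))) = v * cos ψ := by
    rw [hGt, div_self h0, div_one, Complex.real_smul]
    have : (cos ψ : ℂ) * ((v : ℂ) * (Complex.I * (γ t : ℂ))) / (γ t : ℂ) =
        ((v * cos ψ : ℝ) : ℂ) * Complex.I := by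
      push_cast
      field_simp
    rw [this]
    simp [-Complex.ofReal_mul]
  rw [h4] at h3
  have hev : ∀ᶠ a in 𝓝 ψ, |k a - k ψ| < π := by
    have : Tendsto (fun a => |k a - k ψ|) (𝓝 ψ) (𝓝 |k ψ - k ψ|) :=
      ((h.1.tendsto ψ).sub_const _).abs
    rw [sub_self, abs_zero] at this
    exact this.eventually_lt_const pi_pos
  have hk : ∀ a, |k a - k ψ| < π →
      k a = k ψ + Complex.imCLM (Complex.log ((toFun γ ∘ sin) a / (γ t : ℂ))) := by
    intro a ha
    rw [abs_lt] at ha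
    rw [← hGt, hG, hG, ← Complex.exp_sub, ← sub_mul, ← Complex.ofReal_sub, Complex.log_exp]
    · simp [-Complex.ofReal_sub]
    · simpa [-Complex.ofReal_sub] using ha.1
    · simpa [-Complex.ofReal_sub] using ha.2.le
  exact h3.congr_of_eventuallyEq (eventually_nhdsWithin_of_eventually_nhds (hev.mono hk))
    (hk ψ (by simpa using pi_pos))

/-- The derivative of a lift gives the angular derivative of the curve. -/
lemma IsLift.hasAngDerivWithin {γ : Curve} {k : ℝ → ℝ} (h : IsLift γ k) {q : ℝ}
    {t : unitInterval} (ht : t < 1) (hk : HasDerivWithinAt k q (Ico 0 (π / 2)) (arcsin t)) :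
    HasAngDerivWithin γ (q / cos (arcsin t)) (Icc 0 1) t := by
  have ht' : (t : ℝ) < 1 := ht
  have h0 : (0 : ℝ) ≤ t := t.2.1
  have h1 : HasDerivWithinAt arcsin (1 / √(1 - (t : ℝ) ^ 2)) (Ico 0 1) t :=
    (hasDerivAt_arcsin (by linarith) ht'.ne).hasDerivWithinAt
  have h2 := hk.comp (t : ℝ) h1 fun r hr => arcsin_mem hr.1 hr.2
  have h3 := (h2.ofReal_comp.mul_const Complex.I).cexp
  have hG : ∀ r ∈ Ico (0 : ℝ) 1, toFun γ r = Complex.exp (((k ∘ arcsin) r : ℝ) * Complex.I) := by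
    intro r hr
    have := toFun_eq h (arcsin r)
    rwa [sin_arcsin (by linarith [hr.1]) hr.2.le] at this
  have h4 := h3.congr hG (hG t ⟨h0, ht'⟩)
  have h5 : HasDerivWithinAt (toFun γ) _ (Icc 0 1) t :=
    h4.mono_of_mem_nhdsWithin (by
      filter_upwards [self_mem_nhdsWithin, mem_nhdsWithin_of_mem_nhds (Iio_mem_nhds ht')]
        with r hr hr'
      exact ⟨hr.1, hr'⟩)
  refine h5.congr_deriv ?_
  rw [← hG t ⟨h0, ht'⟩, toFun_coe, cos_arcsin]
  push_cast
  ring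

/-- The set of the values of `ψ` which correspond to `t ∈ [a, b]`, `t < 1`. -/
def arcRange (a b : ℝ) : Set ℝ := Icc (arcsin a) (arcsin b) ∩ Ico 0 (π / 2)

/-- Integral curves of the central line field are central curves. -/
lemma IsIntegralOn.isCentralOn {γ : Curve} {k : ℝ → ℝ} {a b : unitInterval}
    (hγ : IsIntegralOn centralField γ a b) (h : IsLift γ k) : IsCentralOn k (arcRange a b) := by
  have hmap : MapsTo sin (arcRange a b) (Icc a b) := fun ψ hψ => by
    have h1 : ψ ∈ Icc (-(π / 2)) (π / 2) := ⟨by linarith [hψ.2.1, pi_pos], hψ.2.2.le⟩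
    have ha : (a : ℝ) ∈ Icc (-1 : ℝ) 1 := ⟨by linarith [a.2.1], a.2.2⟩
    have hb : (b : ℝ) ∈ Icc (-1 : ℝ) 1 := ⟨by linarith [b.2.1], b.2.2⟩
    exact ⟨(arcsin_le_iff_le_sin ha h1).1 hψ.1.1, (le_arcsin_iff_sin_le h1 hb).1 hψ.1.2⟩
  refine isCentralOn_of_hasDerivWithinAt inter_subset_right
    ((convex_Icc _ _).inter (convex_Ico _ _)) fun ψ hψ => ?_
  have ho := h.isOver hψ.2
  have ht := coe_projIcc_sin hψ.2
  have h1 := hγ (projIcc 0 1 zero_le_one (sin ψ)) (by rw [ht]; exact hmap hψ)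
    (not_mem_exceptional ho.lt_one)
  have h2 := h.hasDerivWithinAt ht hmap h1
  rw [ho.centralField_eq, div_mul_cancel₀ _ (cos_pos_of_mem hψ.2).ne'] at h2
  exact h2

lemma arcRange_zero_one : arcRange 0 1 = Ico 0 (π / 2) := by
  rw [arcRange, arcsin_zero, arcsin_one, inter_eq_right]
  exact Ico_subset_Icc_self

lemma isCentralOn_of_mem_integralCurves {γ : Curve} {k : ℝ → ℝ}
    (hγ : γ ∈ integralCurves centralField) (h : IsLift γ k) : IsCentralOn k (Ico 0 (π / 2)) := by
  have := IsIntegralOn.isCentralOn (a := 0) (b := 1) (by rw [Icc.coe_zero, Icc.coe_one]; exact hγ) h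
  rwa [Icc.coe_zero, Icc.coe_one, arcRange_zero_one] at this

lemma hasAngDerivWithin_of_isCentralOn {γ : Curve} {k : ℝ → ℝ} (h : IsLift γ k)
    (hk : IsCentralOn k (Ico 0 (π / 2))) {t : unitInterval} (ht : t < 1) :
    HasAngDerivWithin γ (centralField (pt γ t)) (Icc 0 1) t := by
  rw [(h.isOver_arcsin ht).centralField_eq]
  exact h.hasAngDerivWithin ht (hk.hasDerivWithinAt subset_rfl (arcsin_mem t.2.1 ht))

lemma continuous_pt (γ : Curve) : Continuous (pt γ) := by
  unfold pt
  fun_prop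

/-- Central curves are integral curves of the central line field, at their top points by continuity
of the line field. -/
lemma mem_integralCurves {γ : Curve} {k : ℝ → ℝ} (h : IsLift γ k)
    (hk : IsCentralOn k (Ico 0 (π / 2))) : γ ∈ integralCurves centralField := by
  intro t _ hpt
  by_cases ht : t < 1
  · exact hasAngDerivWithin_of_isCentralOn h hk ht
  have h1 : t = 1 := eq_one_of_not_lt ht
  subst h1
  have hder : ∀ r ∈ Ioo (0 : ℝ) 1, HasDerivAt (toFun γ)
      ((centralField (pt γ (projIcc 0 1 zero_le_one r)) : ℂ) * (Complex.I * toFun γ r)) r := by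
    intro r hr
    have hr' : ((projIcc 0 1 zero_le_one r : unitInterval) : ℝ) = r := by
      rw [projIcc_of_mem _ ⟨hr.1.le, hr.2.le⟩]
    have h2 := hasAngDerivWithin_of_isCentralOn h hk (t := projIcc 0 1 zero_le_one r)
      (show ((projIcc 0 1 zero_le_one r : unitInterval) : ℝ) < 1 by rw [hr']; exact hr.2)
    rw [HasAngDerivWithin, hr'] at h2
    exact h2.hasDerivAt (Icc_mem_nhds hr.1 hr.2)
  have hcont : Continuous (toFun γ) := by
    unfold toFun
    fun_prop
  have hlim : Tendsto (fun r => (centralField (pt γ (projIcc 0 1 zero_le_one r)) : ℂ) *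
      (Complex.I * toFun γ r)) (𝓝[<] (1 : ℝ))
      (𝓝 ((centralField (pt γ 1) : ℂ) * (Complex.I * (γ 1 : ℂ)))) := by
    have h3 : ContinuousAt centralField (pt γ (projIcc 0 1 zero_le_one (1 : ℝ))) := by
      rw [projIcc_right]
      exact continuousAt_centralField_top (fun h' => hpt (Or.inl h')) (fun h' => hpt (Or.inr h'))
        rfl
    have h4 : ContinuousAt (fun r : ℝ => pt γ (projIcc 0 1 zero_le_one r)) 1 :=
      ((continuous_pt γ).comp continuous_projIcc).continuousAt
    have h5 : ContinuousAt (fun r : ℝ => centralField (pt γ (projIcc 0 1 zero_le_one r))) 1 :=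
      ContinuousAt.comp (g := centralField) h3 h4
    have h6 : ContinuousAt (fun r : ℝ => (centralField (pt γ (projIcc 0 1 zero_le_one r)) : ℂ) *
        (Complex.I * toFun γ r)) 1 :=
      (ContinuousAt.comp (g := Complex.ofReal) Complex.continuous_ofReal.continuousAt h5).mul
        (continuousAt_const.mul hcont.continuousAt)
    have h7 := h6.tendsto.mono_left (nhdsWithin_le_nhds (s := Iio 1))
    simpa [projIcc_right, toFun] using h7
  have h8 := hasDerivWithinAt_Iic_of_tendsto_deriv (f := toFun γ) (s := Ioo 0 1) (a := (1 : ℝ))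
    (fun r hr => (hder r hr).differentiableAt.differentiableWithinAt)
    hcont.continuousWithinAt (Ioo_mem_nhdsLT zero_lt_one)
    (hlim.congr' (by
      filter_upwards [Ioo_mem_nhdsLT (zero_lt_one (α := ℝ))] with r hr
      exact (hder r hr).deriv.symm))
  exact h8.mono Icc_subset_Iic_self

lemma exists_isLift_pair {γ₁ γ₂ : Curve} {t : unitInterval} (h : γ₁ t = γ₂ t) :
    ∃ k₁ k₂, IsLift γ₁ k₁ ∧ IsLift γ₂ k₂ ∧ k₁ (arcsin t) = k₂ (arcsin t) := by
  obtain ⟨k₁, h₁⟩ := exists_isLift γ₁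
  obtain ⟨k₂, h₂, h₃⟩ := exists_isLift_eq γ₂ (φ := k₁ (arcsin t)) (ψ := arcsin t) (by
    rw [h₁.2, projIcc_sin_arcsin, h])
  exact ⟨k₁, k₂, h₁, h₂, h₃.symm⟩

lemma eq_of_lifts {γ₁ γ₂ : Curve} {k₁ k₂ : ℝ → ℝ} (h₁ : IsLift γ₁ k₁) (h₂ : IsLift γ₂ k₂)
    {t : unitInterval} (h : k₁ (arcsin t) = k₂ (arcsin t)) : γ₁ t = γ₂ t := by
  rw [← projIcc_sin_arcsin t, ← h₁.2, ← h₂.2, h]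

lemma uniquelyIntegrable_centralField : UniquelyIntegrable centralField := by
  intro γ₁ γ₂ a b h₁ h₂ t ht ht1 h
  obtain ⟨k₁, k₂, hk₁, hk₂, hk⟩ := exists_isLift_pair h
  have hmem : ∀ u ∈ Icc a b, u < 1 → arcsin (u : ℝ) ∈ arcRange a b := fun u hu hu1 =>
    ⟨⟨arcsin_le_arcsin hu.1, arcsin_le_arcsin hu.2⟩, arcsin_mem u.2.1 hu1⟩
  have heq := (h₁.isCentralOn hk₁).eqOn inter_subset_right (h₂.isCentralOn hk₂) (hmem t ht ht1) hk
  have hlt : ∀ u ∈ Icc a b, u < 1 → γ₁ u = γ₂ u := fun u hu hu1 =>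
    eq_of_lifts hk₁ hk₂ (heq (hmem u hu hu1))
  intro u hu
  by_cases hu1 : u < 1
  · exact hlt u hu hu1
  have h1 : u = 1 := eq_one_of_not_lt hu1
  subst h1
  have hcl : IsClosed {u : unitInterval | γ₁ u = γ₂ u} := isClosed_eq (by fun_prop) (by fun_prop)
  have hsub : closure (Ico t 1) ⊆ {u : unitInterval | γ₁ u = γ₂ u} :=
    hcl.closure_subset_iff.2 fun u hu' => hlt u ⟨ht.1.trans hu'.1, hu'.2.le.trans hu.2⟩ hu'.2
  rw [closure_Ico ht1.ne] at hsub
  exact hsub (right_mem_Icc.2 ht1.le)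

/-! ### Pullbacks of proper curves -/

lemma zero_mem_Ico : (0 : ℝ) ∈ Ico 0 (π / 2) := left_mem_Ico.2 (by positivity)

lemma arcsin_mem_Ico {t : unitInterval} (ht : t < 1) : arcsin (t : ℝ) ∈ Ico 0 (π / 2) :=
  arcsin_mem t.2.1 ht

lemma isOver_of_coverEmb_eq {p : ℝ × ℝ} {x : Cyl} (hp : p ∈ strip) (h : coverEmb p = emb x) :
    IsOver p x := by
  refine ⟨hp, ?_, ?_⟩
  · ext
    rw [Circle.coe_exp]
    exact congrArg Prod.fst h
  · exact Complex.ofReal_injective (congrArg Prod.snd h)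

/-- The `n`-th image of the point at height `ψ` on the curve `k`. -/
noncomputable def nthImage (n : ℕ) (k : ℝ → ℝ) (ψ : ℝ) : ℝ × ℝ := liftMap^[n] (k ψ, ψ)

lemma nthImage_mem (n : ℕ) (k : ℝ → ℝ) {ψ : ℝ} (hψ : ψ ∈ Ico 0 (π / 2)) : nthImage n k ψ ∈ strip :=
  iterate_mem (x := (k ψ, ψ)) hψ n

lemma continuousOn_nthImage (n : ℕ) {k : ℝ → ℝ} (hk : ContinuousOn k (Ico 0 (π / 2))) :
    ContinuousOn (nthImage n k) (Ico 0 (π / 2)) := fun ψ hψ =>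
  ContinuousAt.comp_continuousWithinAt (g := liftMap^[n]) (f := fun ψ => (k ψ, ψ))
    (continuousAt_iterate (x := (k ψ, ψ)) hψ n) ((hk ψ hψ).prodMk continuousWithinAt_id)

/-- If the `n`-th image of a proper curve lies in another one, this is so for suitable lifts. -/
lemma exists_isLift_image {n : ℕ} {δ γ : Curve} {k : ℝ → ℝ} (hk : IsLift δ k)
    (h : ∀ t : unitInterval, t < 1 → ∃ u : unitInterval, RG^[n] (emb (pt δ t)) = emb (pt γ u)) :
    ∃ k', IsLift γ k' ∧ ∀ ψ ∈ Ico 0 (π / 2), (nthImage n k ψ).1 = k' (nthImage n k ψ).2 := by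
  have hexp : ∀ ψ ∈ Ico 0 (π / 2), Circle.exp (nthImage n k ψ).1 =
      γ (projIcc 0 1 zero_le_one (sin (nthImage n k ψ).2)) := by
    intro ψ hψ
    have ho := hk.isOver hψ
    obtain ⟨u, hu⟩ := h _ ho.lt_one
    have h1 := isOver_of_coverEmb_eq (nthImage_mem n k hψ) ((ho.iterate n).symm.trans hu)
    have h2 : projIcc 0 1 zero_le_one (sin (nthImage n k ψ).2) = u :=
      Subtype.ext ((coe_projIcc_sin (nthImage_mem n k hψ)).trans h1.2.2)
    rw [h2]
    exact h1.2.1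
  obtain ⟨k', hk', h0⟩ := exists_isLift_eq γ (hexp 0 zero_mem_Ico)
  have hc := continuousOn_nthImage n hk.1.continuousOn
  exact ⟨k', hk', eqOn_of_exp_eq isPreconnected_Ico hc.fst (hk'.1.comp_continuousOn hc.snd)
    (fun ψ hψ => by rw [hexp ψ hψ]; exact (hk'.2 _).symm) zero_mem_Ico h0.symm⟩

lemma exists_RG_iterate_eq {n : ℕ} {δ γ : Curve} {k k' : ℝ → ℝ} (hk : IsLift δ k)
    (hk' : IsLift γ k') (h : ∀ ψ ∈ Ico 0 (π / 2), (nthImage n k ψ).1 = k' (nthImage n k ψ).2)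
    {t : unitInterval} (ht : t < 1) : ∃ u : unitInterval, RG^[n] (emb (pt δ t)) = emb (pt γ u) := by
  have hψ := arcsin_mem_Ico ht
  have h1 := hk'.isOver (nthImage_mem n k hψ)
  rw [← h _ hψ] at h1
  exact ⟨_, ((hk.isOver_arcsin ht).iterate n).trans h1.emb_eq.symm⟩

/-- Two curves whose `n`-th images have nearby angles are exponentially close. -/
lemma dist_le_of_image {n : ℕ} {γ γ' : Curve} {k k' : ℝ → ℝ} (hk : IsLift γ k) (hk' : IsLift γ' k')
    {d : ℝ} (h : ∀ ψ ∈ Ico 0 (π / 2), |(nthImage n k ψ).1 - (nthImage n k' ψ).1| ≤ d) :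
    dist γ γ' ≤ d * (4 / 5) ^ n := by
  have hd : 0 ≤ d := (abs_nonneg _).trans (h 0 zero_mem_Ico)
  refine dist_le_of_forall_lt (by positivity) fun t ht => ?_
  have hψ := arcsin_mem_Ico ht
  rw [← projIcc_sin_arcsin t, ← hk.2, ← hk'.2]
  exact (dist_exp_le _ _).trans (abs_sub_le_of_iterate hψ n (h _ hψ))

/-- The angle of the `n`-th image of a central curve varies by `π / 2` at most. -/
lemma IsCentralOn.abs_image_sub_le {k : ℝ → ℝ} (hk : IsCentralOn k (Ico 0 (π / 2))) (n : ℕ)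
    {a b : ℝ} (ha : a ∈ Ico 0 (π / 2)) (hb : b ∈ Ico 0 (π / 2)) :
    |(nthImage n k a).1 - (nthImage n k b).1| ≤ π / 2 :=
  abs_sub_le_of_causal (nthImage_mem n k ha) (nthImage_mem n k hb) (hk n a ha b hb)

lemma IsCausal.abs_image_sub_le {k q : ℝ → ℝ} (hq : IsCausal q) {n : ℕ}
    (h : ∀ ψ ∈ Ico 0 (π / 2), (nthImage n k ψ).1 = q (nthImage n k ψ).2)
    {a b : ℝ} (ha : a ∈ Ico 0 (π / 2)) (hb : b ∈ Ico 0 (π / 2)) :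
    |(nthImage n k a).1 - (nthImage n k b).1| ≤ π / 2 := by
  rw [h a ha, h b hb]
  exact hq.abs_sub_le (nthImage_mem n k ha) (nthImage_mem n k hb)

lemma IsCentralOn.congr {k k' : ℝ → ℝ} {I : Set ℝ} (hk : IsCentralOn k I) (h : EqOn k' k I) :
    IsCentralOn k' I := fun n a ha b hb => by
  rw [h ha, h hb]; exact hk n a ha b hb

/-- Through each point of the topless cylinder there passes a proper integral curve. -/
lemma exists_integralCurve {φ ψ : ℝ} (hψ : ψ ∈ Ico 0 (π / 2)) :
    ∃ γ ∈ integralCurves centralField, ∃ k, IsLift γ k ∧ IsCentralOn k (Ico 0 (π / 2)) ∧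
      k ψ = φ := by
  obtain ⟨q, hq, hqφ⟩ := exists_isCentralOn (x := (φ, ψ)) hψ
  obtain ⟨γ, k, hk, hkq⟩ := hq.isCausal.exists_curve
  have hc := hq.congr hkq
  exact ⟨γ, mem_integralCurves hk hc, k, hk, hc, (hkq hψ).trans hqφ⟩

/-- A proper curve is exponentially close to a leaf of the central foliation, if the angle of its
`n`-th image has bounded variation. -/
lemma exists_integralCurve_dist_le {n : ℕ} {δ : Curve} {k : ℝ → ℝ} (hk : IsLift δ k) {d : ℝ}
    (h : ∀ ψ ∈ Ico 0 (π / 2), |(nthImage n k ψ).1 - (nthImage n k 0).1| ≤ d) :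
    ∃ γ ∈ integralCurves centralField, dist δ γ ≤ (d + π / 2) * (4 / 5) ^ n := by
  obtain ⟨γ, hγ, q, hq, hqc, hq0⟩ := exists_integralCurve (φ := k 0) zero_mem_Ico
  refine ⟨γ, hγ, dist_le_of_image hk hq fun ψ hψ => ?_⟩
  have h1 := abs_le.1 (h ψ hψ)
  have h2 := abs_le.1 (hqc.abs_image_sub_le n hψ zero_mem_Ico)
  have h3 : (nthImage n q 0).1 = (nthImage n k 0).1 := by rw [nthImage, nthImage, hq0]
  rw [h3] at h2
  exact abs_le.2 ⟨by linarith, by linarith⟩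

/-- A leaf of the central foliation is exponentially close to a pullback of each causal curve (of
a suitable lift). -/
lemma exists_pull_dist_le {n : ℕ} {γ : Curve} (hγ : γ ∈ integralCurves centralField) {q : ℝ → ℝ}
    (hq : IsCausal q) :
    ∃ (m : ℤ) (δ : Curve) (k : ℝ → ℝ), IsLift δ k ∧
      (∀ ψ ∈ Ico 0 (π / 2), (nthImage n k ψ).1 = q (nthImage n k ψ).2 + m * (2 * π)) ∧
      dist γ δ ≤ 2 * π * (4 / 5) ^ n := by
  obtain ⟨g, hg⟩ := exists_isLift γ
  have hgc := isCentralOn_of_mem_integralCurves hγ hg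
  -- the lift of `q` whose angle at the bottom is nearest to that of the `n`-th image of `γ`
  set m : ℤ := round (((nthImage n g 0).1 - q 0) / (2 * π)) with hm
  have hmd : |(nthImage n g 0).1 - (q 0 + m * (2 * π))| ≤ π := by
    have h1 := abs_sub_round (((nthImage n g 0).1 - q 0) / (2 * π))
    rw [← hm] at h1
    have h2 : (nthImage n g 0).1 - (q 0 + m * (2 * π)) =
        (((nthImage n g 0).1 - q 0) / (2 * π) - m) * (2 * π) := by
      field_simp; ring
    rw [h2, abs_mul, abs_of_pos two_pi_pos]
    nlinarith [pi_pos]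
  set q' : ℝ → ℝ := fun ψ => q ψ + m * (2 * π) with hq'
  have hqc : IsCausal q' := fun a ha b hb => by
    simpa [hq'] using hq a ha b hb
  obtain ⟨δ, k, hk, hkp⟩ := (hqc.iterate_pull n).exists_curve
  have him : ∀ ψ ∈ Ico 0 (π / 2), (nthImage n k ψ).1 = q' (nthImage n k ψ).2 := fun ψ hψ => by
    have := iterate_pull_spec hqc hψ 0 n
    rw [zero_add] at this
    rw [nthImage, hkp hψ]
    exact this
  refine ⟨m, δ, k, hk, him, dist_le_of_image hg hk fun ψ hψ => ?_⟩
  have h1 := abs_le.1 (hgc.abs_image_sub_le n hψ zero_mem_Ico)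
  have h2 := abs_le.1 (hqc.abs_sub_le (nthImage_mem n k hψ) zero_mem_Ico)
  rw [him ψ hψ]
  have h3 := abs_le.1 hmd
  exact abs_le.2 ⟨by linarith, by linarith⟩

/-! ### The central foliation -/

lemma angVel_eq {γ : Curve} {t : unitInterval} {v : ℝ} (h : HasAngDerivWithin γ v (Icc 0 1) t) :
    angVel γ t = v := by
  have h0 : Complex.I * (γ t : ℂ) ≠ 0 := mul_ne_zero Complex.I_ne_zero (Circle.coe_ne_zero _)
  rw [angVel, HasDerivWithinAt.derivWithin h (uniqueDiffOn_Icc zero_lt_one _ t.2),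
    mul_div_cancel_right₀ _ h0, Complex.ofReal_re]

lemma hasAngDerivWithin_centralField {γ : Curve} (hγ : γ ∈ integralCurves centralField)
    {t : unitInterval} (ht : t < 1) :
    HasAngDerivWithin γ (centralField (pt γ t)) (Icc 0 1) t :=
  hγ t t.2 (not_mem_exceptional ht)

lemma angVel_centralField {γ : Curve} (hγ : γ ∈ integralCurves centralField)
    {t : unitInterval} (ht : t < 1) : angVel γ t = centralField (pt γ t) :=
  angVel_eq (hasAngDerivWithin_centralField hγ ht)

/-- Strictly vertical curves have causal lifts. -/
lemma IsStrictlyVertical.isCausal {s : Cyl → ℝ} (hs : ∀ x, algSlope x ≤ s x) {γ : Curve}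
    (hγ : IsStrictlyVertical s γ) {k : ℝ → ℝ} (hk : IsLift γ k) : IsCausal k := by
  have hmap : MapsTo sin (Ico 0 (π / 2)) (Icc 0 1) := fun ψ hψ =>
    ⟨(sin_mem hψ).1, (sin_mem hψ).2.le⟩
  intro a ha b hb
  have := Convex.norm_image_sub_le_of_norm_hasDerivWithin_le (f := k)
    (f' := fun ψ => angVel γ (projIcc 0 1 zero_le_one (sin ψ)) * cos ψ) (C := 1)
    (s := Ico 0 (π / 2)) (x := b) (y := a) (fun ψ hψ => ?_) (fun ψ hψ => ?_) (convex_Ico _ _) hb ha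
  · simpa [Real.norm_eq_abs] using this
  · exact hk.hasDerivWithinAt (coe_projIcc_sin hψ) hmap (hγ.hasDeriv _ (hk.isOver hψ).lt_one)
  · have h1 := hγ.vertical _ (hk.isOver hψ).lt_one
    have h2 := hs (pt γ (projIcc 0 1 zero_le_one (sin ψ)))
    have h3 : algSlope (pt γ (projIcc 0 1 zero_le_one (sin ψ))) = cos ψ := by
      have : (1 - sin ψ ^ 2) = cos ψ ^ 2 := by linarith [sin_sq_add_cos_sq ψ]
      rw [algSlope, pt, coe_projIcc_sin hψ, this, sqrt_sq (cos_pos_of_mem hψ).le]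
    rw [h3] at h2
    rw [Real.norm_eq_abs, abs_mul, abs_of_pos (cos_pos_of_mem hψ), mul_comm]
    exact (mul_le_mul_of_nonneg_right h2 (abs_nonneg _)).trans h1.le

/-- Leaves of the central foliation which are close at one height are close everywhere: up to a
large time their images stay close at that height, and therefore everywhere. -/
lemma exists_forall_dist_lt {γ₁ : Curve} (hγ₁ : γ₁ ∈ integralCurves centralField)
    {t₀ : unitInterval} (ht₀ : t₀ < 1) {η : ℝ} (hη : 0 < η) :
    ∃ δ > 0, ∀ γ₂ ∈ integralCurves centralField, dist (γ₂ t₀) (γ₁ t₀) < δ → dist γ₂ γ₁ < η := by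
  obtain ⟨n, hn⟩ : ∃ n : ℕ, (1 + π) * (4 / 5 : ℝ) ^ n < η := by
    have h1 : Tendsto (fun n : ℕ => (1 + π) * (4 / 5 : ℝ) ^ n) atTop (𝓝 ((1 + π) * 0)) :=
      (tendsto_pow_atTop_nhds_zero_of_lt_one (by norm_num) (by norm_num)).const_mul _
    rw [mul_zero] at h1
    exact (h1.eventually_lt_const hη).exists
  obtain ⟨k₁, hk₁⟩ := exists_isLift γ₁
  have hψ := arcsin_mem_Ico ht₀
  obtain ⟨g, hg1, hg2, hg3⟩ := exists_local_angle (k₁ (arcsin t₀))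
  have he : Circle.exp (k₁ (arcsin t₀)) = γ₁ t₀ := by rw [hk₁.2, projIcc_sin_arcsin]
  rw [he] at hg1 hg2
  have hc : ContinuousAt (fun z => (liftMap^[n] (g z, arcsin t₀)).1) (γ₁ t₀) :=
    continuousAt_fst.comp (ContinuousAt.comp (g := liftMap^[n])
      (continuousAt_iterate (x := (g (γ₁ t₀), arcsin t₀)) hψ n) (hg1.prodMk continuousAt_const))
  obtain ⟨δ, hδ, h⟩ := Metric.continuousAt_iff.1 hc 1 one_pos
  refine ⟨δ, hδ, fun γ₂ hγ₂ hd => ?_⟩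
  obtain ⟨k₂, hk₂, h₂⟩ := exists_isLift_eq γ₂ (φ := g (γ₂ t₀)) (ψ := arcsin t₀) (by
    rw [hg3, projIcc_sin_arcsin])
  have h1 := h hd
  rw [hg2, ← h₂, Real.dist_eq] at h1
  refine (dist_le_of_image hk₂ hk₁ fun ψ hψ' => ?_).trans_lt hn
  have h3 := abs_lt.1 h1
  have h4 := abs_le.1 ((isCentralOn_of_mem_integralCurves hγ₁ hk₁).abs_image_sub_le n hψ' hψ)
  have h5 := abs_le.1 ((isCentralOn_of_mem_integralCurves hγ₂ hk₂).abs_image_sub_le n hψ' hψ)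
  simp only [nthImage] at *
  exact abs_le.2 ⟨by linarith, by linarith⟩

lemma isVerticalLamination_centralField {εb : ℝ} {s : Cyl → ℝ} (h0 : 0 < εb) (h1 : εb < 1 / 10)
    (hs : IsModifiedSlope (1 / 10) εb s) :
    IsVerticalLamination s (integralCurves centralField) where
  vertical γ hγ :=
    { hasDeriv := fun t ht => by
        rw [angVel_centralField hγ ht]; exact hasAngDerivWithin_centralField hγ ht
      continuousOn := by
        refine ContinuousOn.congr (f := fun t => centralField (pt γ t)) (fun t ht => ?_)
          fun t ht => angVel_centralField hγ ht
        exact (ContinuousAt.comp (g := centralField) (continuousAt_centralField (x := pt γ t) ht)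
          (continuous_pt γ).continuousAt).continuousWithinAt
      vertical := fun t ht => by
        rw [angVel_centralField hγ ht]
        exact centralField_vertical h0 h1 hs (not_mem_Indet ht) }
  disjoint γ₁ h₁ γ₂ h₂ t ht h := by
    ext u
    refine congrArg _ (uniquelyIntegrable_centralField γ₁ γ₂ 0 1 ?_ ?_ t ⟨t.2.1, t.2.2⟩ ht h u
      ⟨u.2.1, u.2.2⟩)
    · rwa [Icc.coe_zero, Icc.coe_one]
    · rwa [Icc.coe_zero, Icc.coe_one]
  product γ₀ _ t₀ ht₀ := by
    have ht : (t₀ : ℝ) < 1 := ht₀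
    refine ⟨(1 - t₀) / 2, by linarith, 1, one_pos, fun γ₁ h₁ _ η hη => ?_⟩
    have hK : IsCompact {x : Cyl | (x.2 : ℝ) ≤ (1 + t₀) / 2} :=
      (isClosed_le (by fun_prop) continuous_const).isCompact
    have hu := hK.uniformContinuousOn_of_continuous (f := centralField) fun x hx =>
      (continuousAt_centralField (lt_of_le_of_lt hx (by linarith))).continuousWithinAt
    obtain ⟨η', hη', hu⟩ := Metric.uniformContinuousOn_iff.1 hu η hη
    obtain ⟨δ, hδ, h⟩ := exists_forall_dist_lt h₁ ht₀ (lt_min hη hη')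
    refine ⟨δ, hδ, fun γ₂ h₂ hd t ht1 htε => ?_⟩
    have hdist := (ContinuousMap.dist_apply_le_dist (f := γ₂) (g := γ₁) t).trans_lt (h γ₂ h₂ hd)
    refine ⟨hdist.trans_le (min_le_left _ _), ?_⟩
    have htK : (t : ℝ) ≤ (1 + t₀) / 2 := by
      rw [Subtype.dist_eq, Real.dist_eq, abs_lt] at htε
      linarith [htε.2]
    rw [angVel_centralField h₁ ht1, angVel_centralField h₂ ht1, ← Real.dist_eq]
    refine hu (pt γ₂ t) htK (pt γ₁ t) htK ?_
    rw [Prod.dist_eq]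
    exact max_lt (hdist.trans_le (min_le_right _ _)) (by simpa [pt] using hη')

lemma pullback_integralCurves :
    pullback 1 (integralCurves centralField) = integralCurves centralField := by
  ext δ
  constructor
  · rintro ⟨γ, hγ, h⟩
    obtain ⟨k, hk⟩ := exists_isLift δ
    obtain ⟨k', hk', hi⟩ := exists_isLift_image hk h
    exact mem_integralCurves hk (isCentralOn_of_image subset_rfl
      (isCentralOn_of_mem_integralCurves hγ hk') hi)
  · intro hδ
    obtain ⟨k, hk⟩ := exists_isLift δ
    have hkc := isCentralOn_of_mem_integralCurves hδ hk
    obtain ⟨γ, hγ, q, hq, hqc, hq0⟩ := exists_integralCurve (φ := (nthImage 1 k 0).1)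
      (nthImage_mem 1 k zero_mem_Ico)
    have hp : ∀ ψ ∈ Ico 0 (π / 2),
        (liftMap (pull q ψ, ψ)).1 = q (liftMap (pull q ψ, ψ)).2 :=
      fun ψ hψ => pull_spec hqc.isCausal hψ
    have heq := hkc.eqOn subset_rfl (isCentralOn_of_image subset_rfl hqc hp) zero_mem_Ico
      (eq_pull hqc.isCausal zero_mem_Ico hq0.symm)
    refine ⟨γ, hγ, fun t ht => exists_RG_iterate_eq hk hq (fun ψ hψ => ?_) ht⟩
    rw [nthImage, heq hψ]
    exact hp ψ hψ

lemma isCentralFoliation_centralField {εb : ℝ} {s : Cyl → ℝ} (h0 : 0 < εb) (h1 : εb < 1 / 10)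
    (hs : IsModifiedSlope (1 / 10) εb s) :
    IsCentralFoliation s (integralCurves centralField) where
  lamination := isVerticalLamination_centralField h0 h1 hs
  fills z t ht := by
    obtain ⟨φ, hφ⟩ := Circle.exp_surjective z
    obtain ⟨γ, hγ, k, hk, -, hkφ⟩ := exists_integralCurve (φ := φ) (arcsin_mem_Ico ht)
    refine ⟨γ, hγ, ?_⟩
    rw [← projIcc_sin_arcsin t, ← hk.2, hkφ, hφ]
  invariant := pullback_integralCurves

/-- The central foliation is unique: all images of the leaves of an invariant foliation lie in its
leaves and so are causal, hence the leaves are central curves. -/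
lemma IsCentralFoliation.eq_integralCurves {s : Cyl → ℝ} (hs : ∀ x, algSlope x ≤ s x)
    {F : Set Curve} (hF : IsCentralFoliation s F) : F = integralCurves centralField := by
  have key : ∀ n : ℕ, ∀ γ ∈ F, ∀ k, IsLift γ k → ∀ a ∈ Ico 0 (π / 2), ∀ b ∈ Ico 0 (π / 2),
      Causal (liftMap^[n] (k a, a)) (liftMap^[n] (k b, b)) := by
    intro n
    induction n with
    | zero =>
      intro γ hγ k hk a ha b hb
      exact (hF.lamination.vertical γ hγ).isCausal hs hk a ha b hb
    | succ n ih =>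
      intro γ hγ k hk a ha b hb
      rw [← hF.invariant] at hγ
      obtain ⟨γ', hγ', h⟩ := hγ
      obtain ⟨k', hk', hi⟩ := exists_isLift_image hk h
      have h2 : ∀ a ∈ Ico 0 (π / 2),
          liftMap (k a, a) = (k' (liftMap (k a, a)).2, (liftMap (k a, a)).2) := fun a ha =>
        Prod.ext (hi a ha) rfl
      rw [Function.iterate_succ_apply, Function.iterate_succ_apply, h2 a ha, h2 b hb]
      exact ih γ' hγ' k' hk' _ (liftMap_mem (x := (k a, a)) ha) _ (liftMap_mem (x := (k b, b)) hb)
  have hsub : F ⊆ integralCurves centralField := fun γ hγ => by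
    obtain ⟨k, hk⟩ := exists_isLift γ
    exact mem_integralCurves hk fun n => key n γ hγ k hk
  refine hsub.antisymm fun γ hγ => ?_
  obtain ⟨γ', hγ', h⟩ := hF.fills (γ 0) 0 zero_lt_one
  have : γ' = γ := by
    ext u
    refine congrArg _ (uniquelyIntegrable_centralField γ' γ 0 1 ?_ ?_ 0 ⟨le_rfl, zero_le_one⟩
      zero_lt_one h u ⟨u.2.1, u.2.2⟩)
    · rw [Icc.coe_zero, Icc.coe_one]; exact hsub hγ'
    · rwa [Icc.coe_zero, Icc.coe_one]
  exact this ▸ hγ'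

/-! ### Exponential convergence of pullbacks -/

lemma hausdorffEDist_le_of_mem_dist {X : Type*} [PseudoMetricSpace X] {s t : Set X} {r : ℝ}
    (h₁ : ∀ x ∈ s, ∃ y ∈ t, dist x y ≤ r) (h₂ : ∀ x ∈ t, ∃ y ∈ s, dist x y ≤ r) :
    Metric.hausdorffEDist s t ≤ ENNReal.ofReal r := by
  refine Metric.hausdorffEDist_le_of_mem_edist (fun x hx => ?_) fun x hx => ?_
  · obtain ⟨y, hy, h⟩ := h₁ x hx
    exact ⟨y, hy, by rw [edist_dist]; exact ENNReal.ofReal_le_ofReal h⟩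
  · obtain ⟨y, hy, h⟩ := h₂ x hx
    exact ⟨y, hy, by rw [edist_dist]; exact ENNReal.ofReal_le_ofReal h⟩

lemma hausdorffEDist_pullback_le {s : Cyl → ℝ} (hs : ∀ x, algSlope x ≤ s x) {F : Set Curve}
    (hF : IsVerticalLamination s F) (hne : F.Nonempty) (n : ℕ) :
    Metric.hausdorffEDist (pullback n F) (integralCurves centralField) ≤
      ENNReal.ofReal (2 * π * (4 / 5) ^ n) := by
  refine hausdorffEDist_le_of_mem_dist ?_ fun γ hγ => ?_
  · rintro δ ⟨γ, hγ, h⟩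
    obtain ⟨k, hk⟩ := exists_isLift δ
    obtain ⟨q, hq, hi⟩ := exists_isLift_image hk h
    obtain ⟨γ', hγ', hd⟩ := exists_integralCurve_dist_le hk fun ψ hψ =>
      ((hF.vertical γ hγ).isCausal hs hq).abs_image_sub_le hi hψ zero_mem_Ico
    refine ⟨γ', hγ', hd.trans ?_⟩
    gcongr
    linarith [pi_pos]
  · obtain ⟨γ', hγ'⟩ := hne
    obtain ⟨q, hq⟩ := exists_isLift γ'
    obtain ⟨m, δ, k, hk, hi, hd⟩ :=
      exists_pull_dist_le (n := n) hγ ((hF.vertical γ' hγ').isCausal hs hq)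
    exact ⟨δ, ⟨γ', hγ', fun t ht => exists_RG_iterate_eq hk (hq.add m) hi ht⟩, hd⟩

/-! ### The renormalization of the partition function -/

/-- The partition function of `Γₙ`, conditioned on the spins `x`, `y` of the marked vertices. -/
noncomputable def condPart (n : ℕ) (z t : ℂ) (x y : Bool) : ℂ :=
  ∑ τ : Inner n → Bool, ∏ e : Edge n, bondWeight z t
    (Sum.elim (fun b => cond b y x) τ (ends n e).1) (Sum.elim (fun b => cond b y x) τ (ends n e).2)

lemma partitionFn_eq_sum (n : ℕ) (z t : ℂ) :
    partitionFn n z t = ∑ x, ∑ y, condPart n z t x y := by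
  let E : (Vertex n → Bool) ≃ Bool × Bool × (Inner n → Bool) :=
    { toFun := fun σ => (σ (Sum.inl false), σ (Sum.inl true), fun v => σ (Sum.inr v))
      invFun := fun q => Sum.elim (fun b => cond b q.2.1 q.1) q.2.2
      left_inv := fun σ => by
        funext v
        rcases v with (_ | _) | v <;> rfl
      right_inv := fun q => rfl }
  rw [partitionFn, ← E.symm.sum_comp, Fintype.sum_prod_type]
  refine Finset.sum_congr rfl fun x _ => ?_
  rw [Fintype.sum_prod_type]
  rfl

lemma condPart_zero (z t : ℂ) (x y : Bool) : condPart 0 z t x y = bondWeight z t x y := by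
  have : IsEmpty (Inner 0) := inferInstanceAs (IsEmpty Empty)
  have : Unique (Edge 0) := inferInstanceAs (Unique Unit)
  rw [condPart, Fintype.sum_unique, Fintype.prod_unique]
  rfl

/-- The conditional partition function of the diamond: the contributions of the two paths `acb` and
`adb` are equal and independent. -/
lemma condPart_succ (n : ℕ) (z t : ℂ) (x y : Bool) : condPart (n + 1) z t x y =
    (∑ c, condPart n z t x c * condPart n z t c y) ^ 2 := by
  let E : (Inner (n + 1) → Bool) ≃ Bool × Bool × (Fin 4 → Inner n → Bool) :=
    { toFun := fun τ => (τ (Sum.inl false : Bool ⊕ (Fin 4 × Inner n)),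
        τ (Sum.inl true : Bool ⊕ (Fin 4 × Inner n)),
        fun k v => τ (Sum.inr (k, v) : Bool ⊕ (Fin 4 × Inner n)))
      invFun := fun q => (Sum.elim (fun b => cond b q.2.1 q.1) (fun w => q.2.2 w.1 w.2) :
        Bool ⊕ (Fin 4 × Inner n) → Bool)
      left_inv := fun τ => by
        funext (v : Bool ⊕ (Fin 4 × Inner n))
        rcases v with (_ | _) | v <;> rfl
      right_inv := fun q => rfl }
  let X : Bool → Bool → Fin 4 → Bool := fun c d => ![x, c, x, d]
  let Y : Bool → Bool → Fin 4 → Bool := fun c d => ![c, y, d, y]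
  have hv : ∀ (c d : Bool) (τ : Fin 4 → Inner n → Bool) (k : Fin 4) (v : Vertex n),
      (Sum.elim (fun b => cond b y x) (E.symm (c, d, τ)) : Vertex (n + 1) → Bool) (copy n k v) =
        Sum.elim (fun b => cond b (Y c d k) (X c d k)) (τ k) v := by
    intro c d τ k v
    rcases v with b | v
    · fin_cases k <;> cases b <;> rfl
    · rfl
  have hprod : ∀ (c d : Bool) (τ : Fin 4 → Inner n → Bool),
      (∏ e : Edge (n + 1), bondWeight z t
        ((Sum.elim (fun b => cond b y x) (E.symm (c, d, τ)) : Vertex (n + 1) → Bool)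
          (ends (n + 1) e).1)
        ((Sum.elim (fun b => cond b y x) (E.symm (c, d, τ)) : Vertex (n + 1) → Bool)
          (ends (n + 1) e).2)) =
      ∏ k, ∏ e : Edge n, bondWeight z t
        (Sum.elim (fun b => cond b (Y c d k) (X c d k)) (τ k) (ends n e).1)
        (Sum.elim (fun b => cond b (Y c d k) (X c d k)) (τ k) (ends n e).2) := by
    intro c d τ
    rw [← Fintype.prod_prod_type']
    refine Fintype.prod_equiv (Equiv.refl _ : Edge (n + 1) ≃ Fin 4 × Edge n) _ _ fun e => ?_
    obtain ⟨k, e⟩ := e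
    exact congrArg₂ _ (hv c d τ k _) (hv c d τ k _)
  rw [condPart, ← E.symm.sum_comp, Fintype.sum_prod_type]
  have hsum : ∀ c d : Bool, ∑ τ : Fin 4 → Inner n → Bool, (∏ k, ∏ e : Edge n, bondWeight z t
        (Sum.elim (fun b => cond b (Y c d k) (X c d k)) (τ k) (ends n e).1)
        (Sum.elim (fun b => cond b (Y c d k) (X c d k)) (τ k) (ends n e).2)) =
      condPart n z t x c * condPart n z t c y * condPart n z t x d * condPart n z t d y := by
    intro c d
    have h := (Finset.prod_univ_sum (fun _ : Fin 4 => (Finset.univ : Finset (Inner n → Bool)))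
      fun k τ => ∏ e : Edge n, bondWeight z t
        (Sum.elim (fun b => cond b (Y c d k) (X c d k)) τ (ends n e).1)
        (Sum.elim (fun b => cond b (Y c d k) (X c d k)) τ (ends n e).2)).symm
    rw [Fintype.piFinset_univ] at h
    rw [h, Fin.prod_univ_four]
    rfl
  have hstep : ∀ c : Bool, (∑ q : Bool × (Fin 4 → Inner n → Bool), ∏ e : Edge (n + 1),
      bondWeight z t
        ((Sum.elim (fun b => cond b y x) (E.symm (c, q)) : Vertex (n + 1) → Bool)
          (ends (n + 1) e).1)
        ((Sum.elim (fun b => cond b y x) (E.symm (c, q)) : Vertex (n + 1) → Bool)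
          (ends (n + 1) e).2)) =
      ∑ d, condPart n z t x c * condPart n z t c y * condPart n z t x d * condPart n z t d y := by
    intro c
    rw [Fintype.sum_prod_type]
    refine Finset.sum_congr rfl fun d _ => ?_
    rw [← hsum]
    exact Finset.sum_congr rfl fun τ _ => hprod c d τ
  rw [Finset.sum_congr rfl fun c _ => hstep c]
  simp only [Fintype.sum_bool]
  ring

/-- The conditional partition functions are those of a single edge at the renormalized parameters,
up to a nonzero factor: the recursion for the factor is `c' = c⁴ |z² + t²|²`. -/
lemma exists_condPart_eq {p : ℝ × ℝ} (hp : p ∈ strip) (n : ℕ) :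
    ∃ c : ℂ, c ≠ 0 ∧ ∀ x y, condPart n (coverEmb p).1 (coverEmb p).2 x y =
      c * bondWeight (coverEmb (liftMap^[n] p)).1 (coverEmb (liftMap^[n] p)).2 x y := by
  induction n with
  | zero => exact ⟨1, one_ne_zero, fun x y => by rw [condPart_zero, one_mul]; rfl⟩
  | succ n ih =>
    obtain ⟨c, hc, h⟩ := ih
    have hq := iterate_mem hp n
    rw [Function.iterate_succ_apply']
    set q := liftMap^[n] p
    rw [← RG_coverEmb hq]
    have hz : (coverEmb q).1 ≠ 0 := Complex.exp_ne_zero _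
    have hden : ((coverEmb q).1 ^ 2 + (coverEmb q).2 ^ 2) *
        (((coverEmb q).1 ^ 2)⁻¹ + (coverEmb q).2 ^ 2) ≠ 0 := by
      have := mul_den_eq q.1 (sin q.2)
      simp only [coverEmb]
      rw [this]
      exact_mod_cast (den_pos (sin_mem hq).1 (sin_mem hq).2).ne'
    obtain ⟨hA, hB⟩ := mul_ne_zero_iff.1 hden
    refine ⟨c ^ 4 * (((coverEmb q).1 ^ 2 + (coverEmb q).2 ^ 2) *
        (((coverEmb q).1 ^ 2)⁻¹ + (coverEmb q).2 ^ 2)), mul_ne_zero (pow_ne_zero _ hc) hden,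
      fun x y => ?_⟩
    rw [condPart_succ]
    simp only [h, Fintype.sum_bool, RG]
    generalize (coverEmb q).1 = z at *
    generalize (coverEmb q).2 = t at *
    have hD : t ^ 2 * (z ^ 2 + (z ^ 2)⁻¹) + t ^ 4 + 1 =
        (z ^ 2 + t ^ 2) * ((z ^ 2)⁻¹ + t ^ 2) := by
      field_simp; ring
    have hmix : c ^ 4 * ((z ^ 2 + t ^ 2) * ((z ^ 2)⁻¹ + t ^ 2)) *
        (t ^ 2 * (z ^ 2 + (z ^ 2)⁻¹ + 2) / (t ^ 2 * (z ^ 2 + (z ^ 2)⁻¹) + t ^ 4 + 1)) =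
        (c * z⁻¹ * (c * t) + c * t * (c * z)) ^ 2 := by
      rw [hD, mul_assoc, mul_div_cancel₀ _ hden]
      field_simp
      ring
    cases x <;> cases y <;> simp only [bondWeight, reduceIte, Bool.false_eq_true, reduceCtorEq]
    · have h1 : ∀ a b : ℂ, b ≠ 0 → c ^ 4 * (a * b) * (a / b) = (c ^ 2 * a) ^ 2 := fun a b hb => by
        field_simp
      rw [h1 _ _ hB]
      ring
    · rw [hmix]
      ring
    · rw [hmix]
    · have h1 : ∀ a b : ℂ, a ≠ 0 → c ^ 4 * (a * b) * (a / b)⁻¹ = (c ^ 2 * b) ^ 2 := fun a b ha => by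
        field_simp
      rw [h1 _ _ hA, ← inv_pow]
      ring

/-- Below the top, the partition function vanishes exactly at the points whose `n`-th image lies on
the curve `t = - cos φ`: for a single edge it is `z⁻¹ + z + 2 t`. -/
lemma partitionFn_eq_zero_iff {p : ℝ × ℝ} (hp : p ∈ strip) (n : ℕ) :
    partitionFn n (coverEmb p).1 (coverEmb p).2 = 0 ↔
      cos (liftMap^[n] p).1 = -sin (liftMap^[n] p).2 := by
  obtain ⟨c, hc, h⟩ := exists_condPart_eq hp n
  rw [partitionFn_eq_sum]
  simp only [h, Fintype.sum_bool]
  simp only [bondWeight, reduceIte, Bool.false_eq_true, reduceCtorEq, coverEmb]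
  set q := liftMap^[n] p
  have hcos : Complex.exp (q.1 * Complex.I) + (Complex.exp (q.1 * Complex.I))⁻¹ =
      2 * (cos q.1 : ℂ) := by
    rw [← Complex.exp_neg, Complex.ofReal_cos, Complex.cos, neg_mul]
    ring
  have h1 : c * (Complex.exp (q.1 * Complex.I))⁻¹ + c * ((sin q.2 : ℝ) : ℂ) +
      (c * ((sin q.2 : ℝ) : ℂ) + c * Complex.exp (q.1 * Complex.I)) =
      2 * c * ((cos q.1 + sin q.2 : ℝ) : ℂ) := by
    rw [Complex.ofReal_add]
    linear_combination c * hcos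
  rw [h1, mul_eq_zero, Complex.ofReal_eq_zero, or_iff_right (mul_ne_zero two_ne_zero hc),
    add_eq_zero_iff_eq_neg]

/-! ### Convergence of the Lee-Yang loci -/

lemma mem_leeYang_iff {n : ℕ} {γ : Curve} {k : ℝ → ℝ} (hk : IsLift γ k) :
    γ ∈ leeYang n ↔ ∀ ψ ∈ Ico 0 (π / 2), cos (nthImage n k ψ).1 = -sin (nthImage n k ψ).2 := by
  have key : ∀ ψ ∈ Ico 0 (π / 2), ∀ t : unitInterval, IsOver (k ψ, ψ) (pt γ t) →
      (partitionFn n (γ t : ℂ) ((t : ℝ) : ℂ) = 0 ↔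
        cos (nthImage n k ψ).1 = -sin (nthImage n k ψ).2) := fun ψ hψ t ho => by
    have h1 := partitionFn_eq_zero_iff (p := (k ψ, ψ)) hψ n
    rwa [← ho.emb_eq] at h1
  constructor
  · exact fun h ψ hψ => (key ψ hψ _ (hk.isOver hψ)).1 (h _)
  · intro h
    have hb : ∀ x y, Continuous fun t : unitInterval =>
        bondWeight (γ t : ℂ) ((t : ℝ) : ℂ) x y := by
      intro x y
      have hγ : Continuous fun t => (γ t : ℂ) := by fun_prop
      unfold bondWeight
      split_ifs
      · exact hγ.inv₀ fun t => Circle.coe_ne_zero _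
      · exact hγ
      · fun_prop
    have hc : Continuous fun t : unitInterval => partitionFn n (γ t : ℂ) ((t : ℝ) : ℂ) :=
      continuous_finsetSum _ fun σ _ => continuous_finsetProd _ fun e _ => hb _ _
    refine congrFun (Continuous.ext_on dense_Iio_one hc continuous_const fun t ht => ?_)
    exact (key _ (arcsin_mem_Ico ht) t (hk.isOver_arcsin ht)).2 (h _ (arcsin_mem_Ico ht))

/-- A continuous function with `cos ≤ 0` cannot cross a multiple of `2π`. -/
lemma abs_sub_le_of_cos_nonpos {f : ℝ → ℝ} {S : Set ℝ} (hS : IsPreconnected S)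
    (hf : ContinuousOn f S) (h : ∀ a ∈ S, cos (f a) ≤ 0) {a b : ℝ} (ha : a ∈ S) (hb : b ∈ S) :
    |f a - f b| ≤ 2 * π := by
  wlog hab : f b ≤ f a generalizing a b
  · rw [abs_sub_comm]; exact this hb ha (not_le.1 hab).le
  rw [abs_of_nonneg (sub_nonneg.2 hab)]
  by_contra! hn
  have h1 := Int.le_ceil (f b / (2 * π))
  have h2 := Int.ceil_lt_add_one (f b / (2 * π))
  set m := ⌈f b / (2 * π)⌉
  rw [div_le_iff₀ two_pi_pos] at h1
  rw [← sub_lt_iff_lt_add, lt_div_iff₀ two_pi_pos] at h2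
  have h3 : (m : ℝ) * (2 * π) ∈ Icc (f b) (f a) := ⟨h1, by linarith⟩
  obtain ⟨c, hc, hcm⟩ := hS.intermediate_value hb ha hf h3
  have h4 := h c hc
  rw [hcm, cos_int_mul_two_pi] at h4
  linarith

lemma hausdorffEDist_leeYang_le (n : ℕ) :
    Metric.hausdorffEDist (leeYang n) (integralCurves centralField) ≤
      ENNReal.ofReal (3 * π * (4 / 5) ^ n) := by
  refine hausdorffEDist_le_of_mem_dist (fun δ hδ => ?_) fun γ hγ => ?_
  · obtain ⟨k, hk⟩ := exists_isLift δ
    have h := (mem_leeYang_iff hk).1 hδ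
    obtain ⟨γ, hγ, hd⟩ := exists_integralCurve_dist_le (n := n) hk (d := 2 * π) fun ψ hψ =>
      abs_sub_le_of_cos_nonpos (f := fun ψ => (nthImage n k ψ).1) isPreconnected_Ico
        (continuousOn_nthImage n hk.1.continuousOn).fst
        (fun a ha => by
          rw [h a ha]; linarith [(sin_mem (nthImage_mem n k ha)).1]) hψ zero_mem_Ico
    refine ⟨γ, hγ, hd.trans ?_⟩
    gcongr
    linarith [pi_pos]
  · -- the curve `t = - cos φ` is `φ = π / 2 + ψ`
    obtain ⟨m, δ, k, hk, hi, hd⟩ := exists_pull_dist_le (n := n) hγ (q := fun ψ => π / 2 + ψ)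
      fun a _ b _ => by simp
    refine ⟨δ, (mem_leeYang_iff hk).2 fun ψ hψ => ?_, hd.trans ?_⟩
    · rw [hi ψ hψ, cos_add_int_mul_two_pi, add_comm, cos_add_pi_div_two]
    · gcongr
      linarith [pi_pos]

end DHL

theorem mainTheorem7 :
    ∃ (l : DHL.Cyl → ℝ) (κ r : ℝ), 0 < κ ∧ 0 < r ∧ r < 1 ∧
      DHL.UniquelyIntegrable l ∧
      (∀ (εb : ℝ) (s : DHL.Cyl → ℝ), 0 < εb → εb < κ → DHL.IsModifiedSlope κ εb s →
        -- the central line field exists and is unique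
        DHL.IsCentralLineField s l ∧
        (∀ l', DHL.IsCentralLineField s l' →
          Set.EqOn l' l (DHL.Indet ∪ DHL.PreIndet)ᶜ) ∧
        -- its integral curves form a central foliation, which is the only one
        DHL.IsCentralFoliation s (DHL.integralCurves l) ∧
        (∀ F, DHL.IsCentralFoliation s F → F = DHL.integralCurves l) ∧
        -- exponential convergence of the pullbacks, with the same rate for all laminations
        (∀ F : Set DHL.Curve, DHL.IsVerticalLamination s F → F.Nonempty →
          ∃ C : ℝ, 0 < C ∧ ∀ n : ℕ,
            Metric.hausdorffEDist (DHL.pullback n F) (DHL.integralCurves l) ≤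
              ENNReal.ofReal (C * r ^ n))) ∧
      -- exponential convergence of the Lee-Yang loci
      (∃ C : ℝ, 0 < C ∧ ∀ n : ℕ,
        Metric.hausdorffEDist (DHL.leeYang n) (DHL.integralCurves l) ≤
          ENNReal.ofReal (C * r ^ n)) := by
  refine ⟨DHL.centralField, 1 / 10, 4 / 5, by norm_num, by norm_num, by norm_num,
    DHL.uniquelyIntegrable_centralField, fun εb s h0 h1 hs => ?_,
    3 * Real.pi, by positivity, DHL.hausdorffEDist_leeYang_le⟩
  exact ⟨DHL.isCentralLineField_centralField h0 h1 hs,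
    fun l' hl' => DHL.eq_centralField hs.alg_le hl',
    DHL.isCentralFoliation_centralField h0 h1 hs,
    fun F hF => hF.eq_integralCurves hs.alg_le,
    fun F hF hne => ⟨2 * Real.pi, by positivity,
      DHL.hausdorffEDist_pullback_le hs.alg_le hF hne⟩⟩
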